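/- Consider the external memory model with an internal memory of $M$ words (plus a constant number of registers) and an unbounded disk divided into blocks of $B$ words, where $1\le B\le M/2$ and $M\ge a B^{1+\varepsilon}$ (tall cache) for constants $a,\varepsilon>0$. A word holds an element of a totally ordered universe or an integer of $O(\log N)$ bits. Programs are deterministic and comparison-based (elements can only be copied and compared), keep all their state in the words of the internal memory and of the disk, and internal computation is free; the cost is the number of I/Os, each of which reads or writes one block. An array $A$ of $N$ elements is stored, unsorted, in the first $n=\lceil N/B\rceil$ blocks of the disk; put $m=M/B$. A query is either $\mathrm{select}(s)$, $1\le s\le N$, whose answer is the element at position $s$ of the sorted array, or $\mathrm{search}(p)$, whose answer is the position (counted from $1$) of the first occurrence of $p$ in the sorted array if $p$ occurs in $A$, and the number of elements of $A$ smaller than $p$ otherwise. Queries are online: each is revealed only after the preceding one has been answered. For a sequence of $q$ queries, let $s_1\le\dots\le s_q$ be the sorted list of the positions $s$ of the selection queries and of the answers of the search queries (an answer $0$ being replaced by $1$), let $s_0=1$, $s_{q+1}=N$, $\Delta_i=s_{i+1}-s_i$, and $$\mathcal B_m(S_q)=n\log_m n-\sum_{i=0}^{q}\frac{\Delta_i}{B}\log_m\frac{\Delta_i}{B},$$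 where $\log_m(\Delta_i/B)$ is read as $0$ when $\Delta_i<M$. Then there is a deterministic algorithm (a program for each $N$, $M$, $B$, with constants in the number of registers and the word size that do not depend on $N,M,B$) such that for all constants $c,a,\varepsilon,\kappa>0$ there is a constant $C$ with the following property. Whenever $1\le B\le M/2$, $M\ge aB^{1+\varepsilon}$ and $\log_2 N\le cB$, then for every array $A$ of $N$ elements of any totally ordered universe and every sequence of $q\le\kappa N$ online selection and search queries, the algorithm answers all the queries correctly and uses in total at most $$C\bigl(\mathcal B_m(S_q)+\min\{qm,N\}\log_B N+n\bigr)$$ I/Os (where $\log_B N$ is read as $0$ if $B=1$ or $N=0$). -/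

import Mathlib

namespace ExtMem

universe u

/-- The content of one memory cell: an element of the ordered universe `α`, or an integer. -/
inductive Word (α : Type u) : Type u
  | key (a : α)
  | num (k : ℕ)

/-- All that a comparison-based program can see of an internal memory of `R` cells: the integers
stored in the integer cells (`none` at a cell that holds an element), and the outcomes of all
comparisons between cells that hold elements. -/
structure View (R : ℕ) where
  int : Fin R → Option ℕ
  le : Fin R → Fin R → Bool

/-- The new content of an internal cell: a copy of an old cell, or an integer below `W`. -/
inductive Source (R W : ℕ)
  | copy (c : Fin R)
  | const (k : Fin W)

/-- What ends a phase of internal computation: one I/O (a transfer of one block between disk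
address `addr`, an integer below `W`, and the internal cells `base, base + 1, …`), or the output of
the word in internal cell `c` as the answer to the current query. -/
inductive Command (R W : ℕ)
  | read (addr : Fin W) (base : ℕ)
  | write (addr : Fin W) (base : ℕ)
  | answer (c : Fin R)

/-- A deterministic comparison-based program for `R` internal cells whose integers are below `W`.
As internal computation is free, the computation between two consecutive I/Os is one function. The
program has no state besides the internal cells and the disk; elements can be compared and copied
only. -/
def Program (R W : ℕ) : Type := View R → (Fin R → Source R W) × Command R W

/-- `R` internal cells and an unbounded disk whose blocks have `B` cells. -/
structure Config (α : Type u) (R B : ℕ) where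
  mem : Fin R → Word α
  disk : ℕ → Fin B → Word α

/-- An online query on an array of length `N`. The index `i` counts from `0`: `select i` asks for
the element of rank `i + 1`. -/
inductive Query (α : Type u) (N : ℕ) : Type u
  | select (i : Fin N)
  | search (p : α)

section Machine

variable {α : Type u} [LinearOrder α] {R W B N : ℕ}

def Word.int? : Word α → Option ℕ
  | .key _ => none
  | .num k => some k

def Word.le : Word α → Word α → Bool
  | .key a, .key b => decide (a ≤ b)
  | _, _ => false

def viewOf (mem : Fin R → Word α) : View R where
  int c := (mem c).int?
  le c d := (mem c).le (mem d)

def Source.eval (mem : Fin R → Word α) : Source R W → Word α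
  | .copy c => mem c
  | .const k => .num k

/-- The internal memory after the internal computation that precedes the next command. -/
def Program.compute (P : Program R W) (mem : Fin R → Word α) : Fin R → Word α :=
  fun c => ((P (viewOf mem)).1 c).eval mem

/-- The next command. -/
def Program.command (P : Program R W) (mem : Fin R → Word α) : Command R W :=
  (P (viewOf mem)).2

/-- The internal memory after a block has been copied to the cells `base, …, base + B - 1`. -/
def fetch (mem : Fin R → Word α) (base : ℕ) (blk : Fin B → Word α) : Fin R → Word α :=
  fun c => if h : base ≤ c.val ∧ c.val < base + B then blk ⟨c.val - base, by omega⟩ else mem c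

/-- The block formed by the cells `base, …, base + B - 1` (padded if there are not so many). -/
def blockAt (mem : Fin R → Word α) (base : ℕ) : Fin B → Word α :=
  fun j => if h : base + j.val < R then mem ⟨base + j.val, h⟩ else .num 0

/-- `Serves P cfg t w cfg'`: started in `cfg`, the program performs exactly `t` I/Os, then answers
`w`, and is left in configuration `cfg'`. -/
inductive Serves (P : Program R W) : Config α R B → ℕ → Word α → Config α R B → Prop
  | answer (cfg : Config α R B) (c : Fin R) (h : P.command cfg.mem = .answer c) :
      Serves P cfg 0 (P.compute cfg.mem c) ⟨P.compute cfg.mem, cfg.disk⟩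
  | read (cfg cfg' : Config α R B) (addr : Fin W) (base t : ℕ) (w : Word α)
      (h : P.command cfg.mem = .read addr base)
      (rest : Serves P ⟨fetch (P.compute cfg.mem) base (cfg.disk addr), cfg.disk⟩ t w cfg') :
      Serves P cfg (t + 1) w cfg'
  | write (cfg cfg' : Config α R B) (addr : Fin W) (base t : ℕ) (w : Word α)
      (h : P.command cfg.mem = .write addr base)
      (rest : Serves P ⟨P.compute cfg.mem,
        Function.update cfg.disk addr (blockAt (P.compute cfg.mem) base)⟩ t w cfg') :
      Serves P cfg (t + 1) w cfg'

/-- A selection query arrives as an integer (the rank), a search query as an element. -/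
def Query.word : Query α N → Word α
  | .select i => .num (i.val + 1)
  | .search p => .key p

/-- A query arrives in internal cell `0`. -/
def Config.receive (cfg : Config α R B) (Q : Query α N) : Config α R B where
  mem c := if c.val = 0 then Q.word else cfg.mem c
  disk := cfg.disk

/-- `ServesAll P cfg qs ws t`: the queries `qs` are presented one at a time, each after the previous
one has been answered; the answers are `ws`, and exactly `t` I/Os are performed altogether. -/
inductive ServesAll (P : Program R W) :
    Config α R B → List (Query α N) → List (Word α) → ℕ → Prop
  | nil (cfg : Config α R B) : ServesAll P cfg [] [] 0
  | cons (cfg cfg' : Config α R B) (Q : Query α N) (qs : List (Query α N)) (w : Word α)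
      (ws : List (Word α)) (t t' : ℕ) (first : Serves P (cfg.receive Q) t w cfg')
      (rest : ServesAll P cfg' qs ws t') : ServesAll P cfg (Q :: qs) (w :: ws) (t + t')

/-- Initially the array occupies the first `⌈N / B⌉` blocks of the disk, in array order, and the
internal memory holds no information. -/
def initial (R B : ℕ) (A : Fin N → α) : Config α R B where
  mem _ := .num 0
  disk i j := if h : i * B + j.val < N then .key (A ⟨i * B + j.val, h⟩) else .num 0

/-- The position, counted from `1`, of the first occurrence of `p` in the array if it were sorted;
the number of smaller elements if `p` does not occur. -/
def searchPos (A : Fin N → α) (p : α) : ℕ :=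
  (Finset.univ.filter fun i => A i < p).card + if ∃ i, A i = p then 1 else 0

/-- The position that a query contributes to the set `S_q`. -/
def Query.pos (A : Fin N → α) : Query α N → ℕ
  | .select i => i.val + 1
  | .search p => searchPos A p

/-- The correct answer: the entry of the sorted array for a selection, the position for a search. -/
def Query.correct (A : Fin N → α) : Query α N → Word α
  | .select i => .key (A (Tuple.sort A i))
  | .search p => .num (searchPos A p)

end Machine

/-- The gaps `Δ_i = s_{i+1} - s_i` between the consecutive positions of `S_q` in sorted order, where
the positions `1` and `N` are added to the queried ones. -/
def gaps (N : ℕ) (pos : List ℕ) : List ℕ :=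
  let s := (1 :: N :: pos).insertionSort (· ≤ ·)
  List.zipWith (fun a b => b - a) s s.tail

noncomputable section

/-- `n`, the number of blocks of the input. -/
def nBlocks (N B : ℕ) : ℝ := (⌈(N : ℝ) / B⌉₊ : ℝ)

/-- `m = M / B`, the number of blocks of internal memory. -/
def mBlocks (M B : ℕ) : ℝ := (M : ℝ) / B

/-- `log_m (Δ / B)`, read as `0` when `Δ < M`. -/
def gapLog (M B Δ : ℕ) : ℝ :=
  if Δ < M then 0 else Real.logb (mBlocks M B) ((Δ : ℝ) / B)

/-- `n log_m n - ∑ᵢ (Δᵢ / B) log_m (Δᵢ / B)`. -/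
def ioBound (N M B : ℕ) (pos : List ℕ) : ℝ :=
  nBlocks N B * Real.logb (mBlocks M B) (nBlocks N B)
    - ((gaps N pos).map fun Δ : ℕ => (Δ : ℝ) / B * gapLog M B Δ).sum

end

end ExtMem

namespace ExtMem

universe u v

/-! ### An abstract machine whose state is structured, and its implementation -/

/-- Relabelling the elements in a word. -/
def Word.map {α : Type u} {β : Type v} (g : β → α) : Word β → Word α
  | .key x => .key (g x)
  | .num k => .num k

/-- The element in a word, if there is one. -/
def Word.key? {α : Type u} : Word α → Option α
  | .key x => some x
  | .num _ => none

/-- The integer in a word, `0` at an element. -/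
def Word.toNat {α : Type u} : Word α → ℕ
  | .key _ => 0
  | .num k => k

/-- A node of the search tree: its level, the offset of its parent, its index among its siblings,
its offset in the sorted array and its number of elements. -/
structure Node where
  lev : ℕ
  plo : ℕ
  ch : ℕ
  lo : ℕ
  sz : ℕ

/-- The structured content of the internal memory. -/
structure St (β : Type u) (B : ℕ) : Type u where
  pc : ℕ
  nd : Node
  h : ℕ
  fs : ℕ
  i : ℕ
  o : ℕ
  jl : ℕ
  u : ℕ
  ld : ℕ
  piv : List β
  pool : List β
  nums : List ℕ
  buf : Fin B → Word β

/-- What the abstract machine does at the end of an internal computation. All I/Os go through the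
buffer. -/
inductive Cmd (β : Type u) : Type u
  | read (a : ℕ)
  | write (a : ℕ)
  | answer (w : Word β)

section Relabel

variable {α : Type u} {β : Type v} {B : ℕ}

def St.map (g : β → α) (s : St β B) : St α B where
  pc := s.pc
  nd := s.nd
  h := s.h
  fs := s.fs
  i := s.i
  o := s.o
  jl := s.jl
  u := s.u
  ld := s.ld
  piv := s.piv.map g
  pool := s.pool.map g
  nums := s.nums
  buf := fun j => (s.buf j).map g

def Cmd.map (g : β → α) : Cmd β → Cmd α
  | .read a => .read a
  | .write a => .write a
  | .answer w => .answer (w.map g)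

end Relabel

section Layout

variable {α : Type u} {β : Type v} {B : ℕ}

def St.ctl (s : St α B) : List ℕ :=
  [s.pc, s.nd.lev, s.nd.plo, s.nd.ch, s.nd.lo, s.nd.sz, s.h, s.fs, s.i, s.o, s.jl, s.u, s.ld]

/-- A list of elements stored in consecutive cells, padded with zeros. -/
def areaKey (xs : List α) (i : ℕ) : Word α :=
  if h : i < xs.length then .key xs[i] else .num 0

/-- A list of integers stored in consecutive cells; `0` marks an unused cell. -/
def areaNum (ns : List ℕ) (i : ℕ) : Word α :=
  if h : i < ns.length then .num (ns[i] + 1) else .num 0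

/-- The layout of the internal memory; `cp` is the capacity of each of the three lists. -/
def encode (cp : ℕ) (q ans : Word α) (s : St α B) (c : ℕ) : Word α :=
  if c = 0 then q
  else if c = 1 then ans
  else if c < 15 then .num (s.ctl.getD (c - 2) 0)
  else if h : 15 ≤ c ∧ c < 15 + B then s.buf ⟨c - 15, by omega⟩
  else if c < 15 + B + cp then areaKey s.piv (c - (15 + B))
  else if c < 15 + B + 2 * cp then areaKey s.pool (c - (15 + B + cp))
  else if c < 15 + B + 3 * cp then areaNum s.nums (c - (15 + B + 2 * cp))
  else .num 0

def readKeys (w : ℕ → Word α) (base cp : ℕ) : List α :=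
  (List.range cp).filterMap fun i => (w (base + i)).key?

def readNums (w : ℕ → Word α) (base cp : ℕ) : List ℕ :=
  (List.range cp).filterMap fun i => if (w (base + i)).toNat = 0 then none
    else some ((w (base + i)).toNat - 1)

def decode (cp : ℕ) (w : ℕ → Word α) : St α B where
  pc := (w 2).toNat
  nd := ⟨(w 3).toNat, (w 4).toNat, (w 5).toNat, (w 6).toNat, (w 7).toNat⟩
  h := (w 8).toNat
  fs := (w 9).toNat
  i := (w 10).toNat
  o := (w 11).toNat
  jl := (w 12).toNat
  u := (w 13).toNat
  ld := (w 14).toNat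
  piv := readKeys w (15 + B) cp
  pool := readKeys w (15 + B + cp) cp
  nums := readNums w (15 + B + 2 * cp) cp
  buf := fun j => w (15 + j.val)

theorem Word.map_key? (g : β → α) (w : Word β) : (w.map g).key? = w.key?.map g := by
  cases w <;> rfl

theorem Word.map_toNat (g : β → α) (w : Word β) : (w.map g).toNat = w.toNat := by
  cases w <;> rfl

theorem readKeys_map (g : β → α) (w : ℕ → Word β) (base cp : ℕ) :
    readKeys (fun c => (w c).map g) base cp = (readKeys w base cp).map g := by
  simp [readKeys, List.map_filterMap, Word.map_key?]

theorem decode_map (g : β → α) (cp : ℕ) (w : ℕ → Word β) :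
    (decode cp (fun c => (w c).map g) : St α B) = (decode cp w : St β B).map g := by
  simp [decode, St.map, readKeys_map, readNums, Word.map_toNat]

theorem areaKey_map (g : β → α) (xs : List β) (i : ℕ) :
    areaKey (xs.map g) i = (areaKey xs i).map g := by
  unfold areaKey
  by_cases h : i < xs.length <;> simp [h, Word.map]

theorem areaNum_map (g : β → α) (ns : List ℕ) (i : ℕ) :
    areaNum ns i = (areaNum ns i : Word β).map g := by
  unfold areaNum
  split_ifs <;> rfl

theorem encode_map (g : β → α) (cp : ℕ) (q ans : Word β) (s : St β B) (c : ℕ) :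
    encode cp (q.map g) (ans.map g) (s.map g) c = (encode cp q ans s c).map g := by
  unfold encode
  split_ifs
  · rfl
  · rfl
  · rfl
  · rfl
  · exact areaKey_map g _ _
  · exact areaKey_map g _ _
  · exact areaNum_map g _ _
  · rfl

theorem filterMap_range_getElem? {γ : Type*} (xs : List γ) (cp : ℕ) (h : xs.length ≤ cp) :
    (List.range cp).filterMap (fun i => xs[i]?) = xs := by
  induction xs generalizing cp with
  | nil => simp
  | cons x xs ih =>
    obtain ⟨c, rfl⟩ : ∃ c, cp = c + 1 := ⟨cp - 1, by simp at h; omega⟩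
    rw [List.range_succ_eq_map]
    simp only [List.filterMap_cons, List.getElem?_cons_zero, List.filterMap_map]
    have := ih c (by simpa using h)
    simpa [Function.comp_def] using this

theorem areaKey_key? (xs : List α) (i : ℕ) : (areaKey xs i).key? = xs[i]? := by
  unfold areaKey
  split_ifs with h <;> simp [Word.key?, h]

theorem decode_encode (cp : ℕ) (q ans : Word α) (s : St α B) (h1 : s.piv.length ≤ cp)
    (h2 : s.pool.length ≤ cp) (h3 : s.nums.length ≤ cp) :
    decode cp (encode cp q ans s) = s := by
  have e1 : readKeys (encode cp q ans s) (15 + B) cp = s.piv := by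
    refine Eq.trans (List.filterMap_congr fun i hi => ?_) (filterMap_range_getElem? s.piv cp h1)
    rw [List.mem_range] at hi
    rw [← areaKey_key?]
    unfold encode
    simp (disch := omega) only [if_neg, if_pos, dif_neg]
    congr 2; omega
  have e2 : readKeys (encode cp q ans s) (15 + B + cp) cp = s.pool := by
    refine Eq.trans (List.filterMap_congr fun i hi => ?_) (filterMap_range_getElem? s.pool cp h2)
    rw [List.mem_range] at hi
    rw [← areaKey_key?]
    unfold encode
    simp (disch := omega) only [if_neg, if_pos, dif_neg]
    congr 2; omega
  have e3 : readNums (encode cp q ans s) (15 + B + 2 * cp) cp = s.nums := by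
    refine Eq.trans (List.filterMap_congr fun i hi => ?_) (filterMap_range_getElem? s.nums cp h3)
    rw [List.mem_range] at hi
    have : encode cp q ans s (15 + B + 2 * cp + i) = areaNum s.nums i := by
      unfold encode
      simp (disch := omega) only [if_neg, if_pos, dif_neg]
      congr 1; omega
    rw [this]
    unfold areaNum
    split_ifs with h <;> simp_all [Word.toNat]
  have e4 : (fun j : Fin B => encode cp q ans s (15 + j.val)) = s.buf := by
    funext j
    have := j.2
    unfold encode
    simp (disch := omega) only [if_neg, dif_pos]
    congr 1; ext; simp
  unfold decode
  rw [e1, e2, e3, e4]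
  simp [encode, St.ctl, Word.toNat]

end Layout

/-! ### The program that implements an abstract machine -/

section Implementation

variable {R W B : ℕ}

/-- The cells that hold an element. -/
abbrev KeyCell (v : View R) : Type := {c : Fin R // v.int c = none}

/-- The symbolic content of the memory, in which an element is represented by its cell. -/
def symb (v : View R) (c : ℕ) : Word (KeyCell v) :=
  if h : c < R then
    match e : v.int ⟨c, h⟩ with
    | some k => .num k
    | none => .key ⟨⟨c, h⟩, e⟩
  else .num 0

def toSource (v : View R) (c : Fin R) : Word (KeyCell v) → Source R W
  | .key x => .copy x.1
  | .num k => if v.int c = some k then .copy c else if h : k < W then .const ⟨k, h⟩ else .copy c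

def toCommand {γ : Type} (hR : 1 < R) : Cmd γ → Command R W
  | .read a => if h : a < W then .read ⟨a, h⟩ 15 else .answer ⟨1, hR⟩
  | .write a => if h : a < W then .write ⟨a, h⟩ 15 else .answer ⟨1, hR⟩
  | .answer _ => .answer ⟨1, hR⟩

def Cmd.ans {γ : Type u} : Cmd γ → Word γ
  | .answer w => w
  | _ => .num 0

/-- A comparison-based internal computation of the abstract machine. -/
abbrev Step (β : Type u) (B : ℕ) := (β → β → Bool) → Word β → St β B → St β B × Cmd β

def implement (hR : 1 < R) (cp : ℕ) (f : (β : Type) → Step β B) : Program R W := fun v =>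
  let q := symb v 0
  let out := f (KeyCell v) (fun c d => v.le c.1 d.1) q (decode cp (symb v))
  (fun c => toSource v c (encode cp q out.2.ans out.1 c), toCommand hR out.2)

variable {α : Type u} [LinearOrder α]

/-- Naturality of a step function: it treats elements as black boxes. -/
def Natural (f : (β : Type) → Step β B) (fα : Step α B) : Prop :=
  ∀ (β : Type) (g : β → α) (le : β → β → Bool), (∀ x y, le x y = decide (g x ≤ g y)) →
    ∀ q s, fα (fun x y => decide (x ≤ y)) (q.map g) (s.map g)
      = ((f β le q s).1.map g, (f β le q s).2.map g)

/-- The size conditions under which a state fits into the memory after a step from `s₀`. -/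
structure Fits (W cp : ℕ) (s₀ s : St α B) : Prop where
  ctl : ∀ k ∈ s.ctl, k < W
  nums : ∀ k ∈ s.nums, k + 1 < W
  piv_len : s.piv.length ≤ cp
  pool_len : s.pool.length ≤ cp
  nums_len : s.nums.length ≤ cp
  buf : s.buf = s₀.buf ∨ ∀ j k, s.buf j = .num k → k < W

theorem exists_keyOf (mem : Fin R → Word α) :
    ∃ g : KeyCell (viewOf mem) → α, (∀ x y, (viewOf mem).le x.1 y.1 = decide (g x ≤ g y)) ∧
      (∀ x, mem x.1 = .key (g x)) := by
  have : ∀ x : KeyCell (viewOf mem), ∃ a, mem x.1 = .key a := by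
    rintro ⟨c, hc⟩
    simp only [viewOf] at hc
    cases h : mem c with
    | key a => exact ⟨a, rfl⟩
    | num k => simp [h, Word.int?] at hc
  choose g hg using this
  exact ⟨g, fun x y => by simp [viewOf, hg, Word.le], hg⟩

theorem symb_map (mem : Fin R → Word α) (g : KeyCell (viewOf mem) → α)
    (hg : ∀ x, mem x.1 = .key (g x)) (c : Fin R) : (symb (viewOf mem) c).map g = mem c := by
  unfold symb
  rw [dif_pos c.2]
  split
  · rename_i k e
    simp only [viewOf] at e
    cases h : mem c with
    | key a => simp [h, Word.int?] at e
    | num k' => simp [h, Word.int?] at e; simp [Word.map, e]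
  · rename_i e
    exact (hg ⟨c, e⟩).symm

/-- The memory `mem` represents the query `q` and the state `s`. -/
def Repr (cp : ℕ) (q : Word α) (s : St α B) (mem : Fin R → Word α) : Prop :=
  ∃ ans, ∀ c : Fin R, mem c = encode cp q ans s c

theorem decode_congr {γ : Type u} (cp : ℕ) (w w' : ℕ → Word γ)
    (h : ∀ c < 15 + B + 3 * cp, w c = w' c) : (decode cp w : St γ B) = decode cp w' := by
  have key : ∀ base, base + cp ≤ 15 + B + 3 * cp → readKeys w base cp = readKeys w' base cp := by
    intro base hb
    refine List.filterMap_congr fun i hi => ?_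
    rw [List.mem_range] at hi
    rw [h _ (by omega)]
  have num : readNums w (15 + B + 2 * cp) cp = readNums w' (15 + B + 2 * cp) cp := by
    refine List.filterMap_congr fun i hi => ?_
    rw [List.mem_range] at hi
    rw [h _ (by omega)]
  have bf : (fun j : Fin B => w (15 + j.val)) = fun j : Fin B => w' (15 + j.val) := by
    funext j
    exact h _ (by have := j.2; omega)
  unfold decode
  rw [key _ (by omega), key _ (by omega), num, bf]
  simp (disch := omega) only [h]

theorem implement_step {cp : ℕ} (hR : 1 < R) (hcp : 15 + B + 3 * cp ≤ R)
    {f : (β : Type) → Step β B} {fα : Step α B} (hf : Natural f fα) {q : Word α} {s : St α B}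
    {mem : Fin R → Word α} (hm : Repr cp q s mem)
    (h1 : s.piv.length ≤ cp) (h2 : s.pool.length ≤ cp) (h3 : s.nums.length ≤ cp)
    (hfit : Fits W cp s (fα (fun x y => decide (x ≤ y)) q s).1)
    (hans : ∀ k, (fα (fun x y => decide (x ≤ y)) q s).2.ans = .num k → k < W) :
    (∀ c : Fin R, (implement hR cp f : Program R W).compute mem c
      = encode cp q (fα (fun x y => decide (x ≤ y)) q s).2.ans
          (fα (fun x y => decide (x ≤ y)) q s).1 c) ∧
    (implement hR cp f : Program R W).command mem
      = toCommand hR ((fα (fun x y => decide (x ≤ y)) q s).2.map (fun _ => ())) := by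
  obtain ⟨g, hle, hg⟩ := exists_keyOf mem
  obtain ⟨ans, hmem⟩ := hm
  have hq : (symb (viewOf mem) 0).map g = q := by
    have := symb_map mem g hg ⟨0, by omega⟩
    rw [hmem] at this
    simpa [encode] using this
  have hs : (decode cp (symb (viewOf mem)) : St (KeyCell (viewOf mem)) B).map g = s := by
    rw [← decode_map, ← decode_encode cp q ans s h1 h2 h3]
    apply decode_congr
    intro c hc
    have := symb_map mem g hg ⟨c, by omega⟩
    rw [hmem] at this
    exact this
  have key := hf (KeyCell (viewOf mem)) g (fun c d => (viewOf mem).le c.1 d.1) hle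
    (symb (viewOf mem) 0) (decode cp (symb (viewOf mem)))
  rw [hq, hs] at key
  set out := f (KeyCell (viewOf mem)) (fun c d => (viewOf mem).le c.1 d.1)
    (symb (viewOf mem) 0) (decode cp (symb (viewOf mem))) with hout
  have e1 : (fα (fun x y => decide (x ≤ y)) q s).1 = out.1.map g := by rw [key]
  have e2 : (fα (fun x y => decide (x ≤ y)) q s).2 = out.2.map g := by rw [key]
  have hans' : (out.2.map g).ans = out.2.ans.map g := by cases out.2 <;> rfl
  constructor
  · intro c
    rw [e1, e2, hans', ← hq, encode_map]
    show Source.eval mem (toSource (viewOf mem) c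
      (encode cp (symb (viewOf mem) 0) out.2.ans out.1 c)) = _
    cases hw : encode cp (symb (viewOf mem) 0) out.2.ans out.1 c with
    | key x => simp [toSource, Source.eval, Word.map, hg]
    | num k =>
      have hint : (viewOf mem).int c = some k → mem c = .num k := by
        intro h
        simp only [viewOf] at h
        cases hc : mem c with
        | key a => simp [hc, Word.int?] at h
        | num k' => simp [hc, Word.int?] at h; rw [h]
      show Source.eval mem (if (viewOf mem).int c = some k then .copy c
        else if h : k < W then .const ⟨k, h⟩ else .copy c) = _
      by_cases h : (viewOf mem).int c = some k
      · simp [h, Source.eval, Word.map, hint h]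
      · rw [if_neg h]
        have hkW : k < W := by
          have hw' : encode cp q (fα (fun x y => decide (x ≤ y)) q s).2.ans
              (fα (fun x y => decide (x ≤ y)) q s).1 c = .num k := by
            rw [e1, e2, hans', ← hq, encode_map, hw]; rfl
          have hne : mem c ≠ .num k := by
            intro h'
            apply h
            simp [viewOf, h', Word.int?]
          have hfit' := hfit
          generalize hs' : (fα (fun x y => decide (x ≤ y)) q s).1 = s' at hw' hfit'
          generalize hc' : (fα (fun x y => decide (x ≤ y)) q s).2 = c' at hw' hans
          rw [hmem c] at hne
          unfold encode at hw' hne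
          split_ifs at hw' hne with i1 i2 i3 i4 i5 i6 i7
          · exact absurd hw' hne
          · exact hans k hw'
          · rw [Word.num.injEq] at hw'
            subst hw'
            rw [List.getD_eq_getElem _ _ (by simp [St.ctl]; omega)]
            exact hfit'.ctl _ (List.getElem_mem _)
          · rcases hfit'.buf with hb | hb
            · rw [hb] at hw'; exact absurd hw' hne
            · exact hb _ _ hw'
          · unfold areaKey at hw' hne
            split_ifs at hw' with j1
            rw [Word.num.injEq] at hw'
            subst hw'
            exact lt_of_le_of_lt (Nat.zero_le _) (hfit'.ctl s'.pc (by simp [St.ctl]))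
          · unfold areaKey at hw' hne
            split_ifs at hw' with j1
            rw [Word.num.injEq] at hw'
            subst hw'
            exact lt_of_le_of_lt (Nat.zero_le _) (hfit'.ctl s'.pc (by simp [St.ctl]))
          · unfold areaNum at hw'
            split_ifs at hw' with j1
            · rw [Word.num.injEq] at hw'
              subst hw'
              exact hfit'.nums _ (List.getElem_mem _)
            · rw [Word.num.injEq] at hw'
              subst hw'
              exact lt_of_le_of_lt (Nat.zero_le _) (hfit'.ctl s'.pc (by simp [St.ctl]))
          · exact absurd hw' hne
        simp [hkW, Source.eval, Word.map]
  · rw [e2]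
    show toCommand hR out.2 = _
    cases out.2 <;> rfl

theorem fetch_encode {cp : ℕ} {mem : Fin R → Word α} {q ans : Word α} {s : St α B}
    (hm : ∀ c : Fin R, mem c = encode cp q ans s c) (blk : Fin B → Word α) (c : Fin R) :
    fetch mem 15 blk c = encode cp q ans { s with buf := blk } c := by
  unfold fetch
  split_ifs with h
  · unfold encode
    simp (disch := omega) only [if_neg, dif_pos]
  · rw [hm]
    unfold encode
    split_ifs <;> rfl

theorem blockAt_encode {cp : ℕ} {mem : Fin R → Word α} {q ans : Word α} {s : St α B}
    (hR : 15 + B ≤ R) (hm : ∀ c : Fin R, mem c = encode cp q ans s c) :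
    blockAt mem 15 = s.buf := by
  funext j
  have := j.2
  unfold blockAt
  rw [dif_pos (by omega), hm]
  unfold encode
  simp (disch := omega) only [if_neg, dif_pos]
  congr 1; ext; simp

end Implementation

/-! ### Runs of the abstract machine -/

section Runs

variable {α : Type u} {B : ℕ}

/-- `Reach f W cp q s d t s' d'`: from state `s` and disk `d` the abstract machine gets to `s'` and
`d'` by exactly `t` I/Os. -/
inductive Reach (f : Word α → St α B → St α B × Cmd α) (W cp : ℕ) (q : Word α) :
    St α B → (ℕ → Fin B → Word α) → ℕ → St α B → (ℕ → Fin B → Word α) → Prop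
  | refl (s : St α B) (d : ℕ → Fin B → Word α) : Reach f W cp q s d 0 s d
  | read {s s₁ s' : St α B} {d d' : ℕ → Fin B → Word α} {t : ℕ} (a : ℕ)
      (hc : f q s = (s₁, .read a)) (ha : a < W) (hfit : Fits W cp s s₁)
      (rest : Reach f W cp q { s₁ with buf := d a } d t s' d') : Reach f W cp q s d (t + 1) s' d'
  | write {s s₁ s' : St α B} {d d' : ℕ → Fin B → Word α} {t : ℕ} (a : ℕ)
      (hc : f q s = (s₁, .write a)) (ha : a < W) (hfit : Fits W cp s s₁)
      (rest : Reach f W cp q s₁ (Function.update d a s₁.buf) t s' d') :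
      Reach f W cp q s d (t + 1) s' d'

variable {f : Word α → St α B → St α B × Cmd α} {W cp : ℕ} {q : Word α}

theorem Reach.trans {s s' s'' : St α B} {d d' d'' : ℕ → Fin B → Word α} {t t' : ℕ}
    (h : Reach f W cp q s d t s' d') (h' : Reach f W cp q s' d' t' s'' d'') :
    Reach f W cp q s d (t + t') s'' d'' := by
  induction h with
  | refl => simpa using h'
  | read a hc ha hfit _ ih =>
    rw [Nat.add_right_comm]
    exact .read a hc ha hfit (ih h')
  | write a hc ha hfit _ ih =>
    rw [Nat.add_right_comm]
    exact .write a hc ha hfit (ih h')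

/-- The abstract machine answers `w` after `t` I/Os. -/
def Answers (f : Word α → St α B → St α B × Cmd α) (W cp : ℕ) (q : Word α) (s : St α B)
    (d : ℕ → Fin B → Word α) (t : ℕ) (w : Word α) (s' : St α B) (d' : ℕ → Fin B → Word α) : Prop :=
  ∃ s₁, Reach f W cp q s d t s₁ d' ∧ f q s₁ = (s', .answer w) ∧ Fits W cp s₁ s' ∧
    ∀ k, w = .num k → k < W

theorem Reach.answers {s s' s'' : St α B} {d d' d'' : ℕ → Fin B → Word α} {t t' : ℕ} {w : Word α}
    (h : Reach f W cp q s d t s' d') (h' : Answers f W cp q s' d' t' w s'' d'') :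
    Answers f W cp q s d (t + t') w s'' d'' := by
  obtain ⟨s₁, hr, h''⟩ := h'
  exact ⟨s₁, h.trans hr, h''⟩

variable [LinearOrder α] {R : ℕ}

/-- The step function of the abstract machine over the linear order `α`. -/
abbrev Step.at (fα : Step α B) : Word α → St α B → St α B × Cmd α :=
  fα fun x y => decide (x ≤ y)

theorem Answers.serves (hR : 1 < R) (hcp : 15 + B + 3 * cp ≤ R) {f : (β : Type) → Step β B}
    {fα : Step α B} (hf : Natural f fα) {s s' : St α B} {cfg : Config α R B}
    {d' : ℕ → Fin B → Word α} {t : ℕ} {w : Word α} (hm : Repr cp q s cfg.mem)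
    (h1 : s.piv.length ≤ cp) (h2 : s.pool.length ≤ cp) (h3 : s.nums.length ≤ cp)
    (h : Answers fα.at W cp q s cfg.disk t w s' d') :
    ∃ mem', Repr cp q s' mem' ∧
      Serves (implement hR cp f : Program R W) cfg t w ⟨mem', d'⟩ := by
  obtain ⟨s₁, hr, hc, hfit, hw⟩ := h
  generalize hd : cfg.disk = d at hr
  induction hr generalizing cfg with
  | refl s d =>
    obtain ⟨e1, e2⟩ := implement_step (W := W) hR hcp hf hm h1 h2 h3 (by
      show Fits W cp s (fα.at q s).1
      rw [hc]; exact hfit) (by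
      show ∀ k, (fα.at q s).2.ans = _ → _
      rw [hc]; exact hw)
    change _ = toCommand hR ((fα.at q s).2.map _) at e2
    change ∀ c : Fin R, _ = encode cp q (fα.at q s).2.ans (fα.at q s).1 c at e1
    rw [hc] at e1 e2
    refine ⟨_, ⟨_, e1⟩, ?_⟩
    have := Serves.answer (P := (implement hR cp f : Program R W)) cfg ⟨1, hR⟩ e2
    rw [e1, hd] at this
    simpa [encode, Cmd.ans] using this
  | @read s s₁ s'' d d' t a hcc ha hfit' _ ih =>
    obtain ⟨e1, e2⟩ := implement_step (W := W) hR hcp hf hm h1 h2 h3 (by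
      show Fits W cp s (fα.at q s).1
      rw [hcc]; exact hfit') (by
      show ∀ k, (fα.at q s).2.ans = _ → _
      rw [hcc]
      intro k hk
      rw [Cmd.ans, Word.num.injEq] at hk
      omega
      · simp)
    change _ = toCommand hR ((fα.at q s).2.map _) at e2
    change ∀ c : Fin R, _ = encode cp q (fα.at q s).2.ans (fα.at q s).1 c at e1
    rw [hcc] at e1 e2
    have hfe := fetch_encode e1 (d a)
    obtain ⟨mem', hm', hs⟩ := ih (cfg := ⟨fetch ((implement hR cp f : Program R W).compute cfg.mem)
      15 (d a), d⟩) ⟨_, hfe⟩ hfit'.piv_len hfit'.pool_len hfit'.nums_len hc hfit rfl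
    refine ⟨mem', hm', Serves.read cfg _ ⟨a, ha⟩ 15 t w ?_ ?_⟩
    · rw [e2]; simp [toCommand, Cmd.map, ha]
    · rw [hd]; exact hs
  | @write s s₁ s'' d d' t a hcc ha hfit' _ ih =>
    obtain ⟨e1, e2⟩ := implement_step (W := W) hR hcp hf hm h1 h2 h3 (by
      show Fits W cp s (fα.at q s).1
      rw [hcc]; exact hfit') (by
      show ∀ k, (fα.at q s).2.ans = _ → _
      rw [hcc]
      intro k hk
      rw [Cmd.ans, Word.num.injEq] at hk
      omega
      · simp)
    change _ = toCommand hR ((fα.at q s).2.map _) at e2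
    change ∀ c : Fin R, _ = encode cp q (fα.at q s).2.ans (fα.at q s).1 c at e1
    rw [hcc] at e1 e2
    have hb := blockAt_encode (by omega) e1
    obtain ⟨mem', hm', hs⟩ := ih (cfg := ⟨(implement hR cp f : Program R W).compute cfg.mem,
      Function.update d a s₁.buf⟩) ⟨_, e1⟩ hfit'.piv_len hfit'.pool_len hfit'.nums_len hc hfit rfl
    refine ⟨mem', hm', Serves.write cfg _ ⟨a, ha⟩ 15 t w ?_ ?_⟩
    · rw [e2]; simp [toCommand, Cmd.map, ha]
    · rw [hd, hb]; exact hs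

theorem Repr.receive {N : ℕ} {s : St α B} {cfg : Config α R B} (hm : Repr cp q s cfg.mem)
    (Q : Query α N) : Repr cp Q.word s (cfg.receive Q).mem := by
  obtain ⟨ans, h⟩ := hm
  refine ⟨ans, fun c => ?_⟩
  show (if c.val = 0 then Q.word else cfg.mem c) = _
  rw [h]
  unfold encode
  split_ifs <;> rfl

end Runs

/-! ### The algorithm -/

/-- The reduction factor of the size of a node by one level of the tree. -/
def gFac (M B : ℕ) : ℕ := (M / B).sqrt.sqrt

/-- The largest number of pivots of a node. -/
def fMax (M B : ℕ) : ℕ := 8 * gFac M B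

/-- The number of elements in one memory load. -/
def loadSize (M B : ℕ) : ℕ := 2 * B * (M / B / 16)

/-- The number of entries in a block of an index. -/
def fan (B : ℕ) : ℕ := B / 4

/-- The top level of an index. -/
def topLev (N M B : ℕ) : ℕ := Nat.log (fan B) (min (fMax M B) N)

/-- The capacity of each list in internal memory. -/
def capac (M B : ℕ) : ℕ := (M - B) / 3 + 2

/-- The parameters for which the search tree is used. -/
def Good (N M B : ℕ) : Prop :=
  16 ≤ B ∧ 2 ^ 16 ≤ M / B ∧ Nat.log 2 N + 8 ≤ B * gFac M B

instance (N M B : ℕ) : Decidable (Good N M B) := by unfold Good; infer_instance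

/-- Disk addresses outside the input. -/
def adr (N area lev plo ch jl u : ℕ) : ℕ :=
  N + Nat.pair (Nat.pair (Nat.pair area lev) (Nat.pair plo ch)) (Nat.pair jl u)

/-- The address of block `i` of the file of a node. -/
def fileAdr (N : ℕ) (nd : Node) (i : ℕ) : ℕ :=
  if nd.lev = 0 then i else adr N 1 nd.lev nd.plo nd.ch 0 i

/-- The address of block `i` of the scratch file that holds the sample of round `h`. -/
def scrAdr (N h i : ℕ) : ℕ := adr N 2 h 0 0 0 i

/-- The address of block `u` of level `jl` of the index of a node. -/
def idxAdr (N : ℕ) (nd : Node) (jl u : ℕ) : ℕ := adr N 3 nd.lev nd.plo nd.ch jl u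

/-- The block that holds the elements of a list. -/
def keyBlock {β : Type u} (B : ℕ) (xs : List β) : Fin B → Word β := fun j => areaKey xs j

/-- The elements in a block. -/
def keysOf {β : Type u} {B : ℕ} (w : Fin B → Word β) : List β := (List.ofFn w).filterMap Word.key?

/-- Every `k`-th element of a list, starting with the first one. -/
def everyNth {β : Type u} (k : ℕ) : List β → List β
  | [] => []
  | x :: xs => x :: everyNth k (xs.drop (k - 1))
termination_by xs => xs.length
decreasing_by simp

section Steps

variable {β : Type u} {B : ℕ}

def ltB (le : β → β → Bool) (x y : β) : Bool := !le y x

def eqB (le : β → β → Bool) (x y : β) : Bool := le x y && le y x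

/-- The elements of class `j` with respect to the pivots: those that differ from all pivots and
exceed exactly `j` of them. -/
def inCls (le : β → β → Bool) (piv : List β) (j : ℕ) (y : β) : Bool :=
  !piv.any (fun p => eqB le y p) && (piv.countP (fun p => ltB le p y) == j)

/-- The predicates whose counts are maintained during the distribution of a node. -/
def cntPred (le : β → β → Bool) (piv : List β) (r : ℕ) (y : β) : Bool :=
  if r < piv.length then (piv[r]?).any (fun p => ltB le y p)
  else if r < 2 * piv.length then (piv[r - piv.length]?).any (fun p => le y p)
  else inCls le piv (r - 2 * piv.length + 1) y

/-- A word of a block at an index that may be out of range. -/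
def wordAt (w : Fin B → Word β) (i : ℕ) : Word β := if h : i < B then w ⟨i, h⟩ else .num 0

/-- The answer to a query that is found in a sorted or unsorted list at offset `lo`. -/
def leafAnswer (le : β → β → Bool) (q : Word β) (lo : ℕ) (xs : List β) : Word β :=
  match q with
  | .num n => areaKey (xs.mergeSort le) (n - 1 - lo)
  | .key p => .num (lo + xs.countP (fun x => ltB le x p) + if xs.any (fun x => eqB le x p) then 1 else 0)

/-- Whether an entry of an index does not exceed the query. -/
def entryLe (le : β → β → Bool) (q : Word β) (lo : ℕ) (k : Word β) (lt : ℕ) : Bool :=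
  match q, k with
  | .num n, .key _ => decide (lo + lt < n)
  | .key p, .key x => le x p
  | _, .num _ => false

/-- Whether an entry that does not exceed the query answers it. -/
def entryHit (le : β → β → Bool) (q : Word β) (lo : ℕ) (k : Word β) (ltq leq : ℕ) : Bool :=
  match q, k with
  | .num n, .key _ => decide (n ≤ lo + leq)
  | .key p, .key x => le p x
  | _, .num _ => decide (ltq < leq)

def enterNode (N M : ℕ) (s : St β B) : St β B × Cmd β :=
  if s.nd.sz ≤ B then ({ s with pc := 2 }, .read (fileAdr N s.nd 0))
  else ({ s with pc := 3, jl := topLev N M B, u := 0 }, .read (idxAdr N s.nd (topLev N M B) 0))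

def startStep (N M : ℕ) (le : β → β → Bool) (q : Word β) (s : St β B) : St β B × Cmd β :=
  if N ≤ B then
    if s.ld = 1 then (s, .answer (leafAnswer le q 0 ((keysOf s.buf).take N)))
    else ({ s with pc := 2, nd := ⟨0, 0, 0, 0, N⟩ }, .read 0)
  else if Good N M B then enterNode N M { s with nd := ⟨0, 0, 0, 0, N⟩ }
  else ({ s with pc := 10, i := 0, o := 0 }, .read 0)

def leafStep (N : ℕ) (le : β → β → Bool) (q : Word β) (s : St β B) : St β B × Cmd β :=
  ({ s with pc := 0, ld := if N ≤ B then 1 else 0 },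
    .answer (leafAnswer le q s.nd.lo ((keysOf s.buf).take s.nd.sz)))

def searchStep (N M : ℕ) (le : β → β → Bool) (q : Word β) (s : St β B) : St β B × Cmd β :=
  if (wordAt s.buf 0).key?.isNone then
    ({ s with pc := 4, h := 0, fs := s.nd.sz, i := 0, o := 0, pool := [] }, .read 0)
  else
    let b := fan B
    let c := (List.range b).countP fun i =>
      entryLe le q s.nd.lo (wordAt s.buf i) (wordAt s.buf (b + i)).toNat
    if c = 0 then ({ s with pc := 0 }, .answer (.num s.nd.lo))
    else if s.jl ≠ 0 then
      ({ s with jl := s.jl - 1, u := s.u * b + c - 1 },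
        .read (idxAdr N s.nd (s.jl - 1) (s.u * b + c - 1)))
    else
      let k := wordAt s.buf (c - 1)
      let ltq := (wordAt s.buf (b + (c - 1))).toNat
      let leq := (wordAt s.buf (2 * b + (c - 1))).toNat
      let cs := (wordAt s.buf (3 * b + (c - 1))).toNat
      if entryHit le q s.nd.lo k ltq leq then
        ({ s with pc := 0 }, .answer (match q with
          | .num _ => k
          | .key _ => .num (s.nd.lo + ltq + 1)))
      else
        enterNode N M { s with nd :=
          ⟨s.nd.lev + 1, s.nd.lo, s.u * b + c, s.nd.lo + leq, cs⟩ }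

/-- The distance of the pivots in a sorted sample of `σ` elements. -/
def stride (M B σ : ℕ) : ℕ := max ((σ + fMax M B - 1) / fMax M B) B

def sampleStep (N M : ℕ) (le : β → β → Bool) (s : St β B) : St β B × Cmd β :=
  if s.pool.length < loadSize M B ∧ s.i * B < s.fs then
    ({ s with pc := 5 }, .read (if s.h = 0 then fileAdr N s.nd s.i else scrAdr N s.h s.i))
  else if s.fs ≤ loadSize M B then
    let piv := everyNth (stride M B s.pool.length) (s.pool.mergeSort le)
    ({ s with pc := 7, i := 0, pool := [], piv := piv,
              nums := List.replicate (3 * piv.length) 0 }, .read 0)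
  else ({ s with pc := 6, pool := everyNth 2 (s.pool.mergeSort le) }, .read 0)

def absorbStep (s : St β B) : St β B × Cmd β :=
  ({ s with pc := 4, pool := s.pool ++ keysOf s.buf, i := s.i + 1 }, .read 0)

def emitStep (N : ℕ) (s : St β B) : St β B × Cmd β :=
  if s.pool.length ≠ 0 then
    ({ s with pool := s.pool.drop B, o := s.o + 1, buf := keyBlock B (s.pool.take B) },
      .write (scrAdr N (s.h + 1) s.o))
  else if s.i * B < s.fs then ({ s with pc := 4 }, .read 0)
  else ({ s with pc := 4, h := s.h + 1, fs := (s.fs + 1) / 2, i := 0, o := 0 }, .read 0)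

/-- A child of a node. -/
def Node.child (nd : Node) (j off cs : ℕ) : Node := ⟨nd.lev + 1, nd.lo, j, nd.lo + off, cs⟩

def distStep (N : ℕ) (le : β → β → Bool) (s : St β B) : St β B × Cmd β :=
  let F := s.piv.length
  let need := if s.i * B < s.nd.sz then B else 1
  match (List.range F).find? (fun t => decide (need ≤ s.pool.countP (inCls le s.piv (t + 1)))) with
  | some t =>
    let cl := s.pool.filter (inCls le s.piv (t + 1))
    ({ s with pool := s.pool.filter (fun y => !inCls le s.piv (t + 1) y) ++ cl.drop B,
              buf := keyBlock B (cl.take B) },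
      .write (fileAdr N (s.nd.child (t + 1) 0 0) ((s.nums.getD (2 * F + t) 0 - cl.length) / B)))
  | none =>
    if s.i * B < s.nd.sz then ({ s with pc := 8 }, .read (fileAdr N s.nd s.i))
    else ({ s with pc := 9, jl := 0, u := 0 }, .read 0)

def countStep (le : β → β → Bool) (s : St β B) : St β B × Cmd β :=
  ({ s with
      pc := 7
      i := s.i + 1
      pool := s.pool ++ (keysOf s.buf).filter (fun y => !s.piv.any (fun p => eqB le y p))
      nums := (List.range (3 * s.piv.length)).map fun r =>
        s.nums.getD r 0 + (keysOf s.buf).countP (cntPred le s.piv r) }, .read 0)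

/-- Block `u` of level `jl` of an index. -/
def idxBlock (B : ℕ) (piv : List β) (nums : List ℕ) (jl u : ℕ) : Fin B → Word β := fun w =>
  let b := fan B
  let t := (u * b + w.val % b) * b ^ jl
  if t < piv.length then
    if w.val < b then areaKey piv t
    else if w.val < 4 * b then .num (nums.getD ((w.val / b - 1) * piv.length + t) 0)
    else .num 0
  else .num 0

def indexStep (N M : ℕ) (s : St β B) : St β B × Cmd β :=
  if s.jl ≤ topLev N M B then
    if s.u * fan B ^ (s.jl + 1) < s.piv.length then
      ({ s with u := s.u + 1, buf := idxBlock B s.piv s.nums s.jl s.u },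
        .write (idxAdr N s.nd s.jl s.u))
    else ({ s with jl := s.jl + 1, u := 0 }, .read 0)
  else enterNode N M s

/-- Brute force: the next candidate. -/
def candStep (q : Word β) (s : St β B) : St β B × Cmd β :=
  ({ s with pc := 11, piv := (match q with
      | .num _ => (wordAt s.buf (s.i % B)).key?.toList
      | .key p => [p]), o := 0, nums := [0, 0] }, .read 0)

/-- Brute force: counting the elements below the candidate. -/
def bruteStep (N : ℕ) (le : β → β → Bool) (q : Word β) (s : St β B) : St β B × Cmd β :=
  let lt := s.nums.getD 0 0 + (keysOf s.buf).countP (fun x => s.piv.any (fun p => ltB le x p))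
  let leq := s.nums.getD 1 0 + (keysOf s.buf).countP (fun x => s.piv.any (fun p => le x p))
  if (s.o + 1) * B < N then ({ s with o := s.o + 1, nums := [lt, leq] }, .read (s.o + 1))
  else match q with
    | .key _ => ({ s with pc := 0 }, .answer (.num (lt + if lt < leq then 1 else 0)))
    | .num n =>
      if lt < n ∧ n ≤ leq then ({ s with pc := 0 }, .answer (areaKey s.piv 0))
      else ({ s with pc := 10, i := (s.i + 1) % N }, .read ((s.i + 1) % N / B))

/-- The algorithm. -/
def algStep (N M B : ℕ) (β : Type u) : Step β B := fun le q s =>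
  match s.pc with
  | 0 => startStep N M le q s
  | 2 => leafStep N le q s
  | 3 => searchStep N M le q s
  | 4 => sampleStep N M le s
  | 5 => absorbStep s
  | 6 => emitStep N s
  | 7 => distStep N le s
  | 8 => countStep le s
  | 9 => indexStep N M s
  | 10 => candStep q s
  | 11 => bruteStep N le q s
  | _ => (s, .answer (.num 0))

end Steps

/-! ### Naturality of the algorithm -/

section Naturality

variable {α : Type u} {β : Type v} {B : ℕ}

theorem keysOf_map (g : β → α) (w : Fin B → Word β) :
    keysOf (fun j => (w j).map g) = (keysOf w).map g := by
  unfold keysOf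
  rw [show (fun j => (w j).map g) = Word.map g ∘ w from rfl, ← List.map_ofFn,
    List.filterMap_map, List.map_filterMap]
  congr 1
  funext x
  simp [Word.map_key?]

theorem everyNth_map (g : β → α) (k : ℕ) (xs : List β) :
    everyNth k (xs.map g) = (everyNth k xs).map g := by
  induction xs using everyNth.induct (k := k) with
  | case1 => simp [everyNth]
  | case2 x xs ih =>
    rw [List.map_cons, everyNth, everyNth, List.map_cons, ← List.map_drop, ih]

theorem keyBlock_map (g : β → α) (xs : List β) :
    keyBlock B (xs.map g) = fun j => (keyBlock B xs j).map g := by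
  funext j
  exact areaKey_map g xs j

theorem wordAt_map (g : β → α) (w : Fin B → Word β) (i : ℕ) :
    wordAt (fun j => (w j).map g) i = (wordAt w i).map g := by
  unfold wordAt
  split_ifs <;> rfl

variable {g : β → α} {le : β → β → Bool} {leα : α → α → Bool}

theorem mergeSort_natural (hle : ∀ x y, leα (g x) (g y) = le x y) (xs : List β) :
    (xs.map g).mergeSort leα = (xs.mergeSort le).map g :=
  (List.map_mergeSort fun a _ b _ => (hle a b).symm).symm

theorem inCls_natural (hle : ∀ x y, leα (g x) (g y) = le x y) (piv : List β) (j : ℕ) (y : β) :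
    inCls leα (piv.map g) j (g y) = inCls le piv j y := by
  simp [inCls, eqB, ltB, hle, List.any_map, List.countP_map, Function.comp_def]

theorem cntPred_natural (hle : ∀ x y, leα (g x) (g y) = le x y) (piv : List β) (r : ℕ) (y : β) :
    cntPred leα (piv.map g) r (g y) = cntPred le piv r y := by
  simp [cntPred, inCls_natural hle, ltB, hle, Option.any_map]

theorem leafAnswer_natural (hle : ∀ x y, leα (g x) (g y) = le x y) (q : Word β) (lo : ℕ)
    (xs : List β) :
    leafAnswer leα (q.map g) lo (xs.map g) = (leafAnswer le q lo xs).map g := by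
  cases q with
  | key p => simp [leafAnswer, Word.map, ltB, eqB, hle, List.countP_map, List.any_map,
      Function.comp_def]
  | num n => simp only [leafAnswer, Word.map, mergeSort_natural hle, areaKey_map]

theorem entryLe_natural (hle : ∀ x y, leα (g x) (g y) = le x y) (q k : Word β) (lo lt : ℕ) :
    entryLe leα (q.map g) lo (k.map g) lt = entryLe le q lo k lt := by
  cases q <;> cases k <;> simp [entryLe, Word.map, hle]

theorem entryHit_natural (hle : ∀ x y, leα (g x) (g y) = le x y) (q k : Word β) (lo lt l : ℕ) :
    entryHit leα (q.map g) lo (k.map g) lt l = entryHit le q lo k lt l := by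
  cases q <;> cases k <;> simp [entryHit, Word.map, hle]

theorem idxBlock_map (piv : List β) (nums : List ℕ) (jl u : ℕ) :
    idxBlock B (piv.map g) nums jl u = fun j => (idxBlock B piv nums jl u j).map g := by
  funext j
  simp only [idxBlock, List.length_map]
  split_ifs <;> simp [areaKey_map, Word.map]

theorem enterNode_map (N M : ℕ) (s : St β B) :
    enterNode N M (s.map g) = ((enterNode N M s).1.map g, (enterNode N M s).2.map g) := by
  unfold enterNode
  by_cases h : s.nd.sz ≤ B <;> simp [h, St.map, Cmd.map]

theorem enterNode_map_nd (N M : ℕ) (s : St β B) (nd : Node) :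
    enterNode N M { s.map g with nd := nd } = ((enterNode N M { s with nd := nd }).1.map g,
      (enterNode N M { s with nd := nd }).2.map g) :=
  enterNode_map N M { s with nd := nd }

theorem filter_natural {p : α → Bool} {p' : β → Bool} (h : ∀ x, p (g x) = p' x) (xs : List β) :
    (xs.map g).filter p = (xs.filter p').map g := by
  rw [List.filter_map]
  congr 2
  funext x
  exact h x

theorem countP_natural {p : α → Bool} {p' : β → Bool} (h : ∀ x, p (g x) = p' x) (xs : List β) :
    (xs.map g).countP p = xs.countP p' := by
  rw [List.countP_map]
  congr 1
  funext x
  exact h x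

theorem startStep_natural (hle : ∀ x y, leα (g x) (g y) = le x y) (N M : ℕ) (q : Word β)
    (s : St β B) : startStep N M leα (q.map g) (s.map g)
      = ((startStep N M le q s).1.map g, (startStep N M le q s).2.map g) := by
  unfold startStep
  split_ifs with h1 h2 h3 h4 h5
  · simp only [Cmd.map, Prod.mk.injEq, true_and, Cmd.answer.injEq]
    rw [← leafAnswer_natural hle, List.map_take, ← keysOf_map]
    rfl
  · exact absurd h2 h3
  · exact absurd h4 h2
  · rfl
  · exact enterNode_map_nd N M s _
  · rfl

theorem leafStep_natural (hle : ∀ x y, leα (g x) (g y) = le x y) (N : ℕ) (q : Word β)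
    (s : St β B) : leafStep N leα (q.map g) (s.map g)
      = ((leafStep N le q s).1.map g, (leafStep N le q s).2.map g) := by
  unfold leafStep
  simp only [Cmd.map, Prod.mk.injEq, Cmd.answer.injEq]
  refine ⟨rfl, ?_⟩
  rw [← leafAnswer_natural hle, List.map_take, ← keysOf_map]
  rfl

theorem searchStep_natural (hle : ∀ x y, leα (g x) (g y) = le x y) (N M : ℕ) (q : Word β)
    (s : St β B) : searchStep N M leα (q.map g) (s.map g)
      = ((searchStep N M le q s).1.map g, (searchStep N M le q s).2.map g) := by
  have hw : ∀ i, wordAt (s.map g).buf i = (wordAt s.buf i).map g := fun i => wordAt_map g s.buf i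
  unfold searchStep
  simp only [hw, Word.map_key?, Word.map_toNat, Option.isNone_map, entryLe_natural hle,
    entryHit_natural hle, show (s.map g).nd = s.nd from rfl, show (s.map g).jl = s.jl from rfl,
    show (s.map g).u = s.u from rfl]
  split_ifs
  · rfl
  · rfl
  · rfl
  · cases q <;> rfl
  · exact enterNode_map_nd N M s _

theorem sampleStep_natural (hle : ∀ x y, leα (g x) (g y) = le x y) (N M : ℕ)
    (s : St β B) : sampleStep N M leα (s.map g)
      = ((sampleStep N M le s).1.map g, (sampleStep N M le s).2.map g) := by
  unfold sampleStep
  simp only [show (s.map g).pool = s.pool.map g from rfl, List.length_map,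
    show (s.map g).nd = s.nd from rfl, show (s.map g).i = s.i from rfl,
    show (s.map g).fs = s.fs from rfl, show (s.map g).h = s.h from rfl, mergeSort_natural hle,
    everyNth_map]
  split_ifs <;> rfl

theorem absorbStep_natural (s : St β B) : absorbStep (s.map g)
      = ((absorbStep s).1.map g, (absorbStep s).2.map g) := by
  simp [absorbStep, St.map, Cmd.map, keysOf_map]

theorem emitStep_natural (N : ℕ) (s : St β B) : emitStep N (s.map g)
      = ((emitStep N s).1.map g, (emitStep N s).2.map g) := by
  unfold emitStep
  simp only [show (s.map g).pool = s.pool.map g from rfl, List.length_map,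
    show (s.map g).i = s.i from rfl, show (s.map g).o = s.o from rfl,
    show (s.map g).fs = s.fs from rfl, show (s.map g).h = s.h from rfl, ← List.map_drop,
    ← List.map_take, keyBlock_map]
  split_ifs <;> rfl

theorem distStep_natural (hle : ∀ x y, leα (g x) (g y) = le x y) (N : ℕ)
    (s : St β B) : distStep N leα (s.map g)
      = ((distStep N le s).1.map g, (distStep N le s).2.map g) := by
  unfold distStep
  simp only [show (s.map g).pool = s.pool.map g from rfl, List.length_map,
    show (s.map g).piv = s.piv.map g from rfl,
    show (s.map g).i = s.i from rfl, show (s.map g).nd = s.nd from rfl,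
    show (s.map g).nums = s.nums from rfl]
  simp only [fun j xs => countP_natural (inCls_natural hle s.piv j) xs,
    fun j xs => filter_natural (inCls_natural hle s.piv j) xs,
    fun j (xs : List β) => filter_natural (p := fun y => !inCls leα (s.piv.map g) j y)
      (p' := fun y => !inCls le s.piv j y) (fun x => by rw [inCls_natural hle]) xs,
    ← List.map_drop, ← List.map_take, ← List.map_append, keyBlock_map, List.length_map]
  split
  · rfl
  · split_ifs <;> rfl

theorem countStep_natural (hle : ∀ x y, leα (g x) (g y) = le x y)
    (s : St β B) : countStep leα (s.map g)
      = ((countStep le s).1.map g, (countStep le s).2.map g) := by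
  have hk : keysOf (s.map g).buf = (keysOf s.buf).map g := keysOf_map g s.buf
  unfold countStep
  simp only [hk, show (s.map g).piv = s.piv.map g from rfl, List.length_map,
    fun r xs => countP_natural (cntPred_natural hle s.piv r) xs]
  rw [filter_natural (p' := fun y => !s.piv.any (fun p => eqB le y p))]
  · simp [St.map, Cmd.map]
  · intro x
    simp [eqB, hle, List.any_map, Function.comp_def]

theorem indexStep_natural (N M : ℕ) (s : St β B) : indexStep N M (s.map g)
      = ((indexStep N M s).1.map g, (indexStep N M s).2.map g) := by
  unfold indexStep
  simp only [show (s.map g).jl = s.jl from rfl, show (s.map g).u = s.u from rfl,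
    show (s.map g).piv = s.piv.map g from rfl, List.length_map, idxBlock_map]
  split_ifs
  · rfl
  · rfl
  · exact enterNode_map N M s

theorem candStep_natural (q : Word β) (s : St β B) : candStep (q.map g) (s.map g)
      = ((candStep q s).1.map g, (candStep q s).2.map g) := by
  have hw : ∀ i, wordAt (s.map g).buf i = (wordAt s.buf i).map g := fun i => wordAt_map g s.buf i
  unfold candStep
  cases q with
  | key p => rfl
  | num n =>
    simp only [hw, Word.map_key?]
    simp only [Word.map, St.map, Cmd.map]
    cases (wordAt s.buf (s.i % B)).key? <;> rfl

theorem bruteStep_natural (hle : ∀ x y, leα (g x) (g y) = le x y) (N : ℕ) (q : Word β)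
    (s : St β B) : bruteStep N leα (q.map g) (s.map g)
      = ((bruteStep N le q s).1.map g, (bruteStep N le q s).2.map g) := by
  have hk : keysOf (s.map g).buf = (keysOf s.buf).map g := keysOf_map g s.buf
  unfold bruteStep
  simp only [hk, show (s.map g).piv = s.piv.map g from rfl,
    show (s.map g).nums = s.nums from rfl, show (s.map g).o = s.o from rfl,
    show (s.map g).i = s.i from rfl]
  rw [countP_natural (p' := fun x => s.piv.any (fun p => ltB le x p)),
    countP_natural (p' := fun x => s.piv.any (fun p => le x p))]
  · by_cases h : (s.o + 1) * B < N
    · simp only [if_pos h]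
      rfl
    · simp only [if_neg h]
      cases q with
      | key p => rfl
      | num n =>
        simp only [Word.map, areaKey_map]
        split_ifs <;> rfl
  · intro x; simp [hle, List.any_map, Function.comp_def]
  · intro x; simp [ltB, hle, List.any_map, Function.comp_def]

theorem algStep_natural (hle : ∀ x y, leα (g x) (g y) = le x y) (N M : ℕ) (q : Word β)
    (s : St β B) : algStep N M B α leα (q.map g) (s.map g)
      = ((algStep N M B β le q s).1.map g, (algStep N M B β le q s).2.map g) := by
  unfold algStep
  rw [show (s.map g).pc = s.pc from rfl]
  split
  · exact startStep_natural hle N M q s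
  · exact leafStep_natural hle N q s
  · exact searchStep_natural hle N M q s
  · exact sampleStep_natural hle N M s
  · exact absorbStep_natural s
  · exact emitStep_natural N s
  · exact distStep_natural hle N s
  · exact countStep_natural hle s
  · exact indexStep_natural N M s
  · exact candStep_natural q s
  · exact bruteStep_natural hle N q s
  · rfl

end Naturality

theorem natural_algStep {α : Type u} [LinearOrder α] (N M B : ℕ) :
    Natural (fun β => algStep N M B β) (algStep N M B α) :=
  fun _ _ _ hle q s => algStep_natural (fun x y => (hle x y).symm) N M q s

/-! ### Samples, pivots and classes -/

section Lists

variable {α : Type u} [LinearOrder α]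

/-- The order of `α` as a Boolean relation. -/
abbrev dle (x y : α) : Bool := decide (x ≤ y)

@[simp] theorem ltB_dle (x y : α) : ltB dle x y = decide (x < y) := by
  simp [ltB, dle, ← not_le]

@[simp] theorem eqB_dle (x y : α) : eqB dle x y = decide (x = y) := by
  simp [eqB, dle, le_antisymm_iff]

/-- Predicates that are closed downwards. -/
def Down (p : α → Bool) : Prop := ∀ ⦃x y : α⦄, x ≤ y → p y = true → p x = true

theorem down_lt (a : α) : Down fun x => decide (x < a) := fun x y h hy => by
  simp only [decide_eq_true_eq] at *
  exact lt_of_le_of_lt h hy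

theorem down_le (a : α) : Down fun x => decide (x ≤ a) := fun x y h hy => by
  simp only [decide_eq_true_eq] at *
  exact le_trans h hy

theorem down_true : Down fun _ : α => true := fun _ _ _ _ => rfl

theorem sorted_mergeSort (xs : List α) : (xs.mergeSort dle).Pairwise (· ≤ ·) := by
  have := List.pairwise_mergeSort (le := dle (α := α))
    (fun a b c h1 h2 => by simp only [dle, decide_eq_true_eq] at *; exact le_trans h1 h2)
    (fun a b => by simp [dle, le_total]) xs
  simpa [dle] using this

theorem lt_countP_iff {xs : List α} (hs : xs.Pairwise (· ≤ ·)) {p : α → Bool} (hp : Down p)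
    (i : ℕ) (hi : i < xs.length) : i < xs.countP p ↔ p xs[i] = true := by
  induction xs generalizing i with
  | nil => simp at hi
  | cons x xs ih =>
    rw [List.pairwise_cons] at hs
    by_cases hx : p x = true
    · rw [List.countP_cons_of_pos hx]
      cases i with
      | zero => simp [hx]
      | succ i => simpa using ih hs.2 i (by simpa using hi)
    · rw [List.countP_cons_of_neg hx]
      have hall : ∀ y ∈ xs, ¬ p y = true := fun y hy h => hx (hp (hs.1 y hy) h)
      have h0 : xs.countP p = 0 := List.countP_eq_zero.2 hall
      rw [h0]
      cases i with
      | zero => simp [hx]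
      | succ i =>
        simp only [Nat.not_lt_zero, List.getElem_cons_succ, false_iff]
        exact hall _ (List.getElem_mem _)

theorem countP_drop {xs : List α} (hs : xs.Pairwise (· ≤ ·)) {p : α → Bool} (hp : Down p) (r : ℕ) :
    (xs.drop r).countP p = xs.countP p - r := by
  induction xs generalizing r with
  | nil => simp
  | cons x xs ih =>
    rw [List.pairwise_cons] at hs
    cases r with
    | zero => simp
    | succ r =>
      rw [List.drop_succ_cons, ih hs.2]
      by_cases hx : p x = true
      · rw [List.countP_cons_of_pos hx]; omega
      · rw [List.countP_cons_of_neg hx]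
        have h0 : xs.countP p = 0 :=
          List.countP_eq_zero.2 fun y hy h => hx (hp (hs.1 y hy) h)
        omega

theorem everyNth_sublist {β : Type v} (k : ℕ) (xs : List β) : (everyNth k xs).Sublist xs := by
  induction xs using everyNth.induct (k := k) with
  | case1 => simp [everyNth]
  | case2 x xs ih =>
    rw [everyNth]
    exact (ih.trans (List.drop_sublist _ _)).cons_cons x

theorem countP_everyNth {xs : List α} (hs : xs.Pairwise (· ≤ ·)) {p : α → Bool} (hp : Down p)
    {k : ℕ} (hk : 0 < k) : (everyNth k xs).countP p = (xs.countP p + k - 1) / k := by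
  induction xs using everyNth.induct (k := k) with
  | case1 => simp [everyNth, Nat.div_eq_of_lt (show k - 1 < k by omega)]
  | case2 x xs ih =>
    rw [everyNth]
    have hs' := hs
    rw [List.pairwise_cons] at hs
    by_cases hx : p x = true
    · rw [List.countP_cons_of_pos hx, List.countP_cons_of_pos hx,
        ih (hs.2.sublist (List.drop_sublist _ _)), countP_drop hs.2 hp]
      rcases Nat.lt_or_ge (xs.countP p) (k - 1) with h | h
      · rw [show xs.countP p - (k - 1) + k - 1 = k - 1 by omega,
          Nat.div_eq_of_lt (by omega), show xs.countP p + 1 + k - 1 = xs.countP p + k by omega,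
          Nat.add_div_right _ hk, Nat.div_eq_of_lt (by omega)]
      · rw [show xs.countP p + 1 + k - 1 = (xs.countP p - (k - 1) + k - 1) + k by omega,
          Nat.add_div_right _ hk]
    · have h0 : (x :: xs).countP p = 0 := by
        rw [List.countP_cons_of_neg hx]
        exact List.countP_eq_zero.2 fun y hy h => hx (hp (hs.1 y hy) h)
      have h1 : (x :: everyNth k (xs.drop (k - 1))).countP p = 0 := by
        have := (everyNth_sublist k (x :: xs)).countP_le (p := p)
        rw [everyNth] at this
        omega
      rw [h0, h1, Nat.div_eq_of_lt (by omega)]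

theorem length_everyNth {β : Type v} {k : ℕ} (hk : 0 < k) (xs : List β) :
    (everyNth k xs).length = (xs.length + k - 1) / k := by
  induction xs using everyNth.induct (k := k) with
  | case1 => simp [everyNth, Nat.div_eq_of_lt (show k - 1 < k by omega)]
  | case2 x xs ih =>
    rw [everyNth, List.length_cons, ih, List.length_drop, List.length_cons]
    rcases Nat.lt_or_ge xs.length (k - 1) with h | h
    · rw [show xs.length - (k - 1) + k - 1 = k - 1 by omega,
        Nat.div_eq_of_lt (by omega), show xs.length + 1 + k - 1 = xs.length + k by omega,
        Nat.add_div_right _ hk, Nat.div_eq_of_lt (by omega)]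
    · rw [show xs.length + 1 + k - 1 = (xs.length - (k - 1) + k - 1) + k by omega,
        Nat.add_div_right _ hk]

/-- One round of sampling: every second element of each sorted load of `K` elements. -/
def samplePass (K : ℕ) (xs : List α) : List α :=
  if _h : xs.length = 0 ∨ K = 0 then []
  else everyNth 2 ((xs.take K).mergeSort dle) ++ samplePass K (xs.drop K)
termination_by xs.length
decreasing_by simp; omega

theorem length_samplePass {K : ℕ} (hK : 0 < K) (xs : List α) :
    (samplePass (2 * K) xs).length = (xs.length + 1) / 2 := by
  induction xs using samplePass.induct (K := 2 * K) with
  | case1 xs h => rw [samplePass, dif_pos h]; simp; omega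
  | case2 xs h ih =>
    rw [samplePass, dif_neg h, List.length_append, ih, length_everyNth (by norm_num)]
    simp only [List.length_mergeSort, List.length_take, List.length_drop]
    omega

theorem samplePass_subset {K : ℕ} (xs : List α) : samplePass K xs ⊆ xs := by
  induction xs using samplePass.induct (K := K) with
  | case1 xs h => rw [samplePass, dif_pos h]; simp
  | case2 xs h ih =>
    rw [samplePass, dif_neg h]
    refine List.append_subset_of_subset_of_subset ?_ (List.Subset.trans ih (List.drop_subset _ _))
    exact List.Subset.trans (everyNth_sublist 2 _).subset
      (List.Subset.trans (List.mergeSort_perm _ _).subset (List.take_subset _ _))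

theorem countP_samplePass {K : ℕ} (hK : 0 < K) (xs : List α) {p : α → Bool} (hp : Down p) :
    xs.countP p ≤ 2 * (samplePass K xs).countP p ∧
      2 * (samplePass K xs).countP p ≤ xs.countP p + (xs.length + K - 1) / K := by
  induction xs using samplePass.induct (K := K) with
  | case1 xs h =>
    rw [samplePass, dif_pos h]
    rcases h with h | h
    · rw [List.length_eq_zero_iff] at h; simp [h]
    · omega
  | case2 xs h ih =>
    rw [samplePass, dif_neg h, List.countP_append,
      countP_everyNth (sorted_mergeSort _) hp (by norm_num)]
    have e1 := (List.mergeSort_perm (xs.take K) dle).countP_eq p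
    have e2 : xs.countP p = (xs.take K).countP p + (xs.drop K).countP p := by
      rw [← List.countP_append, List.take_append_drop]
    have e3 : (xs.drop K).length = xs.length - K := by simp
    rw [e1]
    have e4 : (xs.length + K - 1) / K = (xs.length - 1) / K + 1 := by
      rw [show xs.length + K - 1 = xs.length - 1 + K by omega, Nat.add_div_right _ hK]
    have e5 : (xs.length - K + K - 1) / K ≤ (xs.length - 1) / K := by
      rcases Nat.lt_or_ge xs.length K with h' | h'
      · rw [show xs.length - K + K - 1 = K - 1 by omega, Nat.div_eq_of_lt (by omega)]
        exact Nat.zero_le _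
      · rw [Nat.sub_add_cancel h']
    rw [e3] at ih
    omega

/-- The final sample: rounds of sampling until at most `2 * K` elements are left. -/
def finalSample (K : ℕ) (xs : List α) : List α :=
  if _h : xs.length ≤ 2 * K ∨ K = 0 then xs else finalSample K (samplePass (2 * K) xs)
termination_by xs.length
decreasing_by rw [length_samplePass (by omega)]; omega

theorem finalSample_induction {K : ℕ} {P : List α → Prop}
    (h1 : ∀ xs : List α, xs.length ≤ 2 * K ∨ K = 0 → P xs)
    (h2 : ∀ xs : List α, ¬(xs.length ≤ 2 * K ∨ K = 0) → P (samplePass (2 * K) xs) → P xs)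
    (xs : List α) : P xs := by
  induction hn : xs.length using Nat.strong_induction_on generalizing xs with
  | _ n ih =>
    by_cases h : xs.length ≤ 2 * K ∨ K = 0
    · exact h1 xs h
    · refine h2 xs h (ih _ ?_ _ rfl)
      rw [length_samplePass (by omega)]
      omega

theorem finalSample_subset {K : ℕ} (xs : List α) : finalSample K xs ⊆ xs := by
  revert xs
  refine finalSample_induction (K := K) ?_ ?_ <;> intro xs h
  · rw [finalSample, dif_pos h]; simp
  · intro ih
    rw [finalSample, dif_neg h]
    exact List.Subset.trans ih (samplePass_subset _)

/-- The ranks in the final sample, scaled by a power of two, approximate those in the list. -/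
theorem finalSample_accurate {K : ℕ} (hK : 1 < K) (xs : List α) (hx : 2 ≤ xs.length) :
    ∃ H E : ℕ, (∀ p, Down p → xs.countP p ≤ 2 ^ H * (finalSample K xs).countP p ∧
        2 ^ H * (finalSample K xs).countP p ≤ xs.countP p + E) ∧
      E * (2 * K) ≤ 4 * H * xs.length ∧ 2 ^ H + 1 ≤ xs.length ∧
      (H = 0 ∧ E = 0 ∨ K ≤ (finalSample K xs).length) := by
  revert xs
  refine finalSample_induction (K := K) ?_ ?_ <;> intro xs h
  · intro hx
    rw [finalSample, dif_pos h]
    exact ⟨0, 0, fun p _ => by simp, by simp, by simpa using hx, .inl ⟨rfl, rfl⟩⟩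
  · intro ih hx
    rw [finalSample, dif_neg h]
    have hl := length_samplePass (K := K) (by omega) xs
    obtain ⟨H, E, h1, h2, h3, h4⟩ := ih (by omega)
    rw [hl] at h2 h3
    refine ⟨H + 1, (xs.length + 2 * K - 1) / (2 * K) + 2 * E, fun p hp => ?_, ?_, ?_, ?_⟩
    · obtain ⟨a1, a2⟩ := countP_samplePass (K := 2 * K) (by omega) xs hp
      obtain ⟨b1, b2⟩ := h1 p hp
      rw [pow_succ]
      constructor
      · nlinarith
      · nlinarith
    · have c1 : (xs.length + 2 * K - 1) / (2 * K) * (2 * K) ≤ 2 * xs.length :=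
        (Nat.div_mul_le_self _ _).trans (by omega)
      have c2 : H < 2 ^ H := Nat.lt_two_pow_self
      have c3 : 2 * H ≤ xs.length := by omega
      have c4 : 2 * ((xs.length + 1) / 2) ≤ xs.length + 1 := by omega
      have c5 : 4 * H * (2 * ((xs.length + 1) / 2)) ≤ 4 * H * (xs.length + 1) :=
        Nat.mul_le_mul_left _ c4
      nlinarith
    · rw [pow_succ]; omega
    · right
      rcases h4 with ⟨rfl, rfl⟩ | h4
      · have := (h1 _ down_true).1
        simp only [List.countP_true, pow_zero, one_mul] at this
        omega
      · exact h4

theorem inCls_iff (piv : List α) (j : ℕ) (y : α) :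
    inCls dle piv j y = true ↔ y ∉ piv ∧ piv.countP (fun p => decide (p < y)) = j := by
  simp only [inCls, eqB_dle, ltB_dle, Bool.and_eq_true, Bool.not_eq_true', beq_iff_eq]
  refine and_congr_left fun _ => ?_
  rw [List.any_eq_false]
  simp only [decide_eq_true_eq]
  exact ⟨fun h hy => h y hy rfl, fun h x hx e => h (e ▸ hx)⟩

/-- Splitting a count at pivot `t`. -/
theorem countP_split {piv : List α} (hs : piv.Pairwise (· ≤ ·)) {t : ℕ} (ht : t < piv.length)
    (xs : List α) {p : α → Bool} (hp : Down p) (h1 : p piv[t] = true)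
    (h2 : ∀ s (hs : s < piv.length), t < s → ¬ p piv[s] = true) :
    xs.countP p = xs.countP (fun y => decide (y ≤ piv[t])) +
      (xs.filter (inCls dle piv (t + 1))).countP p := by
  rw [List.countP_eq_countP_filter_add xs p (fun y => decide (y ≤ piv[t])), List.countP_filter,
    List.countP_filter, List.countP_filter]
  congr 1
  · refine List.countP_congr fun y _ => ?_
    simp only [Bool.and_eq_true, decide_eq_true_eq, and_iff_right_iff_imp]
    exact fun h => hp h h1
  · refine List.countP_congr fun y _ => ?_
    have mono : ∀ a b (ha : a < piv.length) (hb : b < piv.length), a ≤ b → piv[a] ≤ piv[b] := by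
      intro a b ha hb hab
      rcases hab.lt_or_eq with h | rfl
      · exact List.pairwise_iff_getElem.1 hs _ _ _ _ h
      · exact le_rfl
    simp only [Bool.and_eq_true, Bool.not_eq_true', decide_eq_false_iff_not, not_le, inCls_iff]
    refine and_congr_right fun hy => ⟨fun h => ⟨fun hm => ?_, ?_⟩, fun h => ?_⟩
    · obtain ⟨s, hs', rfl⟩ := List.getElem_of_mem hm
      rcases Nat.lt_or_ge t s with h' | h'
      · exact h2 s hs' h' hy
      · exact absurd (mono s t hs' ht h') (not_le.2 h)
    · apply le_antisymm
      · by_contra hc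
        rw [not_le] at hc
        have hlen : t + 1 < piv.length := lt_of_lt_of_le hc (List.countP_le_length)
        have := (lt_countP_iff hs (down_lt y) (t + 1) hlen).1 hc
        rw [decide_eq_true_eq] at this
        exact h2 (t + 1) hlen (by omega) (hp this.le hy)
      · have := (lt_countP_iff hs (down_lt y) t ht).2 (by simpa using h)
        exact this
    · have := (lt_countP_iff hs (down_lt y) t ht).1 (by rw [h.2]; omega)
      simpa using this

end Lists

/-! ### The choice of the pivots -/

theorem gFac_pow_le (M B : ℕ) : gFac M B ^ 4 ≤ M / B := by
  have h1 := Nat.sqrt_le' (M / B)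
  have h2 := Nat.sqrt_le' (M / B).sqrt
  unfold gFac
  calc (M / B).sqrt.sqrt ^ 4 = ((M / B).sqrt.sqrt ^ 2) ^ 2 := by ring
    _ ≤ (M / B).sqrt ^ 2 := Nat.pow_le_pow_left h2 2
    _ ≤ M / B := h1

theorem Good.gFac_ge {N M B : ℕ} (h : Good N M B) : 16 ≤ gFac M B := by
  unfold gFac
  rw [Nat.le_sqrt', Nat.le_sqrt']
  exact le_trans (by norm_num) h.2.1

theorem Good.load_ge {N M B : ℕ} (h : Good N M B) : 16 * gFac M B ^ 2 ≤ M / B / 16 := by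
  have h1 := gFac_pow_le M B
  have h2 := h.gFac_ge
  rw [Nat.le_div_iff_mul_le (by norm_num)]
  have h3 : 16 * 16 ≤ gFac M B * gFac M B := Nat.mul_le_mul h2 h2
  calc 16 * gFac M B ^ 2 * 16 = (16 * 16) * gFac M B ^ 2 := by ring
    _ ≤ (gFac M B * gFac M B) * gFac M B ^ 2 := Nat.mul_le_mul_right _ h3
    _ = gFac M B ^ 4 := by ring
    _ ≤ _ := h1

theorem Good.load_le_capac {N M B : ℕ} (h : Good N M B) : loadSize M B ≤ capac M B := by
  have h1 : B * (M / B) ≤ M := Nat.mul_div_le M B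
  have h2 : 16 * (M / B / 16) ≤ M / B := Nat.mul_div_le _ 16
  have h3 := h.2.1
  unfold loadSize capac
  have h4 : B * (16 * (M / B / 16)) ≤ B * (M / B) := Nat.mul_le_mul_left _ h2
  have h5 : B * 2 ^ 16 ≤ B * (M / B) := Nat.mul_le_mul_left _ h3
  rw [show 2 * B * (M / B / 16) = 2 * (B * (M / B / 16)) by ring]
  rw [show B * (16 * (M / B / 16)) = 16 * (B * (M / B / 16)) by ring] at h4
  omega

/-- The room needed during the distribution of a node. -/
theorem Good.dist_le_load {N M B : ℕ} (h : Good N M B) :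
    (fMax M B + 2) * B ≤ loadSize M B ∧ 3 * fMax M B ≤ loadSize M B := by
  have h1 := h.load_ge
  have h2 := h.gFac_ge
  have h3 := h.1
  unfold loadSize fMax
  have h4 : 16 * gFac M B * 16 ≤ 16 * gFac M B ^ 2 := by nlinarith
  have h5 : 8 * gFac M B + 2 ≤ 2 * (M / B / 16) := by omega
  have h6 : 2 * (M / B / 16) ≤ 2 * B * (M / B / 16) :=
    Nat.mul_le_mul_right _ (by omega)
  constructor
  · calc (8 * gFac M B + 2) * B ≤ 2 * (M / B / 16) * B := Nat.mul_le_mul_right _ h5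
      _ = _ := by ring
  · omega

section Pivots

variable {α : Type u} [LinearOrder α]

theorem length_finalSample_le_self {K : ℕ} (xs : List α) :
    (finalSample K xs).length ≤ xs.length := by
  revert xs
  refine finalSample_induction (K := K) ?_ ?_ <;> intro xs h
  · rw [finalSample, dif_pos h]
  · intro ih
    rw [finalSample, dif_neg h]
    rw [length_samplePass (by omega)] at ih
    omega

/-- Pivots that split the list `xs` evenly enough. -/
structure PivGood (M B : ℕ) (xs piv : List α) : Prop where
  sorted : piv.Pairwise (· ≤ ·)
  pos : 0 < piv.length
  len_fMax : piv.length ≤ fMax M B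
  len_le : piv.length ≤ xs.length
  len_mul : piv.length * B ≤ xs.length + B
  subset : piv ⊆ xs
  min : ∀ y ∈ xs, piv[0] ≤ y
  small : ∀ t < piv.length, (xs.filter (inCls dle piv (t + 1))).length ≤ B ∨
    (xs.filter (inCls dle piv (t + 1))).length * gFac M B ≤ xs.length

/-- The pivots that the algorithm selects from the elements of a node. -/
def pivots (M B : ℕ) (xs : List α) : List α :=
  everyNth (stride M B (finalSample (B * (M / B / 16)) xs).length)
    ((finalSample (B * (M / B / 16)) xs).mergeSort dle)

theorem length_cls_le {piv : List α} (hs : piv.Pairwise (· ≤ ·)) {t : ℕ} (ht : t < piv.length)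
    (xs : List α) (D : ℕ)
    (hD : ∀ p p' : α → Bool, Down p → Down p' → piv.countP p' ≤ piv.countP p →
      xs.countP p' ≤ xs.countP p + D) :
    (xs.filter (inCls dle piv (t + 1))).length ≤ D := by
  have mono : ∀ a b (ha : a < piv.length) (hb : b < piv.length), a ≤ b → piv[a] ≤ piv[b] := by
    intro a b ha hb hab
    rcases hab.lt_or_eq with h | rfl
    · exact List.pairwise_iff_getElem.1 hs _ _ _ _ h
    · exact le_rfl
  have hle : t < piv.countP (fun y => decide (y ≤ piv[t])) :=
    (lt_countP_iff hs (down_le _) t ht).2 (by simp)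
  by_cases hl : t + 1 < piv.length
  · by_cases heq : piv[t] < piv[t + 1]
    · have h := countP_split hs ht xs (down_lt piv[t + 1]) (by simpa using heq) (by
        intro s hs' hts
        simpa using mono (t + 1) s hl hs' hts)
      have h2 := hD _ _ (down_le piv[t]) (down_lt piv[t + 1]) (by
        refine le_trans ?_ hle
        by_contra hc
        rw [not_le] at hc
        have := (lt_countP_iff hs (down_lt piv[t + 1]) (t + 1) hl).1 (by omega)
        simp at this)
      have h3 : (xs.filter (inCls dle piv (t + 1))).countP (fun y => decide (y < piv[t + 1]))
          = (xs.filter (inCls dle piv (t + 1))).length := by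
        rw [List.countP_eq_length]
        intro y hy
        rw [List.mem_filter, inCls_iff] at hy
        have : ¬ (t + 1 < piv.countP (fun p => decide (p < y))) := by omega
        rw [lt_countP_iff hs (down_lt y) (t + 1) hl] at this
        simp only [decide_eq_true_eq, not_lt] at this ⊢
        exact lt_of_le_of_ne this fun e => hy.2.1 (e ▸ List.getElem_mem _)
      omega
    · rw [List.length_eq_zero_iff.2]
      · exact Nat.zero_le _
      · rw [List.filter_eq_nil_iff]
        intro y _ hy
        rw [inCls_iff] at hy
        have h1 : ¬ (t + 1 < piv.countP (fun p => decide (p < y))) := by omega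
        rw [lt_countP_iff hs (down_lt y) (t + 1) hl] at h1
        have h2 : t < piv.countP (fun p => decide (p < y)) := by omega
        rw [lt_countP_iff hs (down_lt y) t ht] at h2
        simp only [decide_eq_true_eq] at h1 h2
        exact h1 (lt_of_le_of_lt (not_lt.1 heq) h2)
  · have h := countP_split hs ht xs down_true rfl (fun s hs' hts => by omega)
    have h2 := hD _ _ (down_le piv[t]) down_true (by
      refine le_trans List.countP_le_length ?_
      omega)
    simp only [List.countP_true] at h h2
    omega

theorem pivGood_pivots {N M B : ℕ} (hg : Good N M B) {xs : List α} (hN : xs.length ≤ N)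
    (hB : B < xs.length) : PivGood M B xs (pivots M B xs) := by
  set K := B * (M / B / 16) with hK
  set S := finalSample K xs with hS
  set k := stride M B S.length with hk
  have hB16 := hg.1
  have hg16 := hg.gFac_ge
  have hl := hg.load_ge
  have hf : 0 < fMax M B := by unfold fMax; omega
  have hkB : B ≤ k := le_max_right _ _
  have hk0 : 0 < k := by omega
  have hK1 : 16 * B * gFac M B ^ 2 ≤ K := by
    rw [hK]
    calc 16 * B * gFac M B ^ 2 = B * (16 * gFac M B ^ 2) := by ring
      _ ≤ _ := Nat.mul_le_mul_left _ hl
  have hK2 : 1 < K := lt_of_lt_of_le (by nlinarith) hK1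
  obtain ⟨H, E, h1, h2, h3, h4⟩ := finalSample_accurate hK2 xs (by omega)
  rw [← hS] at h1 h4
  have hpd : pivots M B xs = everyNth k (S.mergeSort dle) := rfl
  have hss := sorted_mergeSort S
  have hps : (pivots M B xs).Pairwise (· ≤ ·) := hss.sublist (everyNth_sublist _ _)
  have hcnt : ∀ p, Down p → (pivots M B xs).countP p = (S.countP p + k - 1) / k := by
    intro p hp
    rw [hpd, countP_everyNth hss hp hk0, (List.mergeSort_perm S dle).countP_eq p]
  have hlen : (pivots M B xs).length = (S.length + k - 1) / k := by
    rw [hpd, length_everyNth hk0, List.length_mergeSort]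
  have hSx : S.length ≤ xs.length := length_finalSample_le_self xs
  have hSpos : 0 < S.length := by
    have := (h1 _ down_true).1
    simp only [List.countP_true] at this
    rcases Nat.eq_zero_or_pos S.length with h | h
    · rw [h] at this; omega
    · exact h
  have hSub : pivots M B xs ⊆ xs :=
    List.Subset.trans (everyNth_sublist _ _).subset
      (List.Subset.trans (List.mergeSort_perm _ _).subset (finalSample_subset xs))
  have hpos : 0 < (pivots M B xs).length := by
    rw [hlen]
    exact Nat.div_pos (by omega) hk0
  have hD : ∀ p p' : α → Bool, Down p → Down p' →
      (pivots M B xs).countP p' ≤ (pivots M B xs).countP p →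
      xs.countP p' ≤ xs.countP p + (2 ^ H * (k - 1) + E) := by
    intro p p' hp hp' h
    rw [hcnt p hp, hcnt p' hp'] at h
    have a1 : S.countP p' ≤ (S.countP p' + k - 1) / k * k := by
      have := Nat.div_add_mod (S.countP p' + k - 1) k
      have := Nat.mod_lt (S.countP p' + k - 1) hk0
      rw [mul_comm]
      omega
    have a2 : (S.countP p + k - 1) / k * k ≤ S.countP p + (k - 1) :=
      (Nat.div_mul_le_self _ _).trans (by omega)
    have a3 : S.countP p' ≤ S.countP p + (k - 1) :=
      a1.trans ((Nat.mul_le_mul_right k h).trans a2)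
    calc xs.countP p' ≤ 2 ^ H * S.countP p' := (h1 p' hp').1
      _ ≤ 2 ^ H * (S.countP p + (k - 1)) := Nat.mul_le_mul_left _ a3
      _ = 2 ^ H * S.countP p + 2 ^ H * (k - 1) := by ring
      _ ≤ xs.countP p + E + 2 ^ H * (k - 1) := Nat.add_le_add_right (h1 p hp).2 _
      _ = _ := by ring
  refine ⟨hps, hpos, ?_, ?_, ?_, hSub, ?_, ?_⟩
  · rw [hlen]
    have : (S.length + fMax M B - 1) / fMax M B ≤ k := le_max_left _ _
    rw [Nat.div_le_iff_le_mul_add_pred hf] at this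
    apply Nat.le_of_lt_succ
    rw [Nat.div_lt_iff_lt_mul hk0]
    have e : fMax M B * k + fMax M B - 1 < fMax M B * k + fMax M B := by
      omega
    have e2 : S.length ≤ fMax M B * k := by omega
    calc S.length + k - 1 < fMax M B * k + k := by omega
      _ = (fMax M B).succ * k := by rw [Nat.succ_mul]
  · have := (everyNth_sublist k (S.mergeSort dle)).length_le
    rw [List.length_mergeSort] at this
    exact this.trans hSx
  · have e : (pivots M B xs).length * k ≤ S.length + k - 1 := by
      rw [hlen]; exact Nat.div_mul_le_self _ _
    obtain ⟨F, hF⟩ : ∃ F, (pivots M B xs).length = F + 1 := ⟨_, (Nat.succ_pred_eq_of_pos hpos).symm⟩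
    rw [hF] at e ⊢
    have e2 : F * B ≤ F * k := Nat.mul_le_mul_left _ hkB
    rw [Nat.succ_mul] at e ⊢
    omega
  · intro y hy
    by_contra hc
    rw [not_le] at hc
    have b1 : 0 < xs.countP (fun z => decide (z ≤ y)) :=
      List.countP_pos_iff.2 ⟨y, hy, by simp⟩
    have b2 : 0 < S.countP (fun z => decide (z ≤ y)) := by
      have := (h1 _ (down_le y)).1
      rcases Nat.eq_zero_or_pos (S.countP (fun z => decide (z ≤ y))) with h | h
      · rw [h] at this; omega
      · exact h
    have b3 : 0 < (pivots M B xs).countP (fun z => decide (z ≤ y)) := by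
      rw [hcnt _ (down_le y)]
      exact Nat.div_pos (by omega) hk0
    rw [lt_countP_iff hps (down_le y) 0 hpos, decide_eq_true_eq] at b3
    exact absurd b3 (not_le.2 hc)
  · intro t ht
    have hc := length_cls_le hps ht xs _ hD
    have hkf : (k - 1) * fMax M B ≤ S.length ∨ k = B := by
      rcases le_total ((S.length + fMax M B - 1) / fMax M B) B with h | h
      · right; exact max_eq_right h
      · left
        have : k = (S.length + fMax M B - 1) / fMax M B := max_eq_left h
        have h5 : k * fMax M B ≤ S.length + fMax M B - 1 := by
          rw [this]; exact Nat.div_mul_le_self _ _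
        rw [Nat.sub_mul, one_mul]
        omega
    rcases h4 with ⟨rfl, rfl⟩ | h4
    · rw [pow_zero, one_mul, add_zero] at hc
      rcases hkf with h | h
      · right
        calc _ ≤ (k - 1) * gFac M B := Nat.mul_le_mul_right _ hc
          _ ≤ (k - 1) * fMax M B := Nat.mul_le_mul_left _ (by unfold fMax; omega)
          _ ≤ _ := h.trans hSx
      · left; omega
    · right
      have hkf' : (k - 1) * fMax M B ≤ S.length := by
        rcases hkf with h | h
        · exact h
        · rw [h]
          have : B * (8 * gFac M B) ≤ 16 * B * gFac M B ^ 2 := by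
            calc B * (8 * gFac M B) ≤ B * (16 * gFac M B ^ 2) :=
                  Nat.mul_le_mul_left _ (by nlinarith)
              _ = _ := by ring
          have : (B - 1) * fMax M B ≤ B * fMax M B := Nat.mul_le_mul_right _ (by omega)
          unfold fMax at *
          omega
      have hSE : 2 ^ H * S.length ≤ xs.length + E := by
        have := (h1 _ down_true).2
        simpa only [List.countP_true] using this
      have hHN : H ≤ Nat.log 2 N := by
        apply Nat.le_log_of_pow_le (by norm_num)
        omega
      have hHB : H ≤ B * gFac M B := by have := hg.2.2; omega
      have hE : fMax M B * E ≤ xs.length := by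
        have c1 : fMax M B * E * (2 * K) ≤ fMax M B * (4 * (B * gFac M B) * xs.length) := by
          calc fMax M B * E * (2 * K) = fMax M B * (E * (2 * K)) := by ring
            _ ≤ fMax M B * (4 * H * xs.length) := Nat.mul_le_mul_left _ h2
            _ ≤ _ := by gcongr
        have c2 : fMax M B * (4 * (B * gFac M B) * xs.length) ≤ xs.length * (2 * K) := by
          unfold fMax
          calc 8 * gFac M B * (4 * (B * gFac M B) * xs.length)
              = xs.length * (2 * (16 * B * gFac M B ^ 2)) := by ring
            _ ≤ _ := by gcongr
        exact Nat.le_of_mul_le_mul_right (c1.trans c2) (by omega)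
      have hf1 : E ≤ fMax M B * E := Nat.le_mul_of_pos_left _ hf
      have : (List.filter (inCls dle (pivots M B xs) (t + 1)) xs).length * fMax M B
          ≤ 8 * xs.length := by
        calc _ ≤ (2 ^ H * (k - 1) + E) * fMax M B := Nat.mul_le_mul_right _ hc
          _ = 2 ^ H * ((k - 1) * fMax M B) + fMax M B * E := by ring
          _ ≤ 2 ^ H * S.length + xs.length := by gcongr
          _ ≤ _ := by omega
      unfold fMax at this
      nlinarith

end Pivots

/-! ### Addresses, bounds and files -/

/-- The bound for the integers of the program. -/
def wMax (N : ℕ) : ℕ := (N + 2) ^ 20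

theorem add_lt_wMax (N : ℕ) : N + 14 < wMax N := by
  have h1 : 2 ^ 19 ≤ (N + 2) ^ 19 := Nat.pow_le_pow_left (by omega) 19
  unfold wMax
  rw [pow_succ]
  nlinarith

theorem adr_inj {N a l p c j u a' l' p' c' j' u' : ℕ} :
    adr N a l p c j u = adr N a' l' p' c' j' u' ↔
      a = a' ∧ l = l' ∧ p = p' ∧ c = c' ∧ j = j' ∧ u = u' := by
  simp only [adr, Nat.add_left_cancel_iff, Nat.pair_eq_pair]
  tauto

theorem pair_lt {a b Y : ℕ} (ha : a < Y) (hb : b < Y) : Nat.pair a b < Y ^ 2 :=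
  lt_of_lt_of_le (Nat.pair_lt_max_add_one_sq a b)
    (Nat.pow_le_pow_left (by have := max_lt ha hb; omega) 2)

theorem adr_lt {N a l p c j u : ℕ} (ha : a ≤ 3) (hl : l ≤ N + 1) (hp : p ≤ N + 1) (hc : c ≤ N + 1)
    (hj : j ≤ N + 1) (hu : u ≤ N + 1) : adr N a l p c j u < wMax N := by
  have hY : N + 2 ≤ (N + 2) ^ 2 := Nat.le_self_pow (by norm_num) _
  have h4 : 2 ^ 2 ≤ (N + 2) ^ 2 := Nat.pow_le_pow_left (by omega) 2
  have h8 : (N + 2) ^ 2 ≤ ((N + 2) ^ 2) ^ 2 := Nat.le_self_pow (by norm_num) _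
  have h1 := pair_lt (a := a) (b := l) (Y := (N + 2) ^ 2) (by omega) (by omega)
  have h2 := pair_lt (a := p) (b := c) (Y := (N + 2) ^ 2) (by omega) (by omega)
  have h3 := pair_lt (a := j) (b := u) (Y := (N + 2) ^ 2) (by omega) (by omega)
  have h5 := pair_lt h1 h2
  have h6 := pair_lt h5 (lt_of_lt_of_le h3 (Nat.le_self_pow (n := 2) (by norm_num) _))
  rw [← pow_mul, ← pow_mul, ← pow_mul] at h6
  norm_num at h6
  unfold adr wMax
  have h9 : N ≤ (N + 2) ^ 16 := (show N ≤ N + 2 by omega).trans (Nat.le_self_pow (by norm_num) _)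
  have h10 : 2 ^ 4 ≤ (N + 2) ^ 4 := Nat.pow_le_pow_left (by omega) 4
  rw [show (N + 2) ^ 20 = (N + 2) ^ 16 * (N + 2) ^ 4 by ring]
  nlinarith

theorem scrAdr_inj {N h i h' i' : ℕ} : scrAdr N h i = scrAdr N h' i' ↔ h = h' ∧ i = i' := by
  simp [scrAdr, adr_inj]

theorem fileAdr_inj {N : ℕ} {nd : Node} : Function.Injective (fileAdr N nd) := by
  intro i i' h
  unfold fileAdr at h
  split_ifs at h
  · exact h
  · exact (adr_inj.1 h).2.2.2.2.2

theorem scrAdr_ne_fileAdr {N h i i' : ℕ} {nd : Node} (hi : nd.lev = 0 → i' < N) :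
    scrAdr N h i ≠ fileAdr N nd i' := by
  unfold scrAdr fileAdr
  split_ifs with h0
  · have := hi h0
    unfold adr
    omega
  · rw [Ne, adr_inj]
    omega

theorem scrAdr_ne_idxAdr {N h i jl u : ℕ} {nd : Node} : scrAdr N h i ≠ idxAdr N nd jl u := by
  rw [scrAdr, idxAdr, Ne, adr_inj]
  omega

section Files

variable {α : Type u} {B : ℕ}

theorem keysOf_keyBlock (xs : List α) (h : xs.length ≤ B) : keysOf (keyBlock B xs) = xs := by
  have : keysOf (keyBlock B xs) = (List.range B).filterMap (fun i => xs[i]?) := by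
    unfold keysOf keyBlock
    rw [show List.ofFn (fun j : Fin B => areaKey xs j.val) = (List.range B).map (areaKey xs) by
      rw [List.ofFn_eq_map, ← List.map_coe_finRange_eq_range, List.map_map]; rfl,
      List.filterMap_map]
    congr 1
    funext i
    exact areaKey_key? xs i
  rw [this, filterMap_range_getElem? xs B h]

/-- The blocks at the addresses `ad 0`, `ad 1`, … hold the list `xs`. -/
def FileAt (d : ℕ → Fin B → Word α) (ad : ℕ → ℕ) (xs : List α) : Prop :=
  ∀ i, i * B < xs.length → d (ad i) = keyBlock B ((xs.drop (i * B)).take B)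

theorem FileAt.congr {d d' : ℕ → Fin B → Word α} {ad : ℕ → ℕ} {xs : List α} (h : FileAt d ad xs)
    (hd : ∀ i, i * B < xs.length → d' (ad i) = d (ad i)) : FileAt d' ad xs :=
  fun i hi => (hd i hi).trans (h i hi)

theorem FileAt.append {d : ℕ → Fin B → Word α} {ad : ℕ → ℕ} {zs ys : List α} {o : ℕ}
    (had : Function.Injective ad) (h : FileAt d ad zs) (ho : zs.length = o * B)
    (hy : ys.length ≤ B) (hB : 0 < B) :
    FileAt (Function.update d (ad o) (keyBlock B ys)) ad (zs ++ ys) := by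
  intro i hi
  rw [List.length_append] at hi
  rcases Nat.lt_trichotomy i o with h' | rfl | h'
  · rw [Function.update_of_ne (fun e => h'.ne (had e)), h i (by nlinarith)]
    have : (i + 1) * B ≤ o * B := Nat.mul_le_mul_right _ h'
    rw [Nat.succ_mul] at this
    rw [List.drop_append_of_le_length (by omega),
      List.take_append_of_le_length (by rw [List.length_drop]; omega)]
  · rw [Function.update_self, ← ho, List.drop_left, List.take_of_length_le hy]
  · have : (o + 1) * B ≤ i * B := Nat.mul_le_mul_right _ h'
    rw [Nat.succ_mul] at this
    omega

end Files

/-! ### Steps of the algorithm -/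

section Bounds

variable {α : Type u} {B : ℕ}

/-- The state fits into the memory. -/
structure Bd (N M : ℕ) (s : St α B) : Prop where
  ctl : ∀ k ∈ s.ctl, k ≤ N + 12
  nums : ∀ k ∈ s.nums, k ≤ N
  piv_len : s.piv.length ≤ capac M B
  pool_len : s.pool.length ≤ capac M B
  nums_len : s.nums.length ≤ capac M B

theorem Bd.set_buf {N M : ℕ} {s : St α B} (h : Bd N M s) (bf : Fin B → Word α) :
    Bd N M { s with buf := bf } := ⟨h.ctl, h.nums, h.piv_len, h.pool_len, h.nums_len⟩

theorem Bd.fits {N M : ℕ} {s s' : St α B} (h : Bd N M s')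
    (hb : s'.buf = s.buf ∨ ∀ j k, s'.buf j = .num k → k ≤ N) :
    Fits (wMax N) (capac M B) s s' where
  ctl k hk := lt_of_le_of_lt (h.ctl k hk) (by have := add_lt_wMax N; omega)
  nums k hk := by have := add_lt_wMax N; have := h.nums k hk; omega
  piv_len := h.piv_len
  pool_len := h.pool_len
  nums_len := h.nums_len
  buf := by
    refine hb.imp_right fun h j k hk => ?_
    have := add_lt_wMax N
    have := h j k hk
    omega

theorem keyBlock_num {N : ℕ} (xs : List α) (j : Fin B) (k : ℕ) (h : keyBlock B xs j = .num k) :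
    k ≤ N := by
  unfold keyBlock areaKey at h
  split_ifs at h
  rw [Word.num.injEq] at h
  omega

end Bounds

section Runs

variable {α : Type u} [LinearOrder α] {N M B : ℕ} {q : Word α}

/-- Reachability for the algorithm. -/
abbrev Goes (N M : ℕ) (q : Word α) (s : St α B) (d : ℕ → Fin B → Word α) (t : ℕ)
    (s' : St α B) (d' : ℕ → Fin B → Word α) : Prop :=
  Reach (algStep N M B α dle) (wMax N) (capac M B) q s d t s' d'

theorem goes_read {s s₁ : St α B} {d : ℕ → Fin B → Word α} {a : ℕ}
    (h : algStep N M B α dle q s = (s₁, .read a)) (ha : a < wMax N) (hb : Bd N M s₁)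
    (hbuf : s₁.buf = s.buf) : Goes N M q s d 1 { s₁ with buf := d a } d :=
  .read a h ha (hb.fits (.inl hbuf)) (.refl _ _)

theorem goes_write {s s₁ : St α B} {d : ℕ → Fin B → Word α} {a : ℕ}
    (h : algStep N M B α dle q s = (s₁, .write a)) (ha : a < wMax N) (hb : Bd N M s₁)
    (hbuf : ∀ j k, s₁.buf j = .num k → k ≤ N) :
    Goes N M q s d 1 s₁ (Function.update d a s₁.buf) :=
  .write a h ha (hb.fits (.inr hbuf)) (.refl _ _)

theorem zero_lt_wMax : 0 < wMax N := by have := add_lt_wMax N; omega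

/-- The address of block `i` of the file that is being sampled. -/
def srcAdr (N : ℕ) (nd : Node) (h i : ℕ) : ℕ := if h = 0 then fileAdr N nd i else scrAdr N h i

theorem fileAdr_lt {nd : Node} (h1 : nd.lev ≤ N + 1) (h2 : nd.plo ≤ N + 1) (h3 : nd.ch ≤ N + 1) {i : ℕ}
    (hi : i ≤ N) : fileAdr N nd i < wMax N := by
  unfold fileAdr
  split_ifs
  · have := add_lt_wMax N; omega
  · exact adr_lt (by omega) h1 h2 h3 (by omega) (by omega)

/-- The node is one of the nodes of the tree, as far as its size is concerned. -/
structure Node.Bdd (N : ℕ) (nd : Node) : Prop where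
  lev_sz : nd.lev + nd.sz ≤ N
  lo_sz : nd.lo + nd.sz ≤ N
  plo : nd.plo ≤ N
  ch : nd.ch ≤ N

/-- Reading blocks into the pool until the load is complete. -/
theorem goes_load (hB : 0 < B) (hcap : loadSize M B ≤ capac M B) {d : ℕ → Fin B → Word α}
    {xs : List α} (hN : xs.length ≤ N) (r : ℕ) (s : St α B) (hpc : s.pc = 4)
    (hnd : s.nd.Bdd N) (hh : s.h ≤ N) (hfs : s.fs = xs.length)
    (hfile : FileAt d (srcAdr N s.nd s.h) xs) (hr : s.pool.length + r * B = loadSize M B)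
    (hbd : Bd N M s) :
    ∃ t i' bf, Goes N M q s d t
        { s with pool := s.pool ++ (xs.drop (s.i * B)).take (r * B), i := i', buf := bf } d ∧
      xs.drop (i' * B) = (xs.drop (s.i * B)).drop (r * B) ∧ t = 2 * (i' - s.i) ∧
      s.i ≤ i' ∧ (i' = s.i + r ∨ xs.length ≤ i' * B) ∧ (i' = s.i ∨ i' * B < xs.length + B) ∧
      i' ≤ s.i + r ∧
      Bd N M { s with pool := s.pool ++ (xs.drop (s.i * B)).take (r * B), i := i', buf := bf } := by
  induction r generalizing s with
  | zero =>
    refine ⟨0, s.i, s.buf, ?_, by simp, by simp, le_rfl, by simp, by simp, by simp, ?_⟩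
    · simp only [Nat.zero_mul, List.take_zero, List.append_nil]
      exact .refl _ _
    · simp only [Nat.zero_mul, List.take_zero, List.append_nil]
      exact hbd
  | succ r ih =>
    have hctl := hbd.ctl
    simp only [St.ctl, List.mem_cons, List.not_mem_nil, or_false, forall_eq_or_imp, forall_eq]
      at hctl
    have hp := hnd.plo
    have hc := hnd.ch
    have hls := hnd.lev_sz
    by_cases hi : s.i * B < xs.length
    · have hiN : s.i < N := by
        have : s.i ≤ s.i * B := Nat.le_mul_of_pos_right _ hB
        omega
      rw [Nat.succ_mul] at hr
      have hblk : ((xs.drop (s.i * B)).take B).length ≤ B := by simp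
      have s1 : algStep N M B α dle q s
          = ({ s with pc := 5 }, .read (srcAdr N s.nd s.h s.i)) := by
        unfold algStep
        rw [hpc]
        show sampleStep N M dle s = _
        unfold sampleStep
        rw [if_pos ⟨by omega, by rw [hfs]; exact hi⟩]
        rfl
      have b1 : Bd N M { s with pc := 5 } := by
        refine ⟨?_, hbd.nums, hbd.piv_len, hbd.pool_len, hbd.nums_len⟩
        simp only [St.ctl, List.mem_cons, List.not_mem_nil, or_false, forall_eq_or_imp, forall_eq]
        omega
      have a1 : srcAdr N s.nd s.h s.i < wMax N := by
        unfold srcAdr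
        split_ifs
        · exact fileAdr_lt (by omega) (by omega) (by omega) (by omega)
        · exact adr_lt (by omega) (by omega) (by omega) (by omega) (by omega) (by omega)
      have g1 := goes_read (d := d) s1 a1 b1 rfl
      rw [hfile s.i hi] at g1
      set blk := (xs.drop (s.i * B)).take B with hblkdef
      have s2 : algStep N M B α dle q { s with pc := 5, buf := keyBlock B blk }
          = ({ s with pc := 4, pool := s.pool ++ blk, i := s.i + 1, buf := keyBlock B blk },
              .read 0) := by
        show absorbStep { s with pc := 5, buf := keyBlock B blk } = _
        unfold absorbStep
        simp only [keysOf_keyBlock blk hblk]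
      have b2 : Bd N M
          { s with pc := 4, pool := s.pool ++ blk, i := s.i + 1, buf := keyBlock B blk } := by
        refine ⟨?_, hbd.nums, hbd.piv_len, ?_, hbd.nums_len⟩
        · simp only [St.ctl, List.mem_cons, List.not_mem_nil, or_false, forall_eq_or_imp,
            forall_eq]
          omega
        · simp only [List.length_append]; omega
      have g2 := goes_read (d := d) s2 zero_lt_wMax b2 rfl
      have g12 := g1.trans g2
      by_cases hfull : (s.i + 1) * B ≤ xs.length
      · have hlb : blk.length = B := by
          rw [hblkdef, List.length_take, List.length_drop]
          rw [Nat.succ_mul] at hfull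
          omega
        obtain ⟨t, i', bf, g3, e1, e2, e3, e4, e5, e7, e6⟩ := ih
          { s with pc := 4, pool := s.pool ++ blk, i := s.i + 1, buf := d 0 } rfl hnd hh hfs hfile
          (by simp only [List.length_append]; omega) (b2.set_buf _)
        have hpool : s.pool ++ blk ++ (xs.drop ((s.i + 1) * B)).take (r * B)
            = s.pool ++ (xs.drop (s.i * B)).take ((r + 1) * B) := by
          rw [List.append_assoc, hblkdef, Nat.succ_mul r, Nat.add_comm (r * B) B, List.take_add,
            List.drop_drop, Nat.succ_mul]
        refine ⟨_, i', bf, ?_, ?_, rfl, by simp only at e3; omega, ?_, ?_, by simp only at e7; omega, ?_⟩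
        · have := g12.trans g3
          simp only [hpool] at this
          rw [← hpc] at this
          rw [show 2 * (i' - s.i) = 1 + 1 + t by simp only at e2 e3; omega]
          exact this
        · simp only at e1
          rw [e1, List.drop_drop, List.drop_drop]
          congr 1; ring
        · simp only at e4
          rcases e4 with e4 | e4
          · left; omega
          · right; exact e4
        · simp only at e5
          rcases e5 with e5 | e5
          · right
            rw [e5, Nat.succ_mul]; omega
          · right; exact e5
        · simp only [hpool] at e6
          rw [← hpc] at e6
          exact e6
      · rw [not_le] at hfull
        have hfull' := hfull
        rw [Nat.succ_mul] at hfull'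
        have hb : blk = (xs.drop (s.i * B)).take ((r + 1) * B) := by
          rw [hblkdef, List.take_of_length_le (by rw [List.length_drop]; omega),
            List.take_of_length_le (by rw [List.length_drop, Nat.succ_mul]; omega)]
        rw [← hb]
        refine ⟨2, s.i + 1, d 0, ?_, ?_, by omega, by omega, .inr hfull.le, .inr ?_, by omega, ?_⟩
        · rw [← hpc] at g12
          exact g12
        · rw [List.drop_eq_nil_of_le hfull.le, List.drop_eq_nil_of_le]
          rw [List.length_drop, Nat.succ_mul]; omega
        · rw [Nat.succ_mul]; omega
        · rw [← hpc] at b2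
          exact b2.set_buf _
    · rw [not_lt] at hi
      have hd0 : xs.drop (s.i * B) = [] := List.drop_eq_nil_of_le hi
      refine ⟨0, s.i, s.buf, ?_, by simp [hd0], by simp, le_rfl, .inr hi, .inl rfl, by omega, ?_⟩
      · simp only [hd0, List.take_nil, List.append_nil]
        exact .refl _ _
      · simp only [hd0, List.take_nil, List.append_nil]
        exact hbd

end Runs

section Sampling

variable {α : Type u} [LinearOrder α] {N M B : ℕ} {q : Word α}

/-- Writing the pool to the next scratch file. -/
theorem goes_emit (hB : 0 < B) (s : St α B) (d : ℕ → Fin B → Word α) (zs : List α)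
    (hpc : s.pc = 6) (hh : s.h < N) (hzs : zs.length = s.o * B)
    (hN : zs.length + s.pool.length ≤ N) (hfile : FileAt d (scrAdr N (s.h + 1)) zs)
    (hbd : Bd N M s) :
    ∃ t o' bf d', Goes N M q s d t { s with pool := [], o := o', buf := bf } d' ∧
      FileAt d' (scrAdr N (s.h + 1)) (zs ++ s.pool) ∧
      (∀ a, (∀ i, a ≠ scrAdr N (s.h + 1) i) → d' a = d a) ∧
      t * B < s.pool.length + B ∧ (∀ r, s.pool.length = r * B → o' = s.o + r) ∧
      Bd N M { s with pool := [], o := o', buf := bf } := by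
  induction hn : s.pool.length using Nat.strong_induction_on generalizing s d zs with
  | _ n ih =>
    rcases Nat.eq_zero_or_pos n with h0 | h0
    · rw [h0, List.length_eq_zero_iff] at hn
      refine ⟨0, s.o, s.buf, d, ?_, by simpa [hn] using hfile, fun _ _ => rfl, by simp; omega, ?_, ?_⟩
      · rw [← hn]; exact .refl _ _
      · intro r hr
        rw [h0] at hr
        have : r = 0 := by
          rcases Nat.mul_eq_zero.1 hr.symm with h | h <;> omega
        omega
      · rw [← hn]; exact hbd
    · have hctl := hbd.ctl
      simp only [St.ctl, List.mem_cons, List.not_mem_nil, or_false, forall_eq_or_imp, forall_eq]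
        at hctl
      have hoN : s.o < N := by
        have : s.o ≤ s.o * B := Nat.le_mul_of_pos_right _ hB
        omega
      set s1 : St α B :=
        { s with pool := s.pool.drop B, o := s.o + 1, buf := keyBlock B (s.pool.take B) } with hs1
      have e1 : algStep N M B α dle q s = (s1, .write (scrAdr N (s.h + 1) s.o)) := by
        unfold algStep
        rw [hpc]
        show emitStep N s = _
        unfold emitStep
        rw [if_pos (by omega)]
      have b1 : Bd N M s1 := by
        refine ⟨?_, hbd.nums, hbd.piv_len, ?_, hbd.nums_len⟩
        · simp only [hs1, St.ctl, List.mem_cons, List.not_mem_nil, or_false, forall_eq_or_imp,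
            forall_eq]
          omega
        · simp only [hs1, List.length_drop]
          have := hbd.pool_len
          omega
      have g1 := goes_write (d := d) e1
        (adr_lt (by omega) (by omega) (by omega) (by omega) (by omega) (by omega)) b1
        (fun j k hk => keyBlock_num _ j k hk)
      have hf1 := hfile.append (fun i i' h => (scrAdr_inj.1 h).2) hzs
        (ys := s.pool.take B) (by simp) hB
      set d1 := Function.update d (scrAdr N (s.h + 1) s.o) (keyBlock B (s.pool.take B)) with hd1
      have hd1' : ∀ a, (∀ i, a ≠ scrAdr N (s.h + 1) i) → d1 a = d a := fun a ha =>
        Function.update_of_ne (ha _) _ _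
      have htd := List.take_append_drop B s.pool
      by_cases hle : n ≤ B
      · have hdr : s.pool.drop B = [] := List.drop_eq_nil_of_le (by omega)
        have htk : s.pool.take B = s.pool := List.take_of_length_le (by omega)
        refine ⟨1, s.o + 1, keyBlock B (s.pool.take B), d1, ?_, by rw [← htk]; exact hf1, hd1',
          by omega, ?_, ?_⟩
        · rw [hs1, hdr] at g1; exact g1
        · intro r hr
          rw [hr] at hle h0
          have h3 : r ≤ 1 := by
            by_contra hc
            have : 2 * B ≤ r * B := Nat.mul_le_mul_right _ (by omega)
            omega
          have h4 : r ≠ 0 := by rintro rfl; omega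
          omega
        · rw [hs1, hdr] at b1; exact b1
      · obtain ⟨t, o', bf, d', g2, f2, h2, c2, r2, b2⟩ := ih (n - B) (by omega) s1 d1
          (zs ++ s.pool.take B) hpc hh
          (by simp only [hs1, List.length_append, List.length_take, Nat.succ_mul]; omega)
          (by simp only [hs1, List.length_append, List.length_take, List.length_drop]; omega) hf1 b1
          (by simp only [hs1, List.length_drop]; omega)
        refine ⟨1 + t, o', bf, d', g1.trans g2, ?_, fun a ha => (h2 a ha).trans (hd1' a ha), ?_,
          ?_, b2⟩
        · simp only [hs1, List.append_assoc, htd] at f2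
          exact f2
        · rw [Nat.add_mul, Nat.one_mul]; omega
        · intro r hr
          have h4 : r ≠ 0 := by rintro rfl; omega
          obtain ⟨r', rfl⟩ := Nat.exists_eq_succ_of_ne_zero h4
          have := r2 r' (by rw [Nat.succ_mul] at hr; omega)
          simp only [hs1] at this
          omega

/-- One round of sampling. -/
theorem goes_round (hg : Good N M B) {xs : List α} (hN : xs.length ≤ N)
    (hK : loadSize M B < xs.length) (s : St α B) (d : ℕ → Fin B → Word α) (zs : List α)
    (hpc : s.pc = 4) (hpool : s.pool = []) (hnd : s.nd.Bdd N)
    (hh : s.h < N) (hfs : s.fs = xs.length)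
    (hfile : FileAt d (srcAdr N s.nd s.h) xs) (hi : s.i * B < xs.length)
    (hzs : zs.length = s.o * B) (hzN : 2 * zs.length ≤ s.i * B)
    (hout : FileAt d (scrAdr N (s.h + 1)) zs) (hbd : Bd N M s) :
    ∃ t bf d', Goes N M q s d t
        { s with h := s.h + 1, fs := (s.fs + 1) / 2, i := 0, o := 0, buf := bf } d' ∧
      FileAt d' (scrAdr N (s.h + 1)) (zs ++ samplePass (loadSize M B) (xs.drop (s.i * B))) ∧
      (∀ a, (∀ i, a ≠ scrAdr N (s.h + 1) i) → d' a = d a) ∧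
      t * B ≤ 5 * (xs.length - s.i * B) + 6 * B ∧
      Bd N M { s with h := s.h + 1, fs := (s.fs + 1) / 2, i := 0, o := 0, buf := bf } := by
  have hB : 0 < B := by have := hg.1; omega
  have hcap := hg.load_le_capac
  obtain ⟨kk, hkk⟩ : ∃ kk, kk = M / B / 16 := ⟨_, rfl⟩
  have hload : loadSize M B = (2 * kk) * B := by rw [loadSize, hkk]; ring
  have hkk4 : 4 ≤ kk := by
    have := hg.load_ge
    have := hg.gFac_ge
    rw [hkk]; nlinarith
  have hkB : 4 * B ≤ kk * B := Nat.mul_le_mul_right _ hkk4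
  have hkB2 : 2 * kk * B = 2 * (kk * B) := Nat.mul_assoc _ _ _
  induction hn : xs.length - s.i * B using Nat.strong_induction_on generalizing s d zs with
  | _ n ih =>
    obtain ⟨t1, i', bf1, g1, e1, e2, e3, e4, e5, e7, b1⟩ := goes_load (q := q) hB hcap hN (2 * kk) s
      hpc hnd hh.le hfs hfile (by rw [hpool, hload]; simp) hbd
    rw [hpool] at g1 b1
    simp only [List.nil_append] at g1 b1
    set ld := (xs.drop (s.i * B)).take (2 * kk * B) with hld
    have hldlen : ld.length = min (2 * kk * B) (xs.length - s.i * B) := by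
      rw [hld, List.length_take, List.length_drop]
    have hctl := b1.ctl
    simp only [St.ctl, List.mem_cons, List.not_mem_nil, or_false, forall_eq_or_imp, forall_eq]
      at hctl
    -- the load is sorted and halved
    set s2 : St α B :=
      { s with pc := 6, pool := everyNth 2 (ld.mergeSort dle), i := i', buf := bf1 } with hs2
    have st2 : algStep N M B α dle q { s with pool := ld, i := i', buf := bf1 }
        = (s2, .read 0) := by
      unfold algStep
      simp only [hpc]
      unfold sampleStep
      rw [if_neg, if_neg]
      · simp only [hfs]; omega
      · simp only [hldlen, hload, hfs]
        rcases e4 with e4 | e4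
        · intro hc
          have h1 := List.length_drop (l := xs) (i := i' * B)
          rw [e1, List.length_drop, List.length_drop] at h1
          omega
        · omega
    have hhalf : (everyNth 2 (ld.mergeSort dle)).length = (ld.length + 1) / 2 := by
      rw [length_everyNth (by norm_num), List.length_mergeSort]; rfl
    have b2 : Bd N M s2 := by
      refine ⟨?_, b1.nums, b1.piv_len, ?_, b1.nums_len⟩
      · simp only [hs2, St.ctl, List.mem_cons, List.not_mem_nil, or_false, forall_eq_or_imp,
          forall_eq]
        omega
      · simp only [hs2, hhalf]
        have := b1.pool_len
        simp only at this
        omega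
    have g2 := goes_read (d := d) st2 zero_lt_wMax b2 rfl
    obtain ⟨t3, o', bf3, d3, g3, f3, h3, c3, r3, b3⟩ := goes_emit (q := q) hB
      { s2 with buf := d 0 } d zs rfl hh hzs (by simp only [hs2, hhalf]; omega) hout (b2.set_buf _)
    simp only [hs2] at g3 f3 c3 r3 b3 h3
    rw [hhalf] at c3 r3
    have hctl3 := b3.ctl
    simp only [St.ctl, List.mem_cons, List.not_mem_nil, or_false, forall_eq_or_imp, forall_eq]
      at hctl3
    have g123 := (g1.trans g2).trans g3
    have hpass : samplePass (loadSize M B) (xs.drop (s.i * B))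
        = everyNth 2 (ld.mergeSort dle) ++ samplePass (loadSize M B) (xs.drop (i' * B)) := by
      rw [samplePass, dif_neg (by rw [List.length_drop]; omega), hload, ← hld, e1]
    have hrest : xs.length - i' * B = n - 2 * kk * B := by
      have h1 := List.length_drop (l := xs) (i := i' * B)
      rw [e1, List.length_drop, List.length_drop] at h1
      omega
    by_cases hend : i' * B < xs.length
    · -- another load
      have hi' : i' = s.i + 2 * kk := e4.resolve_right (by omega)
      have hldK : ld.length = 2 * kk * B := by
        rw [hldlen]; omega
      set s4 : St α B := { s with pc := 4, pool := [], i := i', o := o', buf := bf3 } with hs4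
      have st4 : algStep N M B α dle q { s with pc := 6, pool := [], i := i', o := o', buf := bf3 }
          = (s4, .read 0) := by
        show emitStep N _ = _
        unfold emitStep
        rw [if_neg (by simp), if_pos (by rw [hfs]; exact hend)]
      have b4 : Bd N M s4 := by
        refine ⟨?_, b3.nums, b3.piv_len, b3.pool_len, b3.nums_len⟩
        simp only [hs4, St.ctl, List.mem_cons, List.not_mem_nil, or_false, forall_eq_or_imp,
          forall_eq]
        omega
      have g4 := goes_read (d := d3) st4 zero_lt_wMax b4 rfl
      have ho' : o' = s.o + kk := r3 kk (by rw [hldK, Nat.mul_assoc]; omega)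
      have hfile3 : FileAt d3 (srcAdr N s.nd s.h) xs := hfile.congr fun i hi => by
        apply h3
        intro i2
        unfold srcAdr
        split_ifs with h0
        · refine (scrAdr_ne_fileAdr fun _ => ?_).symm
          have : i ≤ i * B := Nat.le_mul_of_pos_right _ hB
          omega
        · rw [Ne, scrAdr_inj]; omega
      obtain ⟨t5, bf5, d5, g5, f5, h5, c5, b5⟩ := ih (n - 2 * kk * B) (by omega)
        { s4 with buf := d3 0 } d3 (zs ++ everyNth 2 (ld.mergeSort dle)) rfl rfl hnd hh hfs hfile3
        hend (by
          simp only [hs4, List.length_append, hhalf, hldK, ho', Nat.add_mul, hzs, Nat.mul_assoc]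
          omega)
        (by
          simp only [hs4, List.length_append, hhalf, hldK, hi', Nat.add_mul, Nat.mul_assoc]
          omega) f3 (b4.set_buf _) hrest
      simp only [hs4, List.append_assoc, ← hpass] at g5 f5 c5 b5 h5
      refine ⟨t1 + 1 + t3 + 1 + t5, bf5, d5, ?_, f5, fun a ha => (h5 a ha).trans (h3 a ha), ?_, ?_⟩
      · have := (g123.trans g4).trans g5
        rw [← hpc, ← hpool] at this
        exact this
      · have ht1 : t1 * B = 4 * (kk * B) := by
          rw [e2, hi', show s.i + 2 * kk - s.i = 2 * kk by omega]; ring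
        have h6 : 2 * kk * B = 2 * (kk * B) := by ring
        rw [hldK, h6] at c3
        have hnk : 2 * (kk * B) < n := by
          have h7 : i' * B = s.i * B + 2 * (kk * B) := by rw [hi']; ring
          omega
        have h7 : (t1 + 1 + t3 + 1 + t5) * B = t1 * B + t3 * B + t5 * B + 2 * B := by ring
        rw [h7, ht1]
        rw [h6] at c5
        omega
      · rw [← hpc, ← hpool] at b5
        exact b5
    · have hnil : xs.drop (i' * B) = [] := List.drop_eq_nil_of_le (by omega)
      set s4 : St α B :=
        { s with
          pc := 4, pool := [], h := s.h + 1, fs := (s.fs + 1) / 2, i := 0, o := 0, buf := bf3 }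
        with hs4
      have st4 : algStep N M B α dle q { s with pc := 6, pool := [], i := i', o := o', buf := bf3 }
          = (s4, .read 0) := by
        show emitStep N _ = _
        unfold emitStep
        rw [if_neg (by simp), if_neg (by rw [hfs]; exact hend)]
      have b4 : Bd N M s4 := by
        refine ⟨?_, b3.nums, b3.piv_len, b3.pool_len, b3.nums_len⟩
        simp only [hs4, St.ctl, List.mem_cons, List.not_mem_nil, or_false, forall_eq_or_imp,
          forall_eq]
        omega
      have g4 := goes_read (d := d3) st4 zero_lt_wMax b4 rfl
      have hpass' : samplePass (loadSize M B) (xs.drop (s.i * B))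
          = everyNth 2 (ld.mergeSort dle) := by
        rw [hpass, hnil, samplePass, dif_pos (by simp), List.append_nil]
      refine ⟨t1 + 1 + t3 + 1, d3 0, d3, ?_, by rw [hpass']; exact f3, h3, ?_, ?_⟩
      · have := g123.trans g4
        simp only [hs4] at this
        rw [← hpc, ← hpool] at this
        exact this
      · have h5 : i' * B < xs.length + B := by
          rcases e5 with e5 | e5
          · rw [e5]; omega
          · exact e5
        have h6 : (t1 + 1 + t3 + 1) * B = t1 * B + t3 * B + 2 * B := by ring
        have h7 : t1 * B = 2 * (i' * B - s.i * B) := by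
          rw [e2, Nat.mul_assoc, Nat.sub_mul]
        rw [h6, h7]
        omega
      · have := b4.set_buf (d3 0)
        simp only [hs4] at this
        rw [← hpc, ← hpool] at this
        exact this

/-- The computation of the pivots. -/
theorem goes_pivots (hg : Good N M B) (xs : List α) : ∀ (s : St α B) (d : ℕ → Fin B → Word α),
    xs.length ≤ N → s.pc = 4 → s.pool = [] → s.i = 0 → s.o = 0 → s.nd.Bdd N →
    s.h + xs.length ≤ N → s.fs = xs.length → FileAt d (srcAdr N s.nd s.h) xs → Bd N M s →
    3 * (pivots M B xs).length ≤ capac M B →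
    ∃ t s' d', Goes N M q s d t s' d' ∧ s'.pc = 7 ∧ s'.nd = s.nd ∧ s'.i = 0 ∧ s'.pool = [] ∧
      s'.piv = pivots M B xs ∧ s'.nums = List.replicate (3 * (pivots M B xs).length) 0 ∧
      Bd N M s' ∧ (∀ a, (∀ h i, a ≠ scrAdr N h i) → d' a = d a) ∧
      t * B ≤ 12 * xs.length + 12 * B := by
  have hB : 0 < B := by have := hg.1; omega
  obtain ⟨kk, hkk⟩ : ∃ kk, kk = M / B / 16 := ⟨_, rfl⟩
  have hload : loadSize M B = 2 * kk * B := by rw [loadSize, hkk]; ring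
  have hload2 : loadSize M B = 2 * (B * (M / B / 16)) := by rw [loadSize]; ring
  have hkk4 : 4 ≤ kk := by
    have := hg.load_ge
    have := hg.gFac_ge
    rw [hkk]; nlinarith
  have hkB : 8 * B ≤ 2 * kk * B := Nat.mul_le_mul_right _ (by omega)
  revert xs
  refine finalSample_induction (K := B * (M / B / 16)) ?_ ?_ <;> intro xs hx
  · intro s d hN hpc hpool hi ho hnd hh hfs hfile hbd h3
    have hxl : xs.length ≤ loadSize M B := by
      rcases hx with h | h
      · omega
      · rw [h] at hload2; omega
    obtain ⟨t1, i', bf1, g1, e1, e2, e3, e4, e5, e7, b1⟩ := goes_load (q := q) hB hg.load_le_capac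
      hN (2 * kk) s hpc hnd (by omega) hfs hfile (by rw [hpool, hload]; simp) hbd
    have hld : s.pool ++ (xs.drop (s.i * B)).take (2 * kk * B) = xs := by
      rw [hpool, hi, Nat.zero_mul, List.drop_zero, List.take_of_length_le (by omega),
        List.nil_append]
    rw [hld] at g1 b1
    have hpv : pivots M B xs = everyNth (stride M B xs.length) (xs.mergeSort dle) := by
      unfold pivots
      rw [finalSample, dif_pos hx]
    have hend : ¬ i' * B < xs.length := by
      rcases e4 with e4 | e4
      · rw [e4, hi, Nat.zero_add]; omega
      · omega
    set s2 : St α B :=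
      { s with
        pc := 7, i := 0, pool := [], piv := pivots M B xs,
        nums := List.replicate (3 * (pivots M B xs).length) 0, buf := bf1 } with hs2
    have st2 : algStep N M B α dle q { s with pool := xs, i := i', buf := bf1 }
        = (s2, .read 0) := by
      unfold algStep
      simp only [hpc]
      unfold sampleStep
      rw [if_neg (by simp only [hfs]; tauto), if_pos (by simp only [hfs]; exact hxl)]
      simp only [hs2, hpv]
    have b2 : Bd N M s2 := by
      have hctl := hbd.ctl
      simp only [St.ctl, List.mem_cons, List.not_mem_nil, or_false, forall_eq_or_imp, forall_eq]
        at hctl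
      refine ⟨?_, ?_, ?_, by simp [hs2], by simpa [hs2] using h3⟩
      · simp only [hs2, St.ctl, List.mem_cons, List.not_mem_nil, or_false, forall_eq_or_imp,
          forall_eq]
        omega
      · intro k hk
        rw [List.eq_of_mem_replicate hk]; omega
      · simp only [hs2]; omega
    have g2 := goes_read (d := d) st2 zero_lt_wMax b2 rfl
    refine ⟨_, _, d, g1.trans g2, rfl, rfl, rfl, rfl, rfl, rfl, b2.set_buf _, fun _ _ => rfl, ?_⟩
    have h5 : i' * B < xs.length + B := by
      rcases e5 with e5 | e5
      · rw [e5, hi]; omega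
      · exact e5
    rw [Nat.add_mul, e2, hi, Nat.sub_zero, Nat.mul_assoc]
    omega
  · intro ih s d hN hpc hpool hi ho hnd hh hfs hfile hbd h3
    have hxl : loadSize M B < xs.length := by
      rw [not_or, not_le] at hx
      omega
    have hpv : pivots M B (samplePass (loadSize M B) xs) = pivots M B xs := by
      rw [hload2]
      unfold pivots
      conv_rhs => rw [finalSample, dif_neg hx]
    have hlen : (samplePass (loadSize M B) xs).length = (xs.length + 1) / 2 := by
      rw [hload2, length_samplePass (by rw [not_or] at hx; omega)]
    obtain ⟨t1, bf1, d1, g1, f1, h1, c1, b1⟩ := goes_round (q := q) hg hN hxl s d [] hpc hpool hnd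
      (by omega) hfs hfile (by rw [hi]; omega) (by simp [ho]) (by simp)
      (by intro i hi; simp at hi) hbd
    rw [hi, Nat.zero_mul, List.drop_zero, List.nil_append] at f1
    rw [← hload2] at ih
    have hB16 := hg.1
    obtain ⟨t2, s2, d2, g2, a1, a2, a3, a4, a5, a6, a7, a8, a9⟩ := ih
      { s with h := s.h + 1, fs := (s.fs + 1) / 2, i := 0, o := 0, buf := bf1 } d1
      (by omega) hpc hpool rfl rfl hnd (by simp only; omega) (by simp only; omega) f1 b1
      (by rw [hpv]; exact h3)
    rw [hpv] at a5 a6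
    refine ⟨t1 + t2, s2, d2, g1.trans g2, a1, a2, a3, a4, a5, a6, a7,
      fun a ha => (a8 a ha).trans (h1 a fun i => ha _ i), ?_⟩
    rw [Nat.add_mul]
    rw [hi] at c1
    omega

end Sampling

section Distribution

/-- The rest of a list after the first `B` elements with property `p` have been removed. -/
def removeBlock {β : Type v} (B : ℕ) (p : β → Bool) (ys : List β) : List β :=
  ys.filter (fun y => !p y) ++ (ys.filter p).drop B

theorem filter_removeBlock_self {β : Type v} (B : ℕ) (p : β → Bool) (ys : List β) :
    (removeBlock B p ys).filter p = (ys.filter p).drop B := by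
  unfold removeBlock
  rw [List.filter_append, List.filter_filter, List.filter_eq_nil_iff.2 (by simp), List.nil_append,
    List.filter_eq_self]
  intro a ha
  exact List.of_mem_filter (List.mem_of_mem_drop ha)

theorem filter_removeBlock_of_disjoint {β : Type v} (B : ℕ) {p p' : β → Bool} (ys : List β)
    (h : ∀ y, p' y = true → p y = false) : (removeBlock B p ys).filter p' = ys.filter p' := by
  unfold removeBlock
  have h2 : ((ys.filter p).drop B).filter p' = [] := by
    rw [List.filter_eq_nil_iff]
    intro a ha h'
    have := List.of_mem_filter (List.mem_of_mem_drop ha)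
    rw [h a h'] at this
    cases this
  rw [List.filter_append, List.filter_filter, h2, List.append_nil]
  congr 1
  funext y
  cases hy : p' y
  · rfl
  · simp [h y hy]

theorem removeBlock_subset {β : Type v} (B : ℕ) (p : β → Bool) (ys : List β) :
    removeBlock B p ys ⊆ ys := by
  unfold removeBlock
  refine List.append_subset_of_subset_of_subset (List.filter_subset_self _) ?_
  exact List.Subset.trans (List.drop_subset _ _) (List.filter_subset_self _)

theorem length_removeBlock {β : Type v} (B : ℕ) (p : β → Bool) (ys : List β) :
    (removeBlock B p ys).length + min B (ys.countP p) = ys.length := by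
  unfold removeBlock
  have h1 := List.length_eq_countP_add_countP p (l := ys)
  rw [List.length_append, List.length_drop, ← List.countP_eq_length_filter,
    ← List.countP_eq_length_filter]
  have : List.countP (fun y => !p y) ys = List.countP (fun a => decide ¬p a = true) ys := by
    congr 1; funext y; cases p y <;> rfl
  omega

variable {α : Type u} [LinearOrder α] {N M B : ℕ} {q : Word α}

theorem inCls_disjoint {piv : List α} {j j' : ℕ} (h : j' ≠ j) (y : α)
    (hy : inCls dle piv j' y = true) : inCls dle piv j y = false := by
  rw [inCls_iff] at hy
  rw [← Bool.not_eq_true, inCls_iff]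
  rintro ⟨_, h2⟩
  exact h (hy.2.symm.trans h2)

theorem sum_countP_inCls (piv ys : List α) (F : ℕ)
    (h : ∀ y ∈ ys, ∃ t < F, inCls dle piv (t + 1) y = true) :
    ∑ t ∈ Finset.range F, ys.countP (inCls dle piv (t + 1)) = ys.length := by
  induction ys with
  | nil => simp
  | cons y ys ih =>
    simp only [List.countP_cons, Finset.sum_add_distrib, List.length_cons]
    rw [ih fun z hz => h z (List.mem_cons_of_mem _ hz)]
    obtain ⟨t, ht, hy⟩ := h y List.mem_cons_self
    rw [Finset.sum_eq_single t]
    · simp [hy]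
    · intro t' _ hne
      rw [inCls_disjoint (j' := t + 1) (by omega) y hy]; simp
    · intro h'
      exact absurd (Finset.mem_range.2 ht) h'

theorem fileAdr_child_inj {nd : Node} {j j' i i' : ℕ} :
    fileAdr N (nd.child j 0 0) i = fileAdr N (nd.child j' 0 0) i' ↔ j = j' ∧ i = i' := by
  simp [fileAdr, Node.child, adr_inj]

theorem fileAdr_child_ne {nd : Node} {j i i' : ℕ} (hi : i' < N) :
    fileAdr N (nd.child j 0 0) i ≠ fileAdr N nd i' := by
  unfold fileAdr Node.child
  simp only [Nat.add_eq_zero_iff, one_ne_zero, and_false, if_false]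
  split_ifs
  · unfold adr; omega
  · rw [Ne, adr_inj]; omega

/-- The invariant of the distribution of a node after the part `zs` of its file has been read; `fl t`
is what has been written to the file of child `t + 1`. -/
structure Distributed (N M : ℕ) (nd : Node) (piv zs : List α) (fl : ℕ → List α) (s : St α B)
    (d : ℕ → Fin B → Word α) : Prop where
  pc : s.pc = 7
  node : s.nd = nd
  pivs : s.piv = piv
  nums : s.nums = (List.range (3 * piv.length)).map fun r => zs.countP (cntPred dle piv r)
  pool : ∀ y ∈ s.pool, ∃ t < piv.length, inCls dle piv (t + 1) y = true
  file : ∀ t < piv.length, FileAt d (fileAdr N (nd.child (t + 1) 0 0)) (fl t)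
  dvd : ∀ t < piv.length, s.i * B < nd.sz ∨ 0 < s.pool.countP (inCls dle piv (t + 1)) → B ∣ (fl t).length
  perm : ∀ t < piv.length, List.Perm (fl t ++ s.pool.filter (inCls dle piv (t + 1)))
    (zs.filter (inCls dle piv (t + 1)))
  bd : Bd N M s

theorem cntPred_cls (piv : List α) (t : ℕ) :
    cntPred dle piv (2 * piv.length + t) = inCls dle piv (t + 1) := by
  funext y
  unfold cntPred
  rw [if_neg (by omega), if_neg (by omega)]
  congr 2; omega

/-- Writing one block of a class. -/
theorem Distributed.flush {nd : Node} {piv zs : List α} {fl : ℕ → List α} {s : St α B}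
    {d : ℕ → Fin B → Word α} (h : Distributed N M nd piv zs fl s d) (hB : 0 < B) (hnd : nd.Bdd N)
    (hsz : 0 < nd.sz) (hzs : zs.length ≤ N) (hF : piv.length ≤ N) {t : ℕ}
    (hfind : (List.range s.piv.length).find? (fun t => decide
      ((if s.i * B < s.nd.sz then B else 1) ≤ s.pool.countP (inCls dle s.piv (t + 1)))) = some t) :
    ∃ s' fl' i, Goes N M q s d 1 s'
        (Function.update d (fileAdr N (nd.child (t + 1) 0 0) i) s'.buf) ∧
      Distributed N M nd piv zs fl' s'
        (Function.update d (fileAdr N (nd.child (t + 1) 0 0) i) s'.buf) ∧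
      s'.pool = removeBlock B (inCls dle piv (t + 1)) s.pool ∧ s'.i = s.i := by
  have htF := List.mem_of_find?_eq_some hfind
  rw [List.mem_range, h.pivs] at htF
  have hneed := List.find?_some hfind
  rw [decide_eq_true_eq, h.pivs] at hneed
  have hc : 0 < s.pool.countP (inCls dle piv (t + 1)) := by
    refine lt_of_lt_of_le ?_ hneed
    split_ifs <;> omega
  obtain ⟨o, ho⟩ := h.dvd t htF (.inr hc)
  have hlen := (h.perm t htF).length_eq
  rw [List.length_append, ← List.countP_eq_length_filter, ← List.countP_eq_length_filter] at hlen
  have hle : zs.countP (inCls dle piv (t + 1)) ≤ zs.length := List.countP_le_length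
  have hoN : o ≤ N := by
    have : o ≤ B * o := Nat.le_mul_of_pos_left _ hB
    omega
  have hnum : (s.nums.getD (2 * piv.length + t) 0
      - (s.pool.filter (inCls dle piv (t + 1))).length) / B = o := by
    rw [h.nums, List.getD_eq_getElem _ _ (by simp; omega), List.getElem_map, List.getElem_range,
      cntPred_cls, ← hlen, ← List.countP_eq_length_filter, Nat.add_sub_cancel, ho,
      Nat.mul_div_cancel_left _ hB]
  set cl := s.pool.filter (inCls dle piv (t + 1)) with hcl
  set s' : St α B :=
    { s with pool := removeBlock B (inCls dle piv (t + 1)) s.pool, buf := keyBlock B (cl.take B) }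
    with hs'
  have st : algStep N M B α dle q s
      = (s', .write (fileAdr N (nd.child (t + 1) 0 0) o)) := by
    unfold algStep
    rw [h.pc]
    show distStep N dle s = _
    unfold distStep
    simp only [hfind]
    simp only [h.node, h.pivs, ← hcl, hnum, hs', removeBlock]
  have hlr := length_removeBlock B (inCls dle piv (t + 1)) s.pool
  have b : Bd N M s' := by
    refine ⟨h.bd.ctl, h.bd.nums, h.bd.piv_len, ?_, h.bd.nums_len⟩
    have := h.bd.pool_len
    simp only [hs']; omega
  have hp := hnd.lev_sz
  have hq := hnd.lo_sz
  have g := goes_write (d := d) st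
    (fileAdr_lt (by simp [Node.child]; omega) (by simp [Node.child]; omega)
      (by simp [Node.child]; omega) hoN) b
    (fun j k hk => keyBlock_num _ j k hk)
  refine ⟨s', Function.update fl t (fl t ++ cl.take B), o, g, ?_, rfl, rfl⟩
  constructor
  · exact h.pc
  · exact h.node
  · exact h.pivs
  · exact h.nums
  · exact fun y hy => h.pool y (removeBlock_subset _ _ _ hy)
  · intro t' ht'
    rcases eq_or_ne t' t with rfl | hne
    · rw [Function.update_self]
      exact (h.file t' ht').append fileAdr_inj (by rw [ho, Nat.mul_comm]) (by simp) hB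
    · rw [Function.update_of_ne hne]
      refine (h.file t' ht').congr fun i _ => Function.update_of_ne ?_ _ _
      rw [Ne, fileAdr_child_inj]; omega
  · intro t' ht' hpos
    rw [List.countP_eq_length_filter] at hpos
    simp only [hs'] at hpos
    rcases eq_or_ne t' t with rfl | hne
    · rw [filter_removeBlock_self, List.length_drop, ← hcl] at hpos
      have hcB : B ≤ cl.length := by
        rcases hpos with hpos | hpos
        · rw [h.node, if_pos hpos, List.countP_eq_length_filter] at hneed
          exact hneed
        · omega
      rw [Function.update_self, List.length_append, List.length_take, ho]
      rw [min_eq_left (by omega)]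
      exact ⟨o + 1, by ring⟩
    · rw [filter_removeBlock_of_disjoint _ _ (inCls_disjoint (by omega)),
        ← List.countP_eq_length_filter] at hpos
      rw [Function.update_of_ne hne]
      exact h.dvd t' ht' hpos
  · intro t' ht'
    simp only [hs']
    rcases eq_or_ne t' t with rfl | hne
    · rw [filter_removeBlock_self, Function.update_self, ← hcl, List.append_assoc,
        List.take_append_drop]
      exact h.perm t' ht'
    · rw [filter_removeBlock_of_disjoint _ _ (inCls_disjoint (by omega)),
        Function.update_of_ne hne]
      exact h.perm t' ht'
  · exact b

/-- Writing blocks as long as possible. -/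
theorem Distributed.flushAll {nd : Node} {piv zs : List α} (hB : 0 < B) (hnd : nd.Bdd N)
    (hsz : 0 < nd.sz) (hzs : zs.length ≤ N) (hF : piv.length ≤ N) {fl : ℕ → List α} {s : St α B}
    {d : ℕ → Fin B → Word α} (h : Distributed N M nd piv zs fl s d) :
    ∃ k s' d' fl', Goes N M q s d k s' d' ∧ Distributed N M nd piv zs fl' s' d' ∧ s'.i = s.i ∧
      (∀ t < piv.length, s'.pool.countP (inCls dle piv (t + 1)) <
        if s.i * B < nd.sz then B else 1) ∧
      (∀ a, (∀ t < piv.length, ∀ i, a ≠ fileAdr N (nd.child (t + 1) 0 0) i) → d' a = d a) ∧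
      k ≤ ∑ t ∈ Finset.range piv.length, (s.pool.countP (inCls dle piv (t + 1)) + B - 1) / B ∧
      (s.i * B < nd.sz → k * B + s'.pool.length = s.pool.length) := by
  induction hn : s.pool.length using Nat.strong_induction_on generalizing s d fl with
  | _ n ih =>
    cases hfind : (List.range s.piv.length).find? (fun t => decide
      ((if s.i * B < s.nd.sz then B else 1) ≤ s.pool.countP (inCls dle s.piv (t + 1)))) with
    | none =>
      rw [List.find?_eq_none] at hfind
      refine ⟨0, s, d, fl, .refl _ _, h, rfl, ?_, fun _ _ => rfl, Nat.zero_le _, fun _ => by omega⟩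
      intro t ht
      have := hfind t (by rw [List.mem_range, h.pivs]; exact ht)
      rw [decide_eq_true_eq, not_le, h.node, h.pivs] at this
      exact this
    | some t =>
      have htF := List.mem_of_find?_eq_some hfind
      rw [List.mem_range, h.pivs] at htF
      have hneed := List.find?_some hfind
      rw [decide_eq_true_eq, h.pivs, h.node] at hneed
      have hc : 0 < s.pool.countP (inCls dle piv (t + 1)) := by
        refine lt_of_lt_of_le ?_ hneed
        split_ifs <;> omega
      obtain ⟨s1, fl1, i1, g1, h1, p1, hi1⟩ := h.flush (q := q) hB hnd hsz hzs hF hfind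
      have hlr := length_removeBlock B (inCls dle piv (t + 1)) s.pool
      rw [← p1] at hlr
      obtain ⟨k2, s2, d2, fl2, g2, h2, i2, c2, f2, k2', e2⟩ := ih s1.pool.length (by omega) h1 rfl
      refine ⟨1 + k2, s2, d2, fl2, g1.trans g2, h2, i2.trans hi1, ?_, ?_, ?_, ?_⟩
      · rw [← hi1]; exact c2
      · intro a ha
        rw [f2 a ha, Function.update_of_ne (ha t htF i1)]
      · have hlt : ∑ t' ∈ Finset.range piv.length,
              (s1.pool.countP (inCls dle piv (t' + 1)) + B - 1) / B
            < ∑ t' ∈ Finset.range piv.length,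
              (s.pool.countP (inCls dle piv (t' + 1)) + B - 1) / B := by
          have key : ∀ t' < piv.length, s1.pool.countP (inCls dle piv (t' + 1)) =
              if t' = t then s.pool.countP (inCls dle piv (t' + 1)) - B
              else s.pool.countP (inCls dle piv (t' + 1)) := by
            intro t' _
            rw [p1, List.countP_eq_length_filter, List.countP_eq_length_filter]
            split_ifs with e
            · rw [e, filter_removeBlock_self, List.length_drop]
            · rw [filter_removeBlock_of_disjoint _ _ (inCls_disjoint (by omega))]
          apply Finset.sum_lt_sum
          · intro t' ht'
            rw [key t' (Finset.mem_range.1 ht')]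
            apply Nat.div_le_div_right
            split_ifs <;> omega
          · refine ⟨t, Finset.mem_range.2 htF, ?_⟩
            rw [key t htF, if_pos rfl]
            rw [Nat.lt_iff_add_one_le, Nat.le_div_iff_mul_le hB]
            have := Nat.div_mul_le_self (s.pool.countP (inCls dle piv (t + 1)) - B + B - 1) B
            rw [Nat.succ_mul]
            by_cases hcB : B ≤ s.pool.countP (inCls dle piv (t + 1))
            · omega
            · rw [Nat.div_eq_of_lt (by omega)]; omega
        omega
      · intro hi
        have := e2 (by rw [hi1]; exact hi)
        rw [if_pos hi] at hneed
        rw [Nat.add_mul]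
        omega

theorem exists_inCls {piv : List α} {y : α} (hF : 0 < piv.length) (h0 : piv[0] ≤ y) (hy : y ∉ piv) :
    ∃ t < piv.length, inCls dle piv (t + 1) y = true := by
  have h1 : 0 < piv.countP (fun p => decide (p < y)) := by
    rw [List.countP_pos_iff]
    refine ⟨piv[0], List.getElem_mem _, ?_⟩
    rw [decide_eq_true_eq]
    exact lt_of_le_of_ne h0 fun e => hy (e ▸ List.getElem_mem _)
  have h2 : piv.countP (fun p => decide (p < y)) ≤ piv.length := List.countP_le_length
  refine ⟨piv.countP (fun p => decide (p < y)) - 1, by omega, ?_⟩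
  rw [inCls_iff]
  exact ⟨hy, by omega⟩

/-- The distribution of a node to its children. -/
theorem Distributed.goes {nd : Node} {piv xs : List α} (hB : 0 < B) (hnd : nd.Bdd N)
    (hsz : nd.sz = xs.length) (hx : 0 < xs.length) (hp : PivGood M B xs piv)
    (hcap : (piv.length + 1) * B ≤ capac M B) {fl : ℕ → List α} {s : St α B}
    {d : ℕ → Fin B → Word α} (hfile : FileAt d (fileAdr N nd) xs)
    (h : Distributed N M nd piv (xs.take (s.i * B)) fl s d) (hi : s.i * B < xs.length + B) :
    ∃ (k : ℕ) (s' : St α B) (d' : ℕ → Fin B → Word α) (fl' : ℕ → List α),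
      Goes N M q s d k s' d' ∧ s'.pc = 9 ∧ s'.jl = 0 ∧ s'.u = 0 ∧ s'.nd = nd ∧
      s'.piv = piv ∧
      (s'.nums = (List.range (3 * piv.length)).map fun r => xs.countP (cntPred dle piv r)) ∧
      (∀ t < piv.length, FileAt d' (fileAdr N (nd.child (t + 1) 0 0)) (fl' t) ∧
        List.Perm (fl' t) (xs.filter (inCls dle piv (t + 1)))) ∧ Bd N M s' ∧
      (∀ a, (∀ t < piv.length, ∀ i, a ≠ fileAdr N (nd.child (t + 1) 0 0) i) → d' a = d a) ∧
      k * B ≤ s.pool.length + 3 * (xs.length - s.i * B) + piv.length * B +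
        (if s.i * B < xs.length then 3 * B else B) := by
  have hlev := hnd.lev_sz
  have hlo := hnd.lo_sz
  have hplo := hnd.plo
  have hch := hnd.ch
  have hxN : xs.length ≤ N := by omega
  have hFN : piv.length ≤ N := hp.len_le.trans hxN
  induction hn : xs.length - s.i * B using Nat.strong_induction_on generalizing s d fl with
  | _ n ih =>
    have htk : (xs.take (s.i * B)).length ≤ N := by rw [List.length_take]; omega
    obtain ⟨k1, s1, d1, fl1, g1, h1, i1, c1, f1, m1, e1⟩ :=
      h.flushAll (q := q) hB hnd (by omega) htk hFN
    have hctl := h1.bd.ctl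
    simp only [St.ctl, List.mem_cons, List.not_mem_nil, or_false, forall_eq_or_imp, forall_eq]
      at hctl
    have hnone : (List.range s1.piv.length).find? (fun t => decide
        ((if s1.i * B < s1.nd.sz then B else 1) ≤ s1.pool.countP (inCls dle s1.piv (t + 1))))
        = none := by
      rw [List.find?_eq_none]
      intro t ht
      rw [List.mem_range, h1.pivs] at ht
      rw [decide_eq_true_eq, not_le, h1.node, h1.pivs, i1]
      exact c1 t ht
    have hsum := sum_countP_inCls piv s1.pool piv.length h1.pool
    rw [← i1] at hi hn c1 e1 h ⊢
    by_cases hlt : s1.i * B < xs.length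
    · have hiN : s1.i < N := by
        have : s1.i ≤ s1.i * B := Nat.le_mul_of_pos_right _ hB
        omega
      have hpl : s1.pool.length ≤ piv.length * B := by
        rw [← hsum]
        refine (Finset.sum_le_card_nsmul _ _ B fun t ht => ?_).trans (by simp)
        have := c1 t (Finset.mem_range.1 ht)
        rw [if_pos (by omega)] at this
        omega
      have st2 : algStep N M B α dle q s1 = ({ s1 with pc := 8 }, .read (fileAdr N nd s1.i)) := by
        unfold algStep
        rw [h1.pc]
        show distStep N dle s1 = _
        unfold distStep
        simp only [hnone]
        rw [if_pos (by rw [h1.node]; omega), h1.node]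
      have b2 : Bd N M { s1 with pc := 8 } := by
        refine ⟨?_, h1.bd.nums, h1.bd.piv_len, h1.bd.pool_len, h1.bd.nums_len⟩
        simp only [St.ctl, List.mem_cons, List.not_mem_nil, or_false, forall_eq_or_imp, forall_eq]
        omega
      have g2 := goes_read (d := d1) st2
        (fileAdr_lt (by omega) (by omega) (by omega) (by omega)) b2 rfl
      have hfile1 : FileAt d1 (fileAdr N nd) xs := hfile.congr fun i hi => by
        apply f1
        intro t ht i'
        refine (fileAdr_child_ne ?_).symm
        have : i ≤ i * B := Nat.le_mul_of_pos_right _ hB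
        omega
      rw [hfile1 s1.i hlt] at g2
      set blk := (xs.drop (s1.i * B)).take B with hblk
      have hblkB : blk.length ≤ B := by simp [hblk]
      have hblkl : blk.length = min B (xs.length - s1.i * B) := by simp [hblk]
      have hzs : xs.take ((s1.i + 1) * B) = xs.take (s1.i * B) ++ blk := by
        rw [Nat.succ_mul, List.take_add]
      set s3 : St α B :=
        { s1 with
          pc := 7, i := s1.i + 1,
          pool := s1.pool ++ blk.filter (fun y => !piv.any (fun p => eqB dle y p)),
          nums := (List.range (3 * piv.length)).map fun r =>
            (xs.take ((s1.i + 1) * B)).countP (cntPred dle piv r),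
          buf := keyBlock B blk } with hs3
      have st3 : algStep N M B α dle q { s1 with pc := 8, buf := keyBlock B blk }
          = (s3, .read 0) := by
        show countStep dle { s1 with pc := 8, buf := keyBlock B blk } = _
        unfold countStep
        simp only [keysOf_keyBlock blk hblkB, h1.pivs, hs3, Prod.mk.injEq, St.mk.injEq, true_and,
          and_true]
        apply List.map_congr_left
        intro r hr
        rw [List.mem_range] at hr
        rw [h1.nums, List.getD_eq_getElem _ _ (by simpa using hr), List.getElem_map,
          List.getElem_range, ← i1, hzs, List.countP_append]
      have hfl : (blk.filter (fun y => !piv.any (fun p => eqB dle y p))).length ≤ blk.length :=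
        List.length_filter_le _ _
      have b3 : Bd N M s3 := by
        refine ⟨?_, ?_, h1.bd.piv_len, ?_, ?_⟩
        · simp only [hs3, St.ctl, List.mem_cons, List.not_mem_nil, or_false, forall_eq_or_imp,
            forall_eq]
          omega
        · intro k hk
          simp only [hs3, List.mem_map] at hk
          obtain ⟨r, _, rfl⟩ := hk
          refine List.countP_le_length.trans ?_
          rw [List.length_take]; omega
        · simp only [hs3, List.length_append]
          rw [Nat.succ_mul] at hcap
          omega
        · have := h1.bd.nums_len
          rw [h1.nums] at this
          simpa [hs3] using this
      have g3 := goes_read (d := d1) st3 zero_lt_wMax b3 rfl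
      have h3 : Distributed N M nd piv (xs.take ((s1.i + 1) * B)) fl1 { s3 with buf := d1 0 } d1 := by
        refine ⟨rfl, h1.node, h1.pivs, rfl, ?_, h1.file, ?_, ?_, b3.set_buf _⟩
        · intro y hy
          rcases List.mem_append.1 hy with hy | hy
          · exact h1.pool y hy
          · have hyx : y ∈ xs := List.mem_of_mem_drop (List.mem_of_mem_take (List.mem_of_mem_filter hy))
            refine exists_inCls hp.pos (hp.min y hyx) ?_
            have := List.of_mem_filter hy
            simp only [eqB_dle, Bool.not_eq_true', List.any_eq_false, decide_eq_true_eq] at this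
            exact fun h' => this y h' rfl
        · intro t ht _
          exact h1.dvd t ht (.inl (by omega))
        · intro t ht
          simp only [hs3]
          rw [hzs, List.filter_append, List.filter_append, ← List.append_assoc, List.filter_filter]
          refine List.Perm.append ?_ (List.Perm.of_eq ?_)
          · have := h1.perm t ht
            rw [← i1] at this
            exact this
          · congr 1
            funext y
            cases hy : inCls dle piv (t + 1) y with
            | false => rfl
            | true =>
              rw [inCls_iff] at hy
              simp only [eqB_dle, Bool.and_eq_true, Bool.not_eq_true',
                List.any_eq_false, decide_eq_true_eq, true_and]
              exact fun x hx e => hy.1 (e ▸ hx)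
      obtain ⟨k4, s4, d4, fl4, g4, a1, a2, a3, a4, a5, a6, a7, a8, a9, a10⟩ := ih
        (xs.length - (s1.i + 1) * B) (by rw [Nat.succ_mul]; omega) (s := { s3 with buf := d1 0 }) hfile1 h3
        (by show (s1.i + 1) * B < _; rw [Nat.succ_mul]; omega) rfl
      refine ⟨_, s4, d4, fl4, ((g1.trans g2).trans g3).trans g4, a1, a2, a3, a4, a5, a6, a7, a8,
        fun a ha => (a9 a ha).trans (f1 a ha), ?_⟩
      have e1' := e1 (by omega)
      simp only [hs3, List.length_append] at a10
      have e5 : (s1.i + 1) * B = s1.i * B + B := Nat.succ_mul _ _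
      rw [if_pos hlt, Nat.add_mul, Nat.add_mul, Nat.add_mul, Nat.one_mul]
      split_ifs at a10 <;> omega
    · set s2 : St α B := { s1 with pc := 9, jl := 0, u := 0 } with hs2
      have st2 : algStep N M B α dle q s1 = (s2, .read 0) := by
        unfold algStep
        rw [h1.pc]
        show distStep N dle s1 = _
        unfold distStep
        simp only [hnone]
        rw [if_neg (by rw [h1.node]; omega)]
      have b2 : Bd N M s2 := by
        refine ⟨?_, h1.bd.nums, h1.bd.piv_len, h1.bd.pool_len, h1.bd.nums_len⟩
        simp only [hs2, St.ctl, List.mem_cons, List.not_mem_nil, or_false, forall_eq_or_imp,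
          forall_eq]
        omega
      have g2 := goes_read (d := d1) st2 zero_lt_wMax b2 rfl
      have hall : xs.take (s.i * B) = xs := List.take_of_length_le (by rw [← i1]; omega)
      refine ⟨_, _, d1, fl1, g1.trans g2, rfl, rfl, rfl, h1.node, h1.pivs, ?_, ?_, b2.set_buf _,
        f1, ?_⟩
      · have := h1.nums
        rw [hall] at this
        exact this
      · intro t ht
        refine ⟨h1.file t ht, ?_⟩
        have := h1.perm t ht
        rw [hall] at this
        have h0 := c1 t ht
        rw [if_neg (by omega), List.countP_eq_length_filter, Nat.lt_one_iff,
          List.length_eq_zero_iff] at h0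
        rwa [h0, List.append_nil] at this
      · rw [if_neg hlt, Nat.add_mul]
        have hs0 := sum_countP_inCls piv s.pool piv.length h.pool
        have : k1 * B ≤ s.pool.length + piv.length * B := by
          calc k1 * B ≤ (∑ t ∈ Finset.range piv.length,
                (s.pool.countP (inCls dle piv (t + 1)) + B - 1) / B) * B :=
                Nat.mul_le_mul_right _ m1
            _ = ∑ t ∈ Finset.range piv.length,
                (s.pool.countP (inCls dle piv (t + 1)) + B - 1) / B * B := Finset.sum_mul _ _ _
            _ ≤ ∑ t ∈ Finset.range piv.length,
                (s.pool.countP (inCls dle piv (t + 1)) + B) := by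
                refine Finset.sum_le_sum fun t _ => (Nat.div_mul_le_self _ _).trans (by omega)
            _ = _ := by rw [Finset.sum_add_distrib, hs0]; simp
        omega

end Distribution

section Index

variable {α : Type u} {N M B : ℕ} {q : Word α}

/-- The index of a node is on the disk. -/
def IndexAt (N M : ℕ) (d : ℕ → Fin B → Word α) (nd : Node) (piv : List α) (nums : List ℕ) : Prop :=
  ∀ jl u, jl ≤ topLev N M B → u * fan B ^ (jl + 1) < piv.length →
    d (idxAdr N nd jl u) = idxBlock B piv nums jl u

theorem wordAt_idxBlock_key (hB : 16 ≤ B) (piv : List α) (nums : List ℕ) (jl u i : ℕ)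
    (hi : i < fan B) :
    wordAt (idxBlock B piv nums jl u) i = areaKey piv ((u * fan B + i) * fan B ^ jl) := by
  have hb : 4 * fan B ≤ B := by unfold fan; omega
  unfold wordAt idxBlock
  rw [dif_pos (by omega)]
  simp only [Nat.mod_eq_of_lt hi, if_pos hi]
  split_ifs with h
  · rfl
  · unfold areaKey
    rw [dif_neg h]

theorem wordAt_idxBlock_num (piv : List α) (nums : List ℕ) (jl u i r : ℕ)
    (hi : i < fan B) (hr : r < 3) (ht : (u * fan B + i) * fan B ^ jl < piv.length) :
    wordAt (idxBlock B piv nums jl u) ((r + 1) * fan B + i)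
      = .num (nums.getD (r * piv.length + (u * fan B + i) * fan B ^ jl) 0) := by
  have hb : 4 * fan B ≤ B := by unfold fan; omega
  have h1 : (r + 1) * fan B + i < 4 * fan B := by
    have : (r + 1) * fan B ≤ 3 * fan B := Nat.mul_le_mul_right _ (by omega)
    omega
  have h2 : ((r + 1) * fan B + i) % fan B = i := by
    rw [Nat.mul_comm, Nat.mul_add_mod, Nat.mod_eq_of_lt hi]
  have h3 : ((r + 1) * fan B + i) / fan B = r + 1 := by
    rw [Nat.mul_comm, Nat.mul_add_div (by omega), Nat.div_eq_of_lt hi, Nat.add_zero]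
  unfold wordAt idxBlock
  rw [dif_pos (by omega)]
  simp only [h2, h3, if_pos ht, if_pos h1]
  rw [if_neg]
  · rfl
  · rw [Nat.succ_mul]; omega

theorem idxBlock_num (piv : List α) (nums : List ℕ) (jl u : ℕ) (hn : ∀ k ∈ nums, k ≤ N)
    (j : Fin B) (k : ℕ) (h : idxBlock B piv nums jl u j = .num k) : k ≤ N := by
  unfold idxBlock at h
  have key : ∀ r, nums.getD r 0 ≤ N := by
    intro r
    by_cases hr : r < nums.length
    · rw [List.getD_eq_getElem _ _ hr]; exact hn _ (List.getElem_mem _)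
    · rw [List.getD_eq_default _ _ (by omega)]; omega
  simp only at h
  split_ifs at h with h1 h2
  · unfold areaKey at h
    rw [dif_pos h1] at h
    cases h
  all_goals
    rw [Word.num.injEq] at h
    subst h
    first | exact key _ | exact Nat.zero_le _

theorem topLev_le : topLev N M B ≤ N :=
  (Nat.log_le_self _ _).trans (min_le_right _ _)

theorem idxAdr_inj {nd : Node} {j u j' u' : ℕ} :
    idxAdr N nd j u = idxAdr N nd j' u' ↔ j = j' ∧ u = u' := by
  simp [idxAdr, adr_inj]

variable [LinearOrder α]

/-- Writing one level of the index. -/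
theorem goes_index_level (hB : 16 ≤ B) (s : St α B) (d : ℕ → Fin B → Word α) (hpc : s.pc = 9)
    (hnd : s.nd.Bdd N) (hF : s.piv.length ≤ N) (hjl : s.jl ≤ topLev N M B) (hbd : Bd N M s)
    (hd : ∀ u < s.u, u * fan B ^ (s.jl + 1) < s.piv.length →
      d (idxAdr N s.nd s.jl u) = idxBlock B s.piv s.nums s.jl u) :
    ∃ t bf d', Goes N M q s d t { s with u := s.u + t, buf := bf } d' ∧
      (∀ u, u * fan B ^ (s.jl + 1) < s.piv.length →
        d' (idxAdr N s.nd s.jl u) = idxBlock B s.piv s.nums s.jl u) ∧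
      (∀ a, (∀ u, a ≠ idxAdr N s.nd s.jl u) → d' a = d a) ∧
      ¬ (s.u + t) * fan B ^ (s.jl + 1) < s.piv.length ∧
      (t = 0 ∨ (s.u + t) * fan B ^ (s.jl + 1) < s.piv.length + fan B ^ (s.jl + 1)) ∧
      Bd N M { s with u := s.u + t, buf := bf } := by
  have hp : 0 < fan B ^ (s.jl + 1) := Nat.pow_pos (by unfold fan; omega)
  induction hn : s.piv.length - s.u * fan B ^ (s.jl + 1) using Nat.strong_induction_on
    generalizing s d with
  | _ n ih =>
    by_cases hu : s.u * fan B ^ (s.jl + 1) < s.piv.length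
    · have hctl := hbd.ctl
      simp only [St.ctl, List.mem_cons, List.not_mem_nil, or_false, forall_eq_or_imp, forall_eq]
        at hctl
      have huN : s.u < N := by
        have : s.u ≤ s.u * fan B ^ (s.jl + 1) := Nat.le_mul_of_pos_right _ hp
        omega
      set s1 : St α B :=
        { s with u := s.u + 1, buf := idxBlock B s.piv s.nums s.jl s.u } with hs1
      have st : algStep N M B α dle q s = (s1, .write (idxAdr N s.nd s.jl s.u)) := by
        unfold algStep
        rw [hpc]
        show indexStep N M s = _
        unfold indexStep
        rw [if_pos hjl, if_pos hu]
      have b1 : Bd N M s1 := by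
        refine ⟨?_, hbd.nums, hbd.piv_len, hbd.pool_len, hbd.nums_len⟩
        simp only [hs1, St.ctl, List.mem_cons, List.not_mem_nil, or_false, forall_eq_or_imp,
          forall_eq]
        omega
      have h1 := hnd.lev_sz
      have h2 := hnd.plo
      have h3 := hnd.ch
      have htl := topLev_le (N := N) (M := M) (B := B)
      have g1 := goes_write (d := d) st
        (adr_lt (by omega) (by omega) (by omega) (by omega) (by omega) (by omega)) b1
        (fun j k hk => idxBlock_num _ _ _ _ hbd.nums j k hk)
      have hmul : (s.u + 1) * fan B ^ (s.jl + 1)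
          = s.u * fan B ^ (s.jl + 1) + fan B ^ (s.jl + 1) := Nat.succ_mul _ _
      obtain ⟨t, bf, d', g2, a1, a2, a3, a4, a5⟩ := ih
        (s.piv.length - (s.u + 1) * fan B ^ (s.jl + 1)) (by omega) s1
        (Function.update d (idxAdr N s.nd s.jl s.u) s1.buf) hpc hnd hF hjl b1
        (by
          intro u hu' hlt
          simp only [hs1] at hu' hlt ⊢
          rcases Nat.lt_or_ge u s.u with h | h
          · rw [Function.update_of_ne (by rw [Ne, idxAdr_inj]; omega)]
            exact hd u h hlt
          · have : u = s.u := by omega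
            rw [this, Function.update_self]) hp rfl
      simp only [hs1] at g2 a1 a2 a3 a4 a5
      have hadd : s.u + 1 + t = s.u + (1 + t) := by omega
      rw [hadd] at g2 a3 a4 a5
      refine ⟨1 + t, bf, d', g1.trans g2, a1, ?_, a3, .inr ?_, a5⟩
      · intro a ha
        rw [a2 a ha, Function.update_of_ne (ha s.u)]
      · rcases a4 with rfl | a4
        · rw [Nat.add_zero, hmul]; omega
        · exact a4
    · refine ⟨0, s.buf, d, .refl _ _, ?_, fun _ _ => rfl, hu, .inl rfl, hbd⟩
      intro u hu'
      refine hd u ?_ hu'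
      by_contra hge
      exact hu (lt_of_le_of_lt (Nat.mul_le_mul_right _ (by omega)) hu')

/-- Writing the index. -/
theorem goes_index (hB : 16 ≤ B) (s : St α B) (d : ℕ → Fin B → Word α) (hpc : s.pc = 9)
    (hnd : s.nd.Bdd N) (hF : s.piv.length ≤ N) (hu : s.u = 0) (hjl : s.jl ≤ topLev N M B + 1)
    (hbd : Bd N M s)
    (hd : ∀ jl u, jl < s.jl → u * fan B ^ (jl + 1) < s.piv.length →
      d (idxAdr N s.nd jl u) = idxBlock B s.piv s.nums jl u) :
    ∃ t bf d', Goes N M q s d t { s with jl := topLev N M B + 1, buf := bf } d' ∧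
      IndexAt N M d' s.nd s.piv s.nums ∧
      (∀ a, (∀ jl u, a ≠ idxAdr N s.nd jl u) → d' a = d a) ∧
      t ≤ s.piv.length / fan B ^ s.jl + 2 * (topLev N M B + 1 - s.jl) ∧
      Bd N M { s with jl := topLev N M B + 1, buf := bf } := by
  induction hn : topLev N M B + 1 - s.jl generalizing s d with
  | zero =>
    have he : topLev N M B + 1 = s.jl := by omega
    refine ⟨0, s.buf, d, ?_, ?_, fun _ _ => rfl, Nat.zero_le _, ?_⟩
    · rw [he]; exact .refl _ _
    · intro jl u h1 h2
      exact hd jl u (by omega) h2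
    · rw [he]; exact hbd
  | succ n ih =>
    obtain ⟨t1, bf1, d1, g1, a1, a2, a3, a4, b1⟩ := goes_index_level (q := q) hB s d hpc hnd hF
      (by omega) hbd (by intro u h; omega)
    rw [hu, Nat.zero_add] at g1 a3 a4 b1
    have hctl := b1.ctl
    simp only [St.ctl, List.mem_cons, List.not_mem_nil, or_false, forall_eq_or_imp, forall_eq]
      at hctl
    set s2 : St α B := { s with jl := s.jl + 1, buf := bf1 } with hs2
    have htl := topLev_le (N := N) (M := M) (B := B)
    have st : algStep N M B α dle q { s with u := t1, buf := bf1 } = (s2, .read 0) := by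
      unfold algStep
      simp only [hpc]
      unfold indexStep
      rw [if_pos (by simp only; omega), if_neg (by simpa using a3)]
      simp only [hs2, hu, hpc]
    have b2 : Bd N M s2 := by
      refine ⟨?_, hbd.nums, hbd.piv_len, hbd.pool_len, hbd.nums_len⟩
      simp only [hs2, St.ctl, List.mem_cons, List.not_mem_nil, or_false, forall_eq_or_imp,
        forall_eq]
      omega
    have g2 := goes_read (d := d1) st zero_lt_wMax b2 rfl
    obtain ⟨t3, bf3, d3, g3, c1, c2, c3, b3⟩ := ih { s2 with buf := d1 0 } d1 hpc hnd hF hu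
      (by simp only [hs2]; omega) (b2.set_buf _)
      (by
        intro jl u h1 h2
        simp only [hs2] at h1 h2 ⊢
        rcases Nat.lt_or_ge jl s.jl with h | h
        · rw [a2 _ (by intro u'; rw [Ne, idxAdr_inj]; omega)]
          exact hd jl u h h2
        · have : jl = s.jl := by omega
          subst this
          exact a1 u h2) (by simp only [hs2]; omega)
    refine ⟨t1 + 1 + t3, bf3, d3, (g1.trans g2).trans g3, c1, ?_, ?_, b3⟩
    · intro a ha
      rw [c2 a ha, a2 a (fun u => ha _ u)]
    · simp only [hs2] at c3
      have hb : 2 ≤ fan B := by unfold fan; omega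
      have hp : 0 < fan B ^ (s.jl + 1) := Nat.pow_pos (by omega)
      have h1 : t1 ≤ s.piv.length / fan B ^ (s.jl + 1) + 1 := by
        rcases a4 with a4 | a4
        · rw [a4]; exact Nat.zero_le _
        · by_contra h
          have h' : s.piv.length / fan B ^ (s.jl + 1) + 2 ≤ t1 := by omega
          have h5 := Nat.mul_le_mul_right (fan B ^ (s.jl + 1)) h'
          have h6 := Nat.lt_div_mul_add hp (a := s.piv.length)
          rw [Nat.add_mul] at h5
          omega
      have h2 : 2 * (s.piv.length / fan B ^ (s.jl + 1)) ≤ s.piv.length / fan B ^ s.jl := by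
        rw [pow_succ, ← Nat.div_div_eq_div_mul]
        have h7 := Nat.div_mul_le_self (s.piv.length / fan B ^ s.jl) (fan B)
        have h8 := Nat.mul_le_mul_left (s.piv.length / fan B ^ s.jl / fan B) hb
        rw [Nat.mul_comm 2]
        exact h8.trans h7
      generalize s.piv.length / fan B ^ (s.jl + 1) = x1 at *
      generalize s.piv.length / fan B ^ s.jl = x2 at *
      omega

theorem countP_range_lt (b k : ℕ) (h : k ≤ b) :
    (List.range b).countP (fun i => decide (i < k)) = k := by
  induction b with
  | zero => simp; omega
  | succ b ih =>
    rw [List.range_succ, List.countP_append]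
    rcases Nat.lt_or_ge b k with h' | h'
    · have hk : k = b + 1 := by omega
      have : (List.range b).countP (fun i => decide (i < k)) = b := by
        rw [List.countP_eq_length.2 (by simp; omega), List.length_range]
      rw [this]
      simp [hk]
    · rw [ih h']
      simp; omega

/-- The entries of an index that do not exceed the query are the first `T` ones. -/
def Below (q : Word α) (lo : ℕ) (piv : List α) (nums : List ℕ) (T : ℕ) : Prop :=
  T ≤ piv.length ∧
    ∀ t < piv.length, entryLe dle q lo (areaKey piv t) (nums.getD t 0) = decide (t < T)

theorem Below.count (hB : 16 ≤ B) {lo T : ℕ} {piv : List α} {nums : List ℕ}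
    (h : Below q lo piv nums T) (jl u : ℕ) :
    ((List.range (fan B)).countP fun i => entryLe dle q lo (wordAt (idxBlock B piv nums jl u) i)
      (wordAt (idxBlock B piv nums jl u) (fan B + i)).toNat)
    = (List.range (fan B)).countP fun i => decide ((u * fan B + i) * fan B ^ jl < T) := by
  refine List.countP_congr fun i hi => ?_
  rw [List.mem_range] at hi
  rw [wordAt_idxBlock_key hB _ _ _ _ _ hi]
  by_cases ht : (u * fan B + i) * fan B ^ jl < piv.length
  · have := wordAt_idxBlock_num piv nums jl u i 0 hi (by omega) ht
    rw [Nat.zero_add, Nat.one_mul, Nat.zero_mul, Nat.zero_add] at this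
    rw [this, Word.toNat, h.2 _ ht]
  · have : areaKey piv ((u * fan B + i) * fan B ^ jl) = .num 0 := by
      unfold areaKey; rw [dif_neg ht]
    rw [this]
    have hT := h.1
    cases q <;> simp [entryLe] <;> omega

theorem Below.count_pos (hB : 16 ≤ B) {lo T : ℕ} {piv : List α} {nums : List ℕ}
    (h : Below q lo piv nums T) (hT : 0 < T) (jl : ℕ) :
    ((List.range (fan B)).countP fun i => entryLe dle q lo
      (wordAt (idxBlock B piv nums jl ((T - 1) / fan B ^ (jl + 1))) i)
      (wordAt (idxBlock B piv nums jl ((T - 1) / fan B ^ (jl + 1))) (fan B + i)).toNat)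
    = (T - 1) / fan B ^ jl % fan B + 1 := by
  have hb : 0 < fan B := by unfold fan; omega
  have hp : 0 < fan B ^ jl := Nat.pow_pos hb
  rw [h.count hB, ← countP_range_lt (fan B) ((T - 1) / fan B ^ jl % fan B + 1)
    (Nat.mod_lt _ hb)]
  refine List.countP_congr fun i hi => ?_
  rw [decide_eq_true_eq, decide_eq_true_eq, pow_succ, ← Nat.div_div_eq_div_mul]
  have h1 := Nat.div_add_mod' ((T - 1) / fan B ^ jl) (fan B)
  have h2 : ((T - 1) / fan B ^ jl / fan B * fan B + i) * fan B ^ jl < T ↔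
      (T - 1) / fan B ^ jl / fan B * fan B + i ≤ (T - 1) / fan B ^ jl := by
    rw [Nat.le_div_iff_mul_le hp]; omega
  rw [h2]
  omega

/-- The answer to a query that is answered by an entry of an index. -/
def hitAnswer (q k : Word α) (n : ℕ) : Word α :=
  match q with
  | .num _ => k
  | .key _ => .num (n + 1)

/-- The search in the index of a node. -/
theorem goes_search (hg : Good N M B) {d : ℕ → Fin B → Word α} {piv : List α} {nums : List ℕ}
    {T : ℕ} (hT : 0 < T) (hF : piv.length ≤ N) (s : St α B) (hpc : s.pc = 3)
    (hnd : s.nd.Bdd N) (hidx : IndexAt N M d s.nd piv nums) (hbelow : Below q s.nd.lo piv nums T)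
    (hjl : s.jl ≤ topLev N M B) (hu : s.u = (T - 1) / fan B ^ (s.jl + 1))
    (hbuf : s.buf = idxBlock B piv nums s.jl s.u) (hbd : Bd N M s) :
    ∃ s', Goes N M q s d s.jl s' d ∧ s'.nd = s.nd ∧ Bd N M s' ∧
      algStep N M B α dle q s' =
        if entryHit dle q s.nd.lo (areaKey piv (T - 1)) (nums.getD (T - 1) 0)
          (nums.getD (piv.length + (T - 1)) 0) then
          ({ s' with pc := 0 }, .answer (hitAnswer q (areaKey piv (T - 1))
            (s.nd.lo + nums.getD (T - 1) 0)))
        else enterNode N M { s' with nd := (s.nd.child T (nums.getD (piv.length + (T - 1)) 0)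
          (nums.getD (2 * piv.length + (T - 1)) 0)) } := by
  have hB := hg.1
  have hb : 0 < fan B := by unfold fan; omega
  have hTF := hbelow.1
  have hstep : ∀ s : St α B, s.pc = 3 → s.buf = idxBlock B piv nums s.jl s.u →
      s.u = (T - 1) / fan B ^ (s.jl + 1) → algStep N M B α dle q s = searchStep N M dle q s ∧
      ¬ (wordAt s.buf 0).key?.isNone = true := by
    intro s hpc hbuf hu
    constructor
    · unfold algStep
      rw [hpc]
      rfl
    · rw [hbuf, wordAt_idxBlock_key hB _ _ _ _ _ hb, Nat.add_zero, areaKey_key?,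
        List.getElem?_eq_getElem]
      · simp
      · rw [Nat.mul_assoc, ← pow_succ', hu]
        have := Nat.div_mul_le_self (T - 1) (fan B ^ (s.jl + 1))
        omega
  induction hn : s.jl generalizing s with
  | zero =>
    refine ⟨s, .refl _ _, rfl, hbd, ?_⟩
    obtain ⟨e1, e2⟩ := hstep s hpc hbuf hu
    have hc := hbelow.count_pos hB hT 0
    rw [hn] at hu hbuf
    rw [← hu, ← hbuf, pow_zero, Nat.div_one] at hc
    have hdm := Nat.div_add_mod' (T - 1) (fan B)
    rw [zero_add, pow_one] at hu
    have hi : (T - 1) % fan B < fan B := Nat.mod_lt _ hb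
    have ht : (s.u * fan B + (T - 1) % fan B) * fan B ^ 0 = T - 1 := by
      rw [pow_zero, Nat.mul_one, hu]; exact hdm
    have w0 := wordAt_idxBlock_key hB piv nums 0 s.u _ hi
    have wr := fun r hr => wordAt_idxBlock_num piv nums 0 s.u _ r hi hr (by rw [ht]; omega)
    rw [ht, ← hbuf] at w0
    simp only [ht, ← hbuf] at wr
    have w1 := wr 0 (by omega)
    have w2 := wr 1 (by omega)
    have w3 := wr 2 (by omega)
    rw [Nat.zero_add, Nat.one_mul, Nat.zero_mul, Nat.zero_add] at w1
    rw [Nat.one_mul] at w2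
    have hT' : s.u * fan B + ((T - 1) % fan B + 1) = T := by rw [hu]; omega
    rw [e1]
    unfold searchStep
    rw [if_neg e2]
    simp only [hc]
    rw [if_neg (by omega), if_neg (by simp [hn])]
    simp only [Nat.add_sub_cancel, w0, w1, w2, w3, Word.toNat, hT', Node.child]
    rfl
  | succ j ih =>
    obtain ⟨e1, e2⟩ := hstep s hpc hbuf hu
    have hc := hbelow.count_pos hB hT s.jl
    rw [← hu, ← hbuf] at hc
    have hctl := hbd.ctl
    simp only [St.ctl, List.mem_cons, List.not_mem_nil, or_false, forall_eq_or_imp, forall_eq]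
      at hctl
    have hu' : s.u * fan B + ((T - 1) / fan B ^ s.jl % fan B + 1) - 1
        = (T - 1) / fan B ^ s.jl := by
      rw [hu, pow_succ, ← Nat.div_div_eq_div_mul]
      have := Nat.div_add_mod' ((T - 1) / fan B ^ s.jl) (fan B)
      omega
    have hle : (T - 1) / fan B ^ s.jl ≤ T - 1 := Nat.div_le_self _ _
    set s1 : St α B :=
      { s with jl := j, u := (T - 1) / fan B ^ s.jl } with hs1
    have st : algStep N M B α dle q s
        = (s1, .read (idxAdr N s.nd j ((T - 1) / fan B ^ s.jl))) := by
      rw [e1]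
      unfold searchStep
      rw [if_neg e2]
      simp only [hc, hu']
      rw [if_neg (by omega), if_pos (by omega)]
      simp only [hs1, hn, Nat.add_sub_cancel]
    have b1 : Bd N M s1 := by
      refine ⟨?_, hbd.nums, hbd.piv_len, hbd.pool_len, hbd.nums_len⟩
      simp only [hs1, St.ctl, List.mem_cons, List.not_mem_nil, or_false, forall_eq_or_imp,
        forall_eq]
      omega
    have h1 := hnd.lev_sz
    have h2 := hnd.plo
    have h3 := hnd.ch
    have htl := topLev_le (N := N) (M := M) (B := B)
    have g1 := goes_read (d := d) st
      (adr_lt (by omega) (by omega) (by omega) (by omega) (by omega) (by omega)) b1 rfl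
    have hblk : d (idxAdr N s.nd j ((T - 1) / fan B ^ s.jl))
        = idxBlock B piv nums j ((T - 1) / fan B ^ s.jl) := by
      refine hidx j _ (by omega) ?_
      rw [← hn]
      have := Nat.div_mul_le_self (T - 1) (fan B ^ s.jl)
      omega
    rw [hblk] at g1
    obtain ⟨s', g2, a1, a2, a3⟩ := ih
      { s1 with buf := idxBlock B piv nums j ((T - 1) / fan B ^ s.jl) } hpc hnd hidx hbelow
      (by simp only [hs1]; omega) (by simp only [hs1, hn]) rfl (b1.set_buf _) rfl
    refine ⟨s', ?_, a1, a2, a3⟩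
    rw [Nat.add_comm j 1]
    exact g1.trans g2

end Index

/-! ### Queries on a part of the array -/

section Spec

variable {α : Type u} [LinearOrder α] {N M B : ℕ}

/-- The position of a query on the list `xs` whose elements have ranks from `lo + 1` on. -/
def qpos (q : Word α) (lo : ℕ) (xs : List α) : ℕ :=
  match q with
  | .num n => n
  | .key p => lo + xs.countP (fun x => decide (x < p)) + if p ∈ xs then 1 else 0

/-- The query asks for a rank that occurs in the list. -/
def QValid (q : Word α) (lo : ℕ) (xs : List α) : Prop :=
  match q with
  | .num n => lo < n ∧ n ≤ lo + xs.length
  | .key _ => True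

/-- The answer to a query on the list `xs` whose elements have ranks from `lo + 1` on. -/
def IsAnswer (q : Word α) (lo : ℕ) (xs : List α) (w : Word α) : Prop :=
  match q with
  | .num n => ∃ x ∈ xs, w = .key x ∧ lo + xs.countP (fun y => decide (y < x)) < n ∧
      n ≤ lo + xs.countP (fun y => decide (y ≤ x))
  | .key p => w = .num (qpos (.key p) lo xs)

/-- Whether a pivot does not exceed the query. -/
def qLe (q : Word α) (lo : ℕ) (xs : List α) (x : α) : Bool :=
  match q with
  | .num n => decide (lo + xs.countP (fun y => decide (y < x)) < n)
  | .key p => decide (x ≤ p)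

/-- The counts that are stored in the index of a node. -/
def numsOf (piv xs : List α) : List ℕ :=
  (List.range (3 * piv.length)).map fun r => xs.countP (cntPred dle piv r)

theorem getD_numsOf_lt (piv xs : List α) {t : ℕ} (ht : t < piv.length) :
    (numsOf piv xs).getD t 0 = xs.countP (fun y => decide (y < piv[t])) := by
  unfold numsOf
  rw [List.getD_eq_getElem _ _ (by simp; omega), List.getElem_map, List.getElem_range]
  congr 1
  funext y
  simp [cntPred, ht]

theorem getD_numsOf_le (piv xs : List α) {t : ℕ} (ht : t < piv.length) :
    (numsOf piv xs).getD (piv.length + t) 0 = xs.countP (fun y => decide (y ≤ piv[t])) := by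
  unfold numsOf
  rw [List.getD_eq_getElem _ _ (by simp; omega), List.getElem_map, List.getElem_range]
  congr 1
  funext y
  unfold cntPred
  rw [if_neg (by omega), if_pos (by omega)]
  simp [ht]

theorem getD_numsOf_cls (piv xs : List α) {t : ℕ} (ht : t < piv.length) :
    (numsOf piv xs).getD (2 * piv.length + t) 0
      = (xs.filter (inCls dle piv (t + 1))).length := by
  unfold numsOf
  rw [List.getD_eq_getElem _ _ (by simp; omega), List.getElem_map, List.getElem_range,
    cntPred_cls, List.countP_eq_length_filter]

theorem countP_lt_mono (xs : List α) {x y : α} (h : x ≤ y) :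
    xs.countP (fun z => decide (z < x)) ≤ xs.countP (fun z => decide (z < y)) := by
  refine List.countP_mono_left fun z _ hz => ?_
  rw [decide_eq_true_eq] at *
  exact lt_of_lt_of_le hz h

theorem down_qLe (q : Word α) (lo : ℕ) (xs : List α) : Down (qLe q lo xs) := by
  intro x y h hy
  cases q with
  | key p => exact down_le p h hy
  | num n =>
    simp only [qLe, decide_eq_true_eq] at *
    have := countP_lt_mono xs h
    omega

theorem areaKey_eq {β : Type v} (xs : List β) {t : ℕ} (ht : t < xs.length) : areaKey xs t = .key xs[t] := by
  unfold areaKey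
  rw [dif_pos ht]

theorem below_numsOf {piv : List α} (hs : piv.Pairwise (· ≤ ·)) (q : Word α) (lo : ℕ)
    (xs : List α) : Below q lo piv (numsOf piv xs) (piv.countP (qLe q lo xs)) := by
  refine ⟨List.countP_le_length, fun t ht => ?_⟩
  have key : entryLe dle q lo (areaKey piv t) ((numsOf piv xs).getD t 0) = qLe q lo xs piv[t] := by
    rw [areaKey_eq _ ht, getD_numsOf_lt _ _ ht]
    cases q <;> rfl
  rw [key, Bool.eq_iff_iff, decide_eq_true_eq, lt_countP_iff hs (down_qLe q lo xs) t ht]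

theorem countP_add_le {β : Type v} {p p' r : β → Bool} (xs : List β)
    (h1 : ∀ x ∈ xs, p x = true → p' x = true → False)
    (h2 : ∀ x ∈ xs, p x = true ∨ p' x = true → r x = true) :
    xs.countP p + xs.countP p' ≤ xs.countP r := by
  induction xs with
  | nil => simp
  | cons x xs ih =>
    have := ih (fun y hy => h1 y (List.mem_cons_of_mem _ hy))
      (fun y hy => h2 y (List.mem_cons_of_mem _ hy))
    have a := h1 x List.mem_cons_self
    have b := h2 x List.mem_cons_self
    simp only [List.countP_cons]
    cases hp : p x <;> cases hp' : p' x <;> cases hr : r x <;> simp_all <;> omega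

/-- The elements of class `t + 1` lie between pivot `t` and pivot `t + 1`. -/
theorem inCls_between {piv : List α} (hs : piv.Pairwise (· ≤ ·)) {t : ℕ} {y : α}
    (hy : inCls dle piv (t + 1) y = true) :
    (∀ (h : t < piv.length), piv[t] < y) ∧
      ∀ s (h : s < piv.length), t < s → y < piv[s] := by
  rw [inCls_iff] at hy
  constructor
  · intro h
    have := (lt_countP_iff hs (down_lt y) t h).1 (by omega)
    simpa using this
  · intro s h hts
    have h1 : ¬ piv[s] < y := by
      intro h'
      have := (lt_countP_iff hs (down_lt y) s h).2 (by simpa using h')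
      omega
    exact lt_of_le_of_ne (not_lt.1 h1) fun e => hy.1 (e ▸ List.getElem_mem _)

/-- A query that is not answered by the last pivot below it is answered by the next class. -/
theorem descend {q : Word α} {lo : ℕ} {xs piv ys : List α} (hs : piv.Pairwise (· ≤ ·))
    (hq : QValid q lo xs) {t : ℕ} (ht : t < piv.length)
    (h1 : qLe q lo xs piv[t] = true)
    (h2 : ∀ s (h : s < piv.length), t < s → ¬ qLe q lo xs piv[s] = true)
    (hh : entryHit dle q lo (.key piv[t]) (xs.countP (fun y => decide (y < piv[t])))
      (xs.countP (fun y => decide (y ≤ piv[t]))) = false)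
    (hy : List.Perm ys (xs.filter (inCls dle piv (t + 1)))) :
    QValid q (lo + xs.countP (fun y => decide (y ≤ piv[t]))) ys ∧
    qpos q (lo + xs.countP (fun y => decide (y ≤ piv[t]))) ys = qpos q lo xs ∧
    ∀ w, IsAnswer q (lo + xs.countP (fun y => decide (y ≤ piv[t]))) ys w →
      IsAnswer q lo xs w := by
  have hcnt : ∀ p : α → Bool, ys.countP p = (xs.filter (inCls dle piv (t + 1))).countP p :=
    fun p => hy.countP_eq p
  cases q with
  | key p =>
    simp only [qLe, decide_eq_true_eq] at h1 h2
    simp only [entryHit, dle, decide_eq_false_iff_not, not_le] at hh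
    have hlt : ∀ s (h : s < piv.length), t < s → p < piv[s] := fun s h hts => not_le.1 (h2 s h hts)
    have e1 := countP_split hs ht xs (down_lt p) (by simpa using hh)
      (fun s h hts => by simpa using (hlt s h hts).le)
    have hcls : inCls dle piv (t + 1) p = true := by
      rw [inCls_iff]
      constructor
      · intro hp
        obtain ⟨s, h, rfl⟩ := List.getElem_of_mem hp
        rcases Nat.lt_or_ge t s with h' | h'
        · exact lt_irrefl _ (hlt s h h')
        · rcases h'.lt_or_eq with h' | rfl
          · exact absurd hh (not_lt.2 (List.pairwise_iff_getElem.1 hs _ _ _ _ h'))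
          · exact lt_irrefl _ hh
      · apply le_antisymm
        · by_contra hc
          have hc' : t + 1 < piv.countP (fun y => decide (y < p)) := by omega
          have hl : piv.countP (fun y => decide (y < p)) ≤ piv.length := List.countP_le_length
          have := (lt_countP_iff hs (down_lt p) (t + 1) (by omega)).1 hc'
          rw [decide_eq_true_eq] at this
          exact lt_asymm this (hlt _ (by omega) (by omega))
        · exact (lt_countP_iff hs (down_lt p) t ht).2 (by simpa using hh)
    have e2 : p ∈ ys ↔ p ∈ xs := by
      rw [hy.mem_iff, List.mem_filter]
      tauto
    have e3 : qpos (.key p) (lo + xs.countP (fun y => decide (y ≤ piv[t]))) ys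
        = qpos (.key p) lo xs := by
      simp only [qpos, e2]
      rw [hcnt, e1]
      omega
    refine ⟨trivial, e3, fun w hw => ?_⟩
    simp only [IsAnswer] at hw ⊢
    rw [hw, e3]
  | num n =>
    simp only [qLe, decide_eq_true_eq] at h1 h2
    simp only [entryHit, decide_eq_false_iff_not, not_le] at hh
    have hv : n ≤ lo + xs.countP (fun y => decide (y ≤ piv[t])) + ys.length := by
      by_cases hF : t + 1 < piv.length
      · have h3 := h2 (t + 1) hF (by omega)
        have h0 : piv[t] ≤ piv[t + 1] := List.pairwise_iff_getElem.1 hs _ _ _ _ (by omega)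
        have hne : piv[t] ≠ piv[t + 1] := by
          intro e
          rw [← e] at h3
          exact h3 h1
        have e1 := countP_split hs ht xs (down_lt piv[t + 1])
          (by simpa using lt_of_le_of_ne h0 hne) (by
            intro s h hts
            have : piv[t + 1] ≤ piv[s] := by
              rcases (show t + 1 ≤ s from hts).lt_or_eq with h' | rfl
              · exact List.pairwise_iff_getElem.1 hs _ _ _ _ h'
              · exact le_rfl
            simpa using this)
        have : (xs.filter (inCls dle piv (t + 1))).countP (fun y => decide (y < piv[t + 1]))
            ≤ ys.length := by
          rw [hy.length_eq]; exact List.countP_le_length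
        omega
      · have e1 := countP_split hs ht xs (down_true (α := α)) rfl (by intro s h hts; omega)
        rw [List.countP_true, ← hy.length_eq] at e1
        have := hq.2
        omega
    refine ⟨⟨hh, hv⟩, rfl, fun w hw => ?_⟩
    obtain ⟨x, hx, hwx, a1, a2⟩ := hw
    rw [hy.mem_iff, List.mem_filter] at hx
    obtain ⟨b1, b2⟩ := inCls_between hs hx.2
    have e1 := countP_split hs ht xs (down_lt x) (by simpa using b1 ht)
      (fun s h hts => by simpa using (b2 s h hts).le)
    have e2 := countP_split hs ht xs (down_le x) (by simpa using (b1 ht).le)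
      (fun s h hts => by simpa using b2 s h hts)
    refine ⟨x, hx.1, hwx, ?_, ?_⟩
    · rw [hcnt] at a1; omega
    · rw [hcnt] at a2; omega

/-- The answer from the index. -/
theorem isAnswer_hit {q : Word α} {lo : ℕ} {xs piv : List α} (hsub : piv ⊆ xs)
    {t : ℕ} (ht : t < piv.length) (h1 : qLe q lo xs piv[t] = true)
    (hh : entryHit dle q lo (.key piv[t]) (xs.countP (fun y => decide (y < piv[t])))
      (xs.countP (fun y => decide (y ≤ piv[t]))) = true) :
    IsAnswer q lo xs (hitAnswer q (.key piv[t])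
      (lo + xs.countP (fun y => decide (y < piv[t])))) := by
  have hmem : piv[t] ∈ xs := hsub (List.getElem_mem _)
  cases q with
  | key p =>
    simp only [qLe, decide_eq_true_eq] at h1
    simp only [entryHit, dle, decide_eq_true_eq] at hh
    have : piv[t] = p := le_antisymm h1 hh
    simp only [IsAnswer, hitAnswer, qpos]
    rw [this] at hmem ⊢
    rw [if_pos hmem]
  | num n =>
    simp only [qLe, decide_eq_true_eq] at h1
    simp only [entryHit, decide_eq_true_eq] at hh
    exact ⟨piv[t], hmem, rfl, h1, hh⟩

/-- The answer if no pivot is below the query. -/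
theorem isAnswer_none {q : Word α} {lo : ℕ} {xs piv : List α} (hq : QValid q lo xs)
    (hF : 0 < piv.length) (hmin : ∀ y ∈ xs, piv[0] ≤ y) (h : ¬ qLe q lo xs piv[0] = true) :
    IsAnswer q lo xs (.num lo) := by
  cases q with
  | key p =>
    simp only [qLe, decide_eq_true_eq, not_le] at h
    simp only [IsAnswer, qpos]
    rw [List.countP_eq_zero.2, if_neg]
    · rfl
    · intro hp
      exact absurd h (not_lt.2 (hmin p hp))
    · intro y hy
      simpa using h.le.trans (hmin y hy)
  | num n =>
    simp only [qLe, decide_eq_true_eq, not_lt] at h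
    rw [List.countP_eq_zero.2] at h
    · have := hq.1
      omega
    · intro y hy
      simpa using hmin y hy

/-- The answer from a list in memory. -/
theorem isAnswer_leaf {q : Word α} {lo : ℕ} {xs : List α} (hq : QValid q lo xs) :
    IsAnswer q lo xs (leafAnswer dle q lo xs) := by
  cases q with
  | key p =>
    simp only [IsAnswer, leafAnswer, qpos, ltB_dle, eqB_dle]
    congr 2
    simp [List.any_eq_true]
  | num n =>
    obtain ⟨h1, h2⟩ := hq
    have hi : n - 1 - lo < (xs.mergeSort dle).length := by rw [List.length_mergeSort]; omega
    have hp : List.Perm (xs.mergeSort dle) xs := List.mergeSort_perm xs dle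
    simp only [IsAnswer, leafAnswer]
    rw [areaKey_eq _ hi]
    set x := (xs.mergeSort dle)[n - 1 - lo] with hx
    refine ⟨x, hp.mem_iff.1 (List.getElem_mem _), rfl, ?_, ?_⟩
    · rw [← hp.countP_eq]
      by_contra hc
      have := (lt_countP_iff (sorted_mergeSort xs) (down_lt x) _ hi).1 (by omega)
      rw [decide_eq_true_eq, ← hx] at this
      exact lt_irrefl _ this
    · rw [← hp.countP_eq]
      have := (lt_countP_iff (sorted_mergeSort xs) (down_le x) _ hi).2 (by simp [← hx])
      omega

theorem qpos_bounds {q : Word α} {lo : ℕ} {xs : List α} (hq : QValid q lo xs) :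
    lo ≤ qpos q lo xs ∧ qpos q lo xs ≤ lo + xs.length := by
  cases q with
  | num n => exact ⟨hq.1.le, hq.2⟩
  | key p =>
    simp only [qpos]
    refine ⟨by omega, ?_⟩
    split_ifs with h
    · have h1 := countP_add_le (p := fun x => decide (x < p)) (p' := fun x => decide (x = p))
        (r := fun _ => true) xs (by
          intro x _ h1 h2
          simp only [decide_eq_true_eq] at h1 h2
          exact h1.ne h2) (by simp)
      have h2 : 0 < xs.countP (fun x => decide (x = p)) := by
        rw [List.countP_pos_iff]
        exact ⟨p, h, by simp⟩
      rw [List.countP_true] at h1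
      omega
    · have : xs.countP (fun x => decide (x < p)) ≤ xs.length := List.countP_le_length
      omega

end Spec

/-! ### The search tree -/

section Tree

variable {α : Type u} {N M B : ℕ}

/-- The disk addresses that belong to the node with level `l`, parent offset `p` and index `c`. -/
def Owns (N l p c a : ℕ) : Prop :=
  (∃ jl u, a = adr N 3 l p c jl u) ∨ (l = 0 ∧ a < N) ∨ (l ≠ 0 ∧ ∃ i, a = adr N 1 l p c 0 i)

/-- The identifiers of the nodes of the subtree of a node. -/
def Node.Region (nd : Node) (l p c : ℕ) : Prop :=
  (l = nd.lev ∧ p = nd.plo ∧ c = nd.ch) ∨ (nd.lev < l ∧ nd.lo ≤ p ∧ p < nd.lo + nd.sz)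

/-- The disk addresses of the subtree of a node. -/
def Node.Foot (N : ℕ) (nd : Node) (a : ℕ) : Prop := ∃ l p c, nd.Region l p c ∧ Owns N l p c a

theorem owns_unique {l p c l' p' c' a : ℕ} (hl : l ≠ 0) (h : Owns N l p c a)
    (h' : Owns N l' p' c' a) : l = l' ∧ p = p' ∧ c = c' := by
  rcases h with ⟨j, u, rfl⟩ | ⟨h0, _⟩ | ⟨_, i, rfl⟩
  · rcases h' with ⟨j', u', e⟩ | ⟨_, hlt⟩ | ⟨_, i', e⟩
    · rw [adr_inj] at e; omega
    · unfold adr at hlt; omega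
    · rw [adr_inj] at e; omega
  · exact absurd h0 hl
  · rcases h' with ⟨j', u', e⟩ | ⟨_, hlt⟩ | ⟨_, i', e⟩
    · rw [adr_inj] at e; omega
    · unfold adr at hlt; omega
    · rw [adr_inj] at e; omega

theorem not_owns_scrAdr {l p c h i : ℕ} : ¬ Owns N l p c (scrAdr N h i) := by
  rintro (⟨j, u, e⟩ | ⟨_, hlt⟩ | ⟨_, i', e⟩)
  · rw [scrAdr, adr_inj] at e; omega
  · unfold scrAdr adr at hlt; omega
  · rw [scrAdr, adr_inj] at e; omega

theorem owns_idxAdr (nd : Node) (jl u : ℕ) : Owns N nd.lev nd.plo nd.ch (idxAdr N nd jl u) :=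
  .inl ⟨jl, u, rfl⟩

theorem owns_fileAdr (nd : Node) {i : ℕ} (hi : i < N) :
    Owns N nd.lev nd.plo nd.ch (fileAdr N nd i) := by
  unfold fileAdr
  split_ifs with h
  · exact .inr (.inl ⟨h, hi⟩)
  · exact .inr (.inr ⟨h, i, rfl⟩)

theorem Node.Region.self (nd : Node) : nd.Region nd.lev nd.plo nd.ch := .inl ⟨rfl, rfl, rfl⟩

/-- No index of a node of the subtree has been written. -/
def Fresh (N M : ℕ) (d : ℕ → Fin B → Word α) (nd : Node) : Prop :=
  ∀ l p c, nd.Region l p c → (wordAt (d (adr N 3 l p c (topLev N M B) 0)) 0).key? = none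

variable [LinearOrder α]

/-- The disk holds a search tree for the list `xs` below the node `nd`; `dep x` is the number of
expanded nodes that contain the element of rank `x`. -/
inductive Rep (N M : ℕ) (d : ℕ → Fin B → Word α) (dep : ℕ → ℕ) : Node → List α → Prop
  | unexp (nd : Node) (xs : List α) (hsz : nd.sz = xs.length) (hfile : FileAt d (fileAdr N nd) xs)
      (hfresh : Fresh N M d nd) (hdep : ∀ x, nd.lo ≤ x → x < nd.lo + nd.sz → dep x = nd.lev) :
      Rep N M d dep nd xs
  | exp (nd : Node) (xs piv : List α) (fl : ℕ → List α) (hsz : nd.sz = xs.length) (hB : B < nd.sz)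
      (hpiv : PivGood M B xs piv) (hidx : IndexAt N M d nd piv (numsOf piv xs))
      (hperm : ∀ t < piv.length, List.Perm (fl t) (xs.filter (inCls dle piv (t + 1))))
      (hch : ∀ t (ht : t < piv.length), Rep N M d dep
        (nd.child (t + 1) (xs.countP (fun y => decide (y ≤ piv[t]))) (fl t).length) (fl t)) :
      Rep N M d dep nd xs

theorem Rep.sz_eq {d : ℕ → Fin B → Word α} {dep : ℕ → ℕ} {nd : Node} {xs : List α}
    (h : Rep N M d dep nd xs) : nd.sz = xs.length := by
  cases h <;> assumption

theorem countP_le_add_cls {piv xs : List α} (hs : piv.Pairwise (· ≤ ·)) {t : ℕ} (ht : t < piv.length) :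
    xs.countP (fun y => decide (y ≤ piv[t])) + (xs.filter (inCls dle piv (t + 1))).length
      ≤ xs.length := by
  rw [← List.countP_eq_length_filter]
  rw [show xs.length = xs.countP (fun _ => true) by rw [List.countP_true]]
  refine countP_add_le xs (fun y _ h1 h2 => ?_) (by simp)
  rw [decide_eq_true_eq] at h1
  exact absurd ((inCls_between hs h2).1 ht) (not_lt.2 h1)

theorem countP_le_add_cls_le {piv xs : List α} (hs : piv.Pairwise (· ≤ ·)) {t t' : ℕ}
    (ht : t < piv.length) (ht' : t' < piv.length) (h : t < t') :
    xs.countP (fun y => decide (y ≤ piv[t])) + (xs.filter (inCls dle piv (t + 1))).length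
      ≤ xs.countP (fun y => decide (y ≤ piv[t'])) := by
  rw [← List.countP_eq_length_filter]
  refine countP_add_le xs (fun y _ h1 h2 => ?_) (fun y _ h' => ?_)
  · rw [decide_eq_true_eq] at h1
    exact absurd ((inCls_between hs h2).1 ht) (not_lt.2 h1)
  · rw [decide_eq_true_eq]
    rcases h' with h' | h'
    · rw [decide_eq_true_eq] at h'
      exact h'.trans (List.pairwise_iff_getElem.1 hs _ _ _ _ h)
    · exact ((inCls_between hs h').2 t' ht' h).le

theorem length_cls_lt {piv xs : List α} (hF : 0 < piv.length) (hsub : piv ⊆ xs) (j : ℕ) :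
    (xs.filter (inCls dle piv j)).length < xs.length := by
  refine List.length_filter_lt_length_iff_exists.2 ⟨piv[0], hsub (List.getElem_mem _), ?_⟩
  rw [inCls_iff]
  exact fun h => h.1 (List.getElem_mem _)

theorem Node.Region.of_child {nd : Node} {j off cs l p c : ℕ} (hsz : 0 < nd.sz)
    (hoff : off + cs ≤ nd.sz) (h : (nd.child j off cs).Region l p c) :
    nd.Region l p c ∧ l ≠ 0 ∧ nd.lev < l := by
  rcases h with ⟨h1, h2, h3⟩ | ⟨h1, h2, h3⟩
  · simp only [Node.child] at h1 h2 h3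
    exact ⟨.inr ⟨by omega, by omega, by omega⟩, by omega, by omega⟩
  · simp only [Node.child] at h1 h2 h3
    exact ⟨.inr ⟨by omega, by omega, by omega⟩, by omega, by omega⟩

theorem Node.Region.child_disjoint {nd : Node} {j off cs j' off' cs' l p c : ℕ} (hj : j ≠ j')
    (h : off + cs ≤ off' ∨ off' + cs' ≤ off) (h1 : (nd.child j off cs).Region l p c)
    (h2 : (nd.child j' off' cs').Region l p c) : False := by
  unfold Node.Region Node.child at h1 h2
  simp only at h1 h2
  omega

/-- The subtree of a node is preserved if neither its disk blocks nor its depths change. -/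
theorem Rep.congr {d d' : ℕ → Fin B → Word α} {dep dep' : ℕ → ℕ} {nd : Node} {xs : List α}
    (hB : 0 < B) (h : Rep N M d dep nd xs) (hN : nd.sz ≤ N) (hd : ∀ a, nd.Foot N a → d' a = d a)
    (hdep : ∀ x, nd.lo ≤ x → x < nd.lo + nd.sz → dep' x = dep x) : Rep N M d' dep' nd xs := by
  induction h with
  | unexp nd xs hsz hfile hfresh hdp =>
    refine .unexp nd xs hsz (hfile.congr fun i hi => hd _ ?_) ?_ fun x h1 h2 => ?_
    · have : i ≤ i * B := Nat.le_mul_of_pos_right _ hB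
      exact ⟨_, _, _, .self nd, owns_fileAdr nd (by omega)⟩
    · intro l p c hr
      rw [hd _ ⟨l, p, c, hr, .inl ⟨_, _, rfl⟩⟩]
      exact hfresh l p c hr
    · rw [hdep x h1 h2, hdp x h1 h2]
  | exp nd xs piv fl hsz hBs hpiv hidx hperm hch ih =>
    refine .exp nd xs piv fl hsz hBs hpiv ?_ hperm fun t ht => ?_
    · intro jl u h1 h2
      rw [hd _ ⟨_, _, _, .self nd, owns_idxAdr nd jl u⟩]
      exact hidx jl u h1 h2
    · have hle := countP_le_add_cls (xs := xs) hpiv.sorted ht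
      rw [← (hperm t ht).length_eq] at hle
      refine ih t ht ?_ ?_ ?_
      · simp only [Node.child]; omega
      · rintro a ⟨l, p, c, hr, ho⟩
        exact hd a ⟨l, p, c, (hr.of_child (by omega) (by omega)).1, ho⟩
      · intro x h1 h2
        simp only [Node.child] at h1 h2
        exact hdep x (by omega) (by omega)

end Tree

section Visit

variable {α : Type u} {N M B : ℕ} {q : Word α}

theorem enterNode_big {s : St α B} (h : B < s.nd.sz) : enterNode N M s
    = ({ s with pc := 3, jl := topLev N M B, u := 0 },
        .read (idxAdr N s.nd (topLev N M B) 0)) := by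
  unfold enterNode
  rw [if_neg (by omega)]

theorem Bd.enter {s : St α B} (h : Bd N M s) (j : ℕ) (hj : j ≤ 3) :
    Bd N M { s with pc := j, jl := topLev N M B, u := 0 } := by
  have hctl := h.ctl
  have := topLev_le (N := N) (M := M) (B := B)
  simp only [St.ctl, List.mem_cons, List.not_mem_nil, or_false, forall_eq_or_imp, forall_eq]
    at hctl
  refine ⟨?_, h.nums, h.piv_len, h.pool_len, h.nums_len⟩
  simp only [St.ctl, List.mem_cons, List.not_mem_nil, or_false, forall_eq_or_imp, forall_eq]
  omega

theorem Bd.set_pc {s : St α B} (h : Bd N M s) (j : ℕ) (hj : j ≤ 12) :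
    Bd N M { s with pc := j } := by
  have hctl := h.ctl
  simp only [St.ctl, List.mem_cons, List.not_mem_nil, or_false, forall_eq_or_imp, forall_eq]
    at hctl
  refine ⟨?_, h.nums, h.piv_len, h.pool_len, h.nums_len⟩
  simp only [St.ctl, List.mem_cons, List.not_mem_nil, or_false, forall_eq_or_imp, forall_eq]
  omega

theorem idxAdr_lt {nd : Node} (hnd : nd.Bdd N) {j u : ℕ} (hj : j ≤ N + 1) (hu : u ≤ N + 1) :
    idxAdr N nd j u < wMax N := by
  have h1 := hnd.lev_sz
  have h2 := hnd.plo
  have h3 := hnd.ch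
  exact adr_lt (by omega) (by omega) (by omega) (by omega) hj hu

variable [LinearOrder α]

/-- The expansion of a node that is visited for the first time. -/
theorem goes_expand (hg : Good N M B) {d : ℕ → Fin B → Word α} {dep : ℕ → ℕ} {xs : List α}
    {s₀ s : St α B} (h0 : algStep N M B α dle q s₀ = enterNode N M s) (hbuf : s.buf = s₀.buf)
    (hbd : Bd N M s) (hnd : s.nd.Bdd N) (hB : B < s.nd.sz) (hsz : s.nd.sz = xs.length)
    (hfile : FileAt d (fileAdr N s.nd) xs) (hfresh : Fresh N M d s.nd) :
    ∃ (t : ℕ) (s' : St α B) (d' : ℕ → Fin B → Word α) (piv : List α) (fl : ℕ → List α),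
      Goes N M q s₀ d t s' d' ∧ algStep N M B α dle q s' = enterNode N M s' ∧ s'.nd = s.nd ∧
      Bd N M s' ∧ PivGood M B xs piv ∧ IndexAt N M d' s.nd piv (numsOf piv xs) ∧
      (∀ t < piv.length, List.Perm (fl t) (xs.filter (inCls dle piv (t + 1)))) ∧
      (∀ t (ht : t < piv.length), Rep N M d'
        (fun x => if s.nd.lo ≤ x ∧ x < s.nd.lo + s.nd.sz then s.nd.lev + 1 else dep x)
        (s.nd.child (t + 1) (xs.countP (fun y => decide (y ≤ piv[t]))) (fl t).length) (fl t)) ∧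
      (∀ a, ¬ s.nd.Foot N a → (∀ h i, a ≠ scrAdr N h i) → d' a = d a) ∧
      t * B ≤ 17 * s.nd.sz + (2 * topLev N M B + 21) * B := by
  have hB16 := hg.1
  have hlev := hnd.lev_sz
  have hlo := hnd.lo_sz
  have htl := topLev_le (N := N) (M := M) (B := B)
  have hctl := hbd.ctl
  simp only [St.ctl, List.mem_cons, List.not_mem_nil, or_false, forall_eq_or_imp, forall_eq]
    at hctl
  rw [enterNode_big hB] at h0
  have g1 := goes_read (d := d) h0 (idxAdr_lt hnd (by omega) (by omega)) (hbd.enter 3 le_rfl) hbuf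
  set bf1 := d (idxAdr N s.nd (topLev N M B) 0) with hbf1
  have hf0 : (wordAt bf1 0).key? = none := hfresh _ _ _ (.self s.nd)
  set s2 : St α B :=
    { s with
      pc := 4, jl := topLev N M B, u := 0, h := 0, fs := s.nd.sz, i := 0, o := 0, pool := [],
      buf := bf1 } with hs2
  have st2 : algStep N M B α dle q { s with pc := 3, jl := topLev N M B, u := 0, buf := bf1 }
      = (s2, .read 0) := by
    show searchStep N M dle q _ = _
    unfold searchStep
    rw [if_pos (by simp only [hf0, Option.isNone_none])]
  have b2 : Bd N M s2 := by
    refine ⟨?_, hbd.nums, hbd.piv_len, by simp [hs2], hbd.nums_len⟩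
    simp only [hs2, St.ctl, List.mem_cons, List.not_mem_nil, or_false, forall_eq_or_imp,
      forall_eq]
    omega
  have g2 := goes_read (d := d) st2 zero_lt_wMax b2 rfl
  have hp := pivGood_pivots hg (xs := xs) (by omega) (by omega)
  have hcap := hg.load_le_capac
  obtain ⟨hd1, hd2⟩ := hg.dist_le_load
  have hlf := hp.len_fMax
  obtain ⟨t3, s3, d3, g3, a1, a2, a3, a4, a5, a6, b3, f3, c3⟩ := goes_pivots (q := q) hg xs
    { s2 with buf := d 0 } d (by omega) rfl rfl rfl rfl hnd (by simp only [hs2]; omega) hsz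
    (fun i hi => by
      have := hfile i hi
      simpa [srcAdr, hs2] using this) (b2.set_buf _) (by omega)
  simp only [hs2] at a2
  set piv := pivots M B xs with hpiv
  have hFB : (piv.length + 1) * B ≤ capac M B := by
    have : (piv.length + 1) * B ≤ (fMax M B + 2) * B := Nat.mul_le_mul_right _ (by omega)
    omega
  have hfile3 : FileAt d3 (fileAdr N s.nd) xs := hfile.congr fun i hi => by
    apply f3
    intro h' i'
    refine (scrAdr_ne_fileAdr fun _ => ?_).symm
    have : i ≤ i * B := Nat.le_mul_of_pos_right _ (by omega)
    omega
  have hD : Distributed N M s.nd piv (xs.take (s3.i * B)) (fun _ => []) s3 d3 := by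
    refine ⟨a1, a2, a5, ?_, by simp [a4], ?_, by simp, ?_, b3⟩
    · rw [a6, a3, Nat.zero_mul, List.take_zero]
      simp
    · intro t _ i hi
      simp at hi
    · intro t _
      simp [a3, a4]
  obtain ⟨t4, s4, d4, fl, g4, p1, p2, p3, p4, p5, p6, p7, b4, f4, c4⟩ := hD.goes (q := q)
    (by omega) hnd hsz (by omega) hp hFB hfile3 (by rw [a3]; omega)
  obtain ⟨t5, bf5, d5, g5, i5, f5, c5, b5⟩ := goes_index (q := q) hB16 s4 d4 p1
    (by rw [p4]; exact hnd) (by rw [p5]; have := hp.len_le; omega) p3 (by rw [p2]; omega) b4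
    (by intro jl u h; omega)
  rw [p4, p5, p6] at i5
  rw [p4] at f5
  have hregion : ∀ t (ht : t < piv.length) l p c, (s.nd.child (t + 1)
      (xs.countP (fun y => decide (y ≤ piv[t]))) (fl t).length).Region l p c →
      s.nd.Region l p c ∧ l ≠ 0 ∧ s.nd.lev < l := by
    intro t ht l p c hr
    have hle := countP_le_add_cls (xs := xs) hp.sorted ht
    rw [← (p7 t ht).2.length_eq] at hle
    exact hr.of_child (by omega) (by omega)
  refine ⟨1 + 1 + t3 + t4 + t5, { s4 with jl := topLev N M B + 1, buf := bf5 }, d5, piv, fl,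
    (((g1.trans g2).trans g3).trans g4).trans g5, ?_, p4, b5, hp, i5, fun t ht => (p7 t ht).2,
    ?_, ?_, ?_⟩
  · unfold algStep
    simp only [p1]
    unfold indexStep
    rw [if_neg (by simp)]
  · intro t ht
    refine .unexp _ _ rfl ?_ ?_ ?_
    · refine (p7 t ht).1.congr fun i _ => f5 _ fun jl u => ?_
      simp only [fileAdr, Node.child, idxAdr, Nat.add_eq_zero_iff, one_ne_zero, and_false, if_false]
      rw [Ne, adr_inj]; omega
    · intro l p c hr
      obtain ⟨h1, h2, h3⟩ := hregion t ht l p c hr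
      rw [f5 _ (by intro jl u; rw [idxAdr, Ne, adr_inj]; omega), f4 _ (by
        intro t' _ i
        simp only [fileAdr, Node.child, Nat.add_eq_zero_iff, one_ne_zero, and_false, if_false]
        rw [Ne, adr_inj]; omega), f3 _ (by intro h' i; rw [scrAdr, Ne, adr_inj]; omega)]
      exact hfresh l p c h1
    · intro x h1 h2
      have hle := countP_le_add_cls (xs := xs) hp.sorted ht
      rw [← (p7 t ht).2.length_eq] at hle
      simp only [Node.child] at h1 h2 ⊢
      rw [if_pos (by omega)]
  · intro a ha hscr
    rw [f5 a (by
      rintro jl u rfl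
      exact ha ⟨_, _, _, .self _, owns_idxAdr _ _ _⟩), f4 a (by
      rintro t ht i rfl
      refine ha ⟨_, _, _, (hregion t ht _ _ _ (.self _)).1, .inr (.inr ⟨by simp [Node.child], i, ?_⟩)⟩
      simp [fileAdr, Node.child]), f3 a hscr]
  · have h1 := hp.len_mul
    rw [p2, p5, pow_zero, Nat.div_one] at c5
    have h2 : t5 * B ≤ piv.length * B + (2 * (topLev N M B + 1)) * B := by
      rw [← Nat.add_mul]
      exact Nat.mul_le_mul_right _ c5
    rw [a3, a4, Nat.zero_mul, if_pos (by omega), List.length_nil] at c4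
    have h3 : (2 * (topLev N M B + 1)) * B = 2 * topLev N M B * B + 2 * B := by ring
    have h4 : (2 * topLev N M B + 21) * B = 2 * topLev N M B * B + 21 * B := by ring
    rw [Nat.add_mul, Nat.add_mul, Nat.add_mul, h4]
    omega

/-- The outcome of a query on the subtree of a node: the answer is correct, the tree is preserved, and
the cost is `c` plus an amount that is paid for by the growth of the depths. -/
def Visits (N M : ℕ) (q : Word α) (s₀ : St α B) (d : ℕ → Fin B → Word α) (dep : ℕ → ℕ) (nd : Node)
    (xs : List α) (c : ℕ) : Prop :=
  ∃ (t : ℕ) (w : Word α) (s' : St α B) (d' : ℕ → Fin B → Word α) (dep' : ℕ → ℕ),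
    Answers (algStep N M B α dle) (wMax N) (capac M B) q s₀ d t w s' d' ∧
    IsAnswer q nd.lo xs w ∧ s'.pc = 0 ∧ Bd N M s' ∧ Rep N M d' dep' nd xs ∧
    (∀ a, ¬ nd.Foot N a → (∀ h i, a ≠ scrAdr N h i) → d' a = d a) ∧
    (∀ x, ¬ (nd.lo ≤ x ∧ x < nd.lo + nd.sz) → dep' x = dep x) ∧
    (∀ x k, k < dep' x → k < dep x ∨
      ((x - qpos q nd.lo xs) + (qpos q nd.lo xs - x)) * gFac M B ^ k ≤ N ∧
        B * gFac M B ^ k ≤ N) ∧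
    t * B + 17 * ∑ x ∈ Finset.range N, dep x ≤ c + 17 * ∑ x ∈ Finset.range N, dep' x

theorem IsAnswer.num_le {lo : ℕ} {xs : List α} {w : Word α} (h : IsAnswer q lo xs w)
    (hq : QValid q lo xs) {k : ℕ} (hk : w = .num k) : k ≤ lo + xs.length := by
  cases q with
  | num n =>
    obtain ⟨x, _, e, _⟩ := h
    rw [e] at hk
    cases hk
  | key p =>
    simp only [IsAnswer] at h
    rw [h, Word.num.injEq] at hk
    rw [← hk]
    exact (qpos_bounds hq).2

/-- An answer that changes neither the disk nor the tree. -/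
theorem visits_of_answer {d : ℕ → Fin B → Word α} {dep : ℕ → ℕ} {nd : Node} {xs : List α}
    {s₀ s₁ : St α B} {t c : ℕ} {w : Word α} (hnd : nd.Bdd N) (hrep : Rep N M d dep nd xs)
    (hq : QValid q nd.lo xs) (hgo : Goes N M q s₀ d t s₁ d) {s' : St α B}
    (hst : algStep N M B α dle q s₁ = (s', .answer w)) (hpc : s'.pc = 0) (hbd : Bd N M s')
    (hbuf : s'.buf = s₁.buf) (hw : IsAnswer q nd.lo xs w) (ht : t * B ≤ c) :
    Visits N M q s₀ d dep nd xs c := by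
  refine ⟨t, w, s', d, dep, ⟨s₁, hgo, hst, hbd.fits (.inl hbuf), fun k hk => ?_⟩, hw, hpc, hbd,
    hrep, fun _ _ _ => rfl, fun _ _ => rfl, fun _ _ h => .inl h, by omega⟩
  have h1 := hw.num_le hq hk
  have h2 := hnd.lo_sz
  have h3 := add_lt_wMax N
  rw [hrep.sz_eq] at h2
  omega

theorem visits_leaf (hg : Good N M B) (hNB : B < N) {d : ℕ → Fin B → Word α} {dep : ℕ → ℕ}
    {xs : List α} {s₀ s : St α B} (h0 : algStep N M B α dle q s₀ = enterNode N M s)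
    (hbuf : s.buf = s₀.buf) (hbd : Bd N M s) (hnd : s.nd.Bdd N) (hB : s.nd.sz ≤ B)
    (hrep : Rep N M d dep s.nd xs) (hq : QValid q s.nd.lo xs) :
    Visits N M q s₀ d dep s.nd xs B := by
  have hB16 := hg.1
  have hfile : FileAt d (fileAdr N s.nd) xs := by
    cases hrep with
    | unexp _ _ _ h => exact h
    | exp _ _ _ _ _ h => omega
  have hsz := hrep.sz_eq
  unfold enterNode at h0
  rw [if_pos hB] at h0
  have h1 := hnd.lev_sz
  have h2 := hnd.plo
  have h3 := hnd.ch
  have g1 := goes_read (d := d) h0 (fileAdr_lt (by omega) (by omega) (by omega) (by omega))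
    (hbd.set_pc 2 (by omega)) hbuf
  have hxs : (keysOf (d (fileAdr N s.nd 0))).take s.nd.sz = xs := by
    rcases Nat.eq_zero_or_pos xs.length with h | h
    · rw [hsz, h, List.take_zero]
      exact (List.length_eq_zero_iff.1 h).symm
    · have hb : xs.take B = xs := List.take_of_length_le (by omega)
      rw [hfile 0 (by omega), Nat.zero_mul, List.drop_zero, hb, keysOf_keyBlock _ (by omega), hsz,
        List.take_length]
  set s1 : St α B := { s with pc := 2, buf := d (fileAdr N s.nd 0) } with hs1
  have st : algStep N M B α dle q s1 = ({ s1 with pc := 0, ld := 0 },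
      .answer (leafAnswer dle q s.nd.lo xs)) := by
    show leafStep N dle q s1 = _
    unfold leafStep
    rw [if_neg (by omega)]
    simp only [hs1, hxs]
  refine visits_of_answer hnd hrep hq g1 st rfl ?_ rfl (isAnswer_leaf hq) (by omega)
  have hctl := hbd.ctl
  simp only [St.ctl, List.mem_cons, List.not_mem_nil, or_false, forall_eq_or_imp, forall_eq]
    at hctl
  refine ⟨?_, hbd.nums, hbd.piv_len, hbd.pool_len, hbd.nums_len⟩
  simp only [hs1, St.ctl, List.mem_cons, List.not_mem_nil, or_false, forall_eq_or_imp, forall_eq]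
  omega

/-- A query on the subtree of an expanded node, provided that its children can be queried. -/
theorem visits_exp (hg : Good N M B) {d : ℕ → Fin B → Word α} {dep : ℕ → ℕ}
    {xs piv : List α} {fl : ℕ → List α} {s₀ s : St α B} {c : ℕ}
    (h0 : algStep N M B α dle q s₀ = enterNode N M s)
    (hbuf : s.buf = s₀.buf) (hbd : Bd N M s) (hnd : s.nd.Bdd N) (hB : B < s.nd.sz)
    (hsz : s.nd.sz = xs.length) (hq : QValid q s.nd.lo xs)
    (hpiv : PivGood M B xs piv) (hidx : IndexAt N M d s.nd piv (numsOf piv xs))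
    (hperm : ∀ t < piv.length, List.Perm (fl t) (xs.filter (inCls dle piv (t + 1))))
    (hch : ∀ t (ht : t < piv.length), Rep N M d dep
      (s.nd.child (t + 1) (xs.countP (fun y => decide (y ≤ piv[t]))) (fl t).length) (fl t))
    (ih : ∀ t (ht : t < piv.length) (s₁ : St α B),
      algStep N M B α dle q s₁ = enterNode N M { s₁ with nd := (s.nd.child (t + 1)
        (xs.countP (fun y => decide (y ≤ piv[t]))) (fl t).length) } →
      Bd N M s₁ → QValid q (s.nd.lo + xs.countP (fun y => decide (y ≤ piv[t]))) (fl t) →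
      Visits N M q s₁ d dep
        (s.nd.child (t + 1) (xs.countP (fun y => decide (y ≤ piv[t]))) (fl t).length) (fl t) c) :
    Visits N M q s₀ d dep s.nd xs (c + (topLev N M B + 1) * B) := by
  have hB16 := hg.1
  have hlev := hnd.lev_sz
  have htl := topLev_le (N := N) (M := M) (B := B)
  have hrep : Rep N M d dep s.nd xs := .exp _ _ piv fl hsz hB hpiv hidx hperm hch
  rw [enterNode_big hB] at h0
  have g1 := goes_read (d := d) h0 (idxAdr_lt hnd (by omega) (by omega)) (hbd.enter 3 le_rfl) hbuf
  rw [hidx _ 0 le_rfl (by rw [Nat.zero_mul]; exact hpiv.pos)] at g1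
  set s1 : St α B :=
    { s with
      pc := 3, jl := topLev N M B, u := 0,
      buf := idxBlock B piv (numsOf piv xs) (topLev N M B) 0 } with hs1
  have b1 : Bd N M s1 := (hbd.enter 3 le_rfl).set_buf _
  have hbelow := below_numsOf hpiv.sorted q s.nd.lo xs
  have hb : 1 < fan B := by unfold fan; omega
  have hF : piv.length < fan B ^ (topLev N M B + 1) := by
    refine lt_of_le_of_lt (le_min hpiv.len_fMax ?_) (Nat.lt_pow_succ_log_self hb _)
    have := hpiv.len_le
    omega
  rcases hT : piv.countP (qLe q s.nd.lo xs) with _ | t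
  · rw [hT] at hbelow
    have hc := hbelow.count (B := B) hB16 (topLev N M B) 0
    replace hc := hc.trans (List.countP_eq_zero.2 (by simp))
    have st : algStep N M B α dle q s1 = ({ s1 with pc := 0 }, .answer (.num s.nd.lo)) := by
      show searchStep N M dle q s1 = _
      unfold searchStep
      rw [if_neg]
      · exact if_pos hc
      rw [hs1, wordAt_idxBlock_key hB16 _ _ _ _ _ (by omega), Nat.zero_mul, Nat.zero_add,
        Nat.zero_mul, areaKey_eq _ hpiv.pos]
      simp [Word.key?]
    refine visits_of_answer hnd hrep hq g1 st rfl (b1.set_pc 0 (by omega)) rfl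
      (isAnswer_none hq hpiv.pos hpiv.min ?_) ?_
    · intro h
      have := (lt_countP_iff hpiv.sorted (down_qLe q s.nd.lo xs) 0 hpiv.pos).2 h
      omega
    · rw [Nat.add_mul]; omega
  · rw [hT] at hbelow
    have htF : t < piv.length := hbelow.1
    obtain ⟨s2, g2, e2, b2, st2⟩ := goes_search (q := q) hg (T := t + 1) (by omega)
      (by have := hpiv.len_le; omega) s1 rfl hnd hidx hbelow le_rfl
      (by
        show 0 = _
        rw [Nat.div_eq_of_lt]
        have : fan B ^ (topLev N M B + 1) = fan B ^ (s1.jl + 1) := rfl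
        omega) rfl b1
    have g12 := g1.trans g2
    simp only [Nat.add_sub_cancel] at st2
    rw [areaKey_eq _ htF, getD_numsOf_lt _ _ htF, getD_numsOf_le _ _ htF, getD_numsOf_cls _ _ htF,
      ← (hperm t htF).length_eq] at st2
    have q1 : qLe q s.nd.lo xs piv[t] = true :=
      (lt_countP_iff hpiv.sorted (down_qLe q s.nd.lo xs) t htF).1 (by omega)
    have q2 : ∀ s' (h : s' < piv.length), t < s' → ¬ qLe q s.nd.lo xs piv[s'] = true := by
      intro s' h hts hc
      have := (lt_countP_iff hpiv.sorted (down_qLe q s.nd.lo xs) s' h).2 hc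
      omega
    have htime : (1 + s1.jl) * B = (topLev N M B + 1) * B := by
      rw [Nat.add_comm]
    cases hh : entryHit dle q s.nd.lo (.key piv[t]) (xs.countP (fun y => decide (y < piv[t])))
      (xs.countP (fun y => decide (y ≤ piv[t]))) with
    | true =>
      rw [show s1.nd = s.nd from rfl, if_pos hh] at st2
      exact visits_of_answer hnd hrep hq g12 st2 rfl (b2.set_pc 0 (by omega)) rfl
        (isAnswer_hit hpiv.subset htF q1 hh) (by omega)
    | false =>
      rw [show s1.nd = s.nd from rfl, if_neg (by rw [hh]; simp)] at st2
      obtain ⟨v1, v2, v3⟩ := descend hpiv.sorted hq htF q1 q2 hh (hperm t htF)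
      obtain ⟨t3, w, s3, d3, dep3, a1, a2, a3, a4, a5, a6, a7, a8, a9⟩ := ih t htF s2 st2 b2 v1
      have hle := countP_le_add_cls (xs := xs) hpiv.sorted htF
      rw [← (hperm t htF).length_eq] at hle
      have hlt := length_cls_lt (xs := xs) hpiv.pos hpiv.subset (t + 1)
      rw [← (hperm t htF).length_eq] at hlt
      refine ⟨1 + s1.jl + t3, w, s3, d3, dep3, g12.answers a1, v3 w a2, a3, a4, ?_, ?_, ?_, ?_, ?_⟩
      · refine .exp _ _ piv fl hsz hB hpiv ?_ hperm fun t' ht' => ?_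
        · intro jl u h1 h2
          rw [a6 _ ?_ fun h i => (scrAdr_ne_idxAdr).symm]
          · exact hidx jl u h1 h2
          · rintro ⟨l, p, c', hr, ho⟩
            obtain ⟨_, h4, h5⟩ := hr.of_child (by omega) (by omega)
            have := owns_unique h4 ho (owns_idxAdr s.nd jl u)
            omega
        · rcases eq_or_ne t' t with rfl | hne
          · exact a5
          · have hle' := countP_le_add_cls (xs := xs) hpiv.sorted ht'
            rw [← (hperm t' ht').length_eq] at hle'
            have hdis : xs.countP (fun y => decide (y ≤ piv[t'])) + (fl t').length
                  ≤ xs.countP (fun y => decide (y ≤ piv[t])) ∨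
                xs.countP (fun y => decide (y ≤ piv[t])) + (fl t).length
                  ≤ xs.countP (fun y => decide (y ≤ piv[t'])) := by
              rw [(hperm t htF).length_eq, (hperm t' ht').length_eq]
              rcases Nat.lt_or_ge t' t with h | h
              · exact .inl (countP_le_add_cls_le hpiv.sorted ht' htF h)
              · exact .inr (countP_le_add_cls_le hpiv.sorted htF ht' (by omega))
            refine (hch t' ht').congr (by omega) (by simp only [Node.child]; omega) ?_ ?_
            · rintro a ⟨l, p, c', hr, ho⟩
              have h4 := (hr.of_child (by omega) (by omega)).2.1
              refine a6 a ?_ ?_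
              · rintro ⟨l', p', c'', hr', ho'⟩
                obtain ⟨rfl, rfl, rfl⟩ := owns_unique h4 ho ho'
                exact hr.child_disjoint (by omega) hdis hr'
              · rintro h i rfl
                exact not_owns_scrAdr ho
            · intro x h1 h2
              refine a7 x ?_
              simp only [Node.child] at h1 h2 ⊢
              omega
      · intro a ha hscr
        refine a6 a ?_ hscr
        rintro ⟨l, p, c', hr, ho⟩
        exact ha ⟨l, p, c', (hr.of_child (by omega) (by omega)).1, ho⟩
      · intro x hx
        refine a7 x ?_
        simp only [Node.child]
        omega
      · intro x k hk
        have := a8 x k hk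
        simp only [Node.child] at this
        rwa [v2] at this
      · rw [Nat.add_mul]
        omega

theorem sum_dep_expand (dep : ℕ → ℕ) (lo sz lev : ℕ) (h : lo + sz ≤ N)
    (hdep : ∀ x, lo ≤ x → x < lo + sz → dep x = lev) :
    ∑ x ∈ Finset.range N, (if lo ≤ x ∧ x < lo + sz then lev + 1 else dep x)
      = ∑ x ∈ Finset.range N, dep x + sz := by
  have : ∀ x ∈ Finset.range N, (if lo ≤ x ∧ x < lo + sz then lev + 1 else dep x)
      = dep x + if x ∈ Finset.Ico lo (lo + sz) then 1 else 0 := by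
    intro x _
    simp only [Finset.mem_Ico]
    split_ifs with h1
    · rw [hdep x h1.1 h1.2]
    · rfl
  rw [Finset.sum_congr rfl this, Finset.sum_add_distrib, Finset.sum_ite_mem,
    Finset.inter_eq_right.2, Finset.sum_const, Nat.card_Ico]
  · simp
  · intro x hx
    rw [Finset.mem_Ico] at hx
    rw [Finset.mem_range]
    omega

/-- A query on the subtree of a node. -/
theorem visits (hg : Good N M B) (hNB : B < N) (n : ℕ) :
    ∀ {d : ℕ → Fin B → Word α} {dep : ℕ → ℕ} {xs : List α} {s₀ s : St α B}, s.nd.sz = n →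
    algStep N M B α dle q s₀ = enterNode N M s → s.buf = s₀.buf → Bd N M s → s.nd.Bdd N →
    s.nd.lev ≤ Nat.log (gFac M B) N + 1 → (B < s.nd.sz → s.nd.sz * gFac M B ^ s.nd.lev ≤ N) →
    Rep N M d dep s.nd xs → QValid q s.nd.lo xs →
    Visits N M q s₀ d dep s.nd xs
      ((Nat.log (gFac M B) N + 2 - s.nd.lev) * (24 * (topLev N M B + 1) * B)) := by
  induction n using Nat.strong_induction_on with
  | _ n ih =>
    intro d dep xs s₀ s hn h0 hbuf hbd hnd hlev hgeo hrep hq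
    set L := Nat.log (gFac M B) N with hL
    set J := topLev N M B with hJ
    have hg16 := hg.gFac_ge
    have hB16 := hg.1
    have hsz := hrep.sz_eq
    have hl := hnd.lev_sz
    have hl2 := hnd.lo_sz
    by_cases hB : s.nd.sz ≤ B
    · obtain ⟨t, w, s', d', dep', a1, a2, a3, a4, a5, a6, a7, a8, a9⟩ :=
        visits_leaf hg hNB h0 hbuf hbd hnd hB hrep hq
      refine ⟨t, w, s', d', dep', a1, a2, a3, a4, a5, a6, a7, a8, a9.trans ?_⟩
      have : 1 * (1 * B) ≤ (L + 2 - s.nd.lev) * (24 * (J + 1) * B) :=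
        Nat.mul_le_mul (by omega) (Nat.mul_le_mul_right _ (by omega))
      omega
    · rw [not_le] at hB
      have hgeo' := hgeo hB
      have hlevL : s.nd.lev ≤ L := by
        apply Nat.le_log_of_pow_le (by omega)
        refine le_trans ?_ hgeo'
        exact Nat.le_mul_of_pos_left _ (by omega)
      have key : ∀ {d : ℕ → Fin B → Word α} {dep : ℕ → ℕ} {piv : List α} {fl : ℕ → List α}
          {s₀ s' : St α B}, algStep N M B α dle q s₀ = enterNode N M s' → s'.buf = s₀.buf →
          Bd N M s' → s'.nd = s.nd →
          PivGood M B xs piv → IndexAt N M d s.nd piv (numsOf piv xs) →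
          (∀ t < piv.length, List.Perm (fl t) (xs.filter (inCls dle piv (t + 1)))) →
          (∀ t (ht : t < piv.length), Rep N M d dep
            (s.nd.child (t + 1) (xs.countP (fun y => decide (y ≤ piv[t]))) (fl t).length)
            (fl t)) →
          Visits N M q s₀ d dep s.nd xs
            ((L + 1 - s.nd.lev) * (24 * (J + 1) * B) + (J + 1) * B) := by
        intro d dep piv fl s₀ s' h0 hbuf hbd hnd' hpiv hidx hperm hch
        rw [← hnd'] at hidx hch hnd hB hsz hq hl hl2 hgeo' hlevL hn ⊢
        refine visits_exp hg h0 hbuf hbd hnd hB hsz hq hpiv hidx hperm hch ?_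
        intro t ht s₁ h1 hbd1 hq1
        have hle := countP_le_add_cls (xs := xs) hpiv.sorted ht
        have hlt := length_cls_lt (xs := xs) hpiv.pos hpiv.subset (t + 1)
        have hsm := hpiv.small t ht
        rw [← (hperm t ht).length_eq] at hle hlt hsm
        have hFl := hpiv.len_le
        have hbdd : (s'.nd.child (t + 1) (xs.countP (fun y => decide (y ≤ piv[t])))
            (fl t).length).Bdd N := by
          constructor <;> simp only [Node.child] <;> omega
        have b1 : Bd N M { s₁ with nd := (s'.nd.child (t + 1)
            (xs.countP (fun y => decide (y ≤ piv[t]))) (fl t).length) } := by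
          refine ⟨?_, hbd1.nums, hbd1.piv_len, hbd1.pool_len, hbd1.nums_len⟩
          have hctl := hbd1.ctl
          simp only [St.ctl, List.mem_cons, List.not_mem_nil, or_false, forall_eq_or_imp,
            forall_eq] at hctl
          simp only [Node.child, St.ctl, List.mem_cons, List.not_mem_nil, or_false,
            forall_eq_or_imp, forall_eq]
          omega
        have := ih (fl t).length (by omega) (d := d) (dep := dep) (xs := fl t) (s₀ := s₁)
          (s := { s₁ with nd := (s'.nd.child (t + 1)
            (xs.countP (fun y => decide (y ≤ piv[t]))) (fl t).length) }) rfl h1 rfl b1 hbdd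
          (by simp only [Node.child]; omega) (by
            intro hbig
            simp only [Node.child] at hbig ⊢
            rcases hsm with hsm | hsm
            · omega
            · rw [pow_succ', ← Nat.mul_assoc]
              refine (Nat.mul_le_mul_right _ hsm).trans ?_
              rw [← hsz]; exact hgeo') (hch t ht) hq1
        simp only [Node.child] at this ⊢
        rw [show L + 2 - (s'.nd.lev + 1) = L + 1 - s'.nd.lev by omega] at this
        exact this
      have hsucc : (L + 2 - s.nd.lev) * (24 * (J + 1) * B)
          = (L + 1 - s.nd.lev) * (24 * (J + 1) * B) + 24 * (J + 1) * B := by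
        rw [show L + 2 - s.nd.lev = L + 1 - s.nd.lev + 1 by omega, Nat.succ_mul]
      have hJB : 24 * (J + 1) * B = 24 * (J * B) + 24 * B := by ring
      have hJB' : (J + 1) * B = J * B + B := by ring
      cases hrep with
      | exp _ _ piv fl _ _ hpiv hidx hperm hch =>
        obtain ⟨t, w, s', d', dep', a1, a2, a3, a4, a5, a6, a7, a8, a9⟩ :=
          key h0 hbuf hbd rfl hpiv hidx hperm hch
        refine ⟨t, w, s', d', dep', a1, a2, a3, a4, a5, a6, a7, a8, a9.trans ?_⟩
        omega
      | unexp _ _ _ hfile hfresh hdep =>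
        obtain ⟨t1, s1, d1, piv, fl, g1, e1, n1, b1, p1, p2, p3, p4, f1, c1⟩ :=
          goes_expand (dep := dep) hg h0 hbuf hbd hnd hB hsz hfile hfresh
        obtain ⟨t, w, s', d', dep', a1, a2, a3, a4, a5, a6, a7, a8, a9⟩ :=
          key e1 rfl b1 n1 p1 p2 p3 p4
        refine ⟨t1 + t, w, s', d', dep', g1.answers a1, a2, a3, a4, a5,
          fun a h1 h2 => (a6 a h1 h2).trans (f1 a h1 h2), ?_, ?_, ?_⟩
        · intro x hx
          rw [a7 x hx]
          exact if_neg hx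
        · intro x k hk
          rcases a8 x k hk with h | h
          · dsimp only at h
            split_ifs at h with hx
            · rcases Nat.lt_or_ge k s.nd.lev with h' | h'
              · left
                rw [hdep x hx.1 hx.2]; exact h'
              · right
                have hk' : k = s.nd.lev := by omega
                obtain ⟨z1, z2⟩ := qpos_bounds hq
                rw [hk']
                exact ⟨(Nat.mul_le_mul_right _ (by omega)).trans hgeo',
                  (Nat.mul_le_mul_right _ hB.le).trans hgeo'⟩
            · exact .inl h
          · exact .inr h
        · rw [sum_dep_expand dep _ _ _ hl2 hdep] at a9
          have h24 : (2 * J + 21) * B = 2 * (J * B) + 21 * B := by ring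
          rw [← hJ, h24] at c1
          rw [Nat.add_mul]
          omega

end Visit

/-! ### Sequences of queries -/

section Serve

variable {α : Type u} {N M B : ℕ}

/-- The program. -/
def prog (N M B : ℕ) : Program (M + 21) ((N + 2) ^ 20) :=
  implement (by omega) (capac M B) (fun β => algStep N M B β)

/-- The state that the initial memory represents. -/
def initSt (α : Type u) (B : ℕ) : St α B :=
  ⟨0, ⟨0, 0, 0, 0, 0⟩, 0, 0, 0, 0, 0, 0, 0, [], [], [], fun _ => .num 0⟩

theorem repr_initial {cp R : ℕ} (A : Fin N → α) :
    Repr cp (.num 0) (initSt α B) (initial R B A).mem := by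
  refine ⟨.num 0, fun c => ?_⟩
  show Word.num 0 = _
  unfold encode initSt
  split_ifs <;> try rfl
  · simp only [St.ctl]
    have : ∀ k, ([0, 0, 0, 0, 0, 0, 0, 0, 0, 0, 0, 0, 0] : List ℕ).getD k 0 = 0 := by
      intro k
      by_cases hk : k < 13
      · interval_cases k <;> rfl
      · rw [List.getD_eq_default]; simpa using hk
    rw [this]

theorem bd_initSt : Bd N M (initSt α B) := by
  refine ⟨?_, by simp [initSt], by simp [initSt], by simp [initSt], by simp [initSt]⟩
  simp [initSt, St.ctl]

theorem fileAt_initial {R : ℕ} (A : Fin N → α) :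
    FileAt (initial R B A).disk (fun i => i) (List.ofFn A) := by
  intro i _
  funext j
  show (if h : i * B + j.val < N then Word.key (A ⟨i * B + j.val, h⟩) else .num 0) = _
  unfold keyBlock areaKey
  have hj := j.2
  by_cases h : i * B + j.val < N
  · rw [dif_pos h, dif_pos (by simp; omega)]
    simp
  · rw [dif_neg h, dif_neg (by simp; omega)]

theorem countP_ofFn (A : Fin N → α) (p : α → Prop) [DecidablePred p] :
    (List.ofFn A).countP (fun x => decide (p x))
      = (Finset.univ.filter fun i => p (A i)).card := by
  rw [List.ofFn_eq_map, List.countP_map, Finset.card_def, Finset.filter_val,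
    ← Multiset.countP_eq_card_filter, Fin.univ_def, Multiset.coe_countP]
  rfl

variable [LinearOrder α]

/-- An invariant of the states between queries. -/
theorem servesAll_of_invariant (hBM : B ≤ M) (A : Fin N → α)
    (I : List ℕ → ℕ → St α B → (ℕ → Fin B → Word α) → Prop)
    (hI : ∀ ps T s d, I ps T s d → Bd N M s)
    (step : ∀ (Q : Query α N) ps T s d, I ps T s d → ∃ t s' d',
      Answers (algStep N M B α dle) (wMax N) (capac M B) Q.word s d t (Q.correct A) s' d' ∧
      I (Q.pos A :: ps) (T + t) s' d')
    (qs : List (Query α N)) (ps : List ℕ) (T : ℕ) (q : Word α) (s : St α B)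
    (cfg : Config α (M + 21) B) (hr : Repr (capac M B) q s cfg.mem) (h : I ps T s cfg.disk) :
    ∃ t s' d', ServesAll (prog N M B) cfg qs (qs.map (Query.correct A)) t ∧
      I ((qs.map (Query.pos A)).reverse ++ ps) (T + t) s' d' := by
  induction qs generalizing ps T q s cfg with
  | nil => exact ⟨0, s, cfg.disk, .nil cfg, h⟩
  | cons Q qs ih =>
    obtain ⟨t, s', d', ha, hi⟩ := step Q ps T s cfg.disk h
    have hb := hI _ _ _ _ h
    obtain ⟨mem', hr', hs⟩ := Answers.serves (R := M + 21) (by omega)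
      (by unfold capac; omega) (natural_algStep N M B) (hr.receive Q) hb.piv_len hb.pool_len
      hb.nums_len ha
    obtain ⟨t2, s2, d2, h2, i2⟩ := ih (Q.pos A :: ps) (T + t) Q.word s' ⟨mem', d'⟩ hr' hi
    refine ⟨t + t2, s2, d2, .cons _ _ Q qs _ _ t t2 hs h2, ?_⟩
    rw [List.map_cons, List.reverse_cons, List.append_assoc, List.singleton_append, ← Nat.add_assoc]
    exact i2

theorem qpos_ofFn (A : Fin N → α) (Q : Query α N) : qpos Q.word 0 (List.ofFn A) = Q.pos A := by
  cases Q with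
  | select i => rfl
  | search p =>
    simp only [qpos, Query.word, Query.pos, searchPos, countP_ofFn A (· < p), List.mem_ofFn,
      Nat.zero_add]

theorem qvalid_ofFn (A : Fin N → α) (Q : Query α N) : QValid Q.word 0 (List.ofFn A) := by
  cases Q with
  | select i => simp only [QValid, Query.word, List.length_ofFn]; omega
  | search p => trivial

theorem isAnswer_ofFn (A : Fin N → α) (Q : Query α N) {w : Word α}
    (h : IsAnswer Q.word 0 (List.ofFn A) w) : w = Q.correct A := by
  cases Q with
  | search p =>
    have h1 : w = .num (qpos (Query.search (N := N) p).word 0 (List.ofFn A)) := h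
    rw [h1, qpos_ofFn]
    rfl
  | select i =>
    obtain ⟨x, _, rfl, h1, h2⟩ := h
    have hp : List.Perm (List.ofFn (A ∘ Tuple.sort A)) (List.ofFn A) :=
      Equiv.Perm.ofFn_comp_perm (Tuple.sort A) A
    have hs : (List.ofFn (A ∘ Tuple.sort A)).Pairwise (· ≤ ·) := by
      rw [List.pairwise_ofFn]
      exact fun a b hab => Tuple.monotone_sort A hab.le
    rw [← hp.countP_eq] at h1 h2
    have hi : i.val < (List.ofFn (A ∘ Tuple.sort A)).length := by simp
    have e1 := lt_countP_iff hs (down_lt x) i.val hi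
    have e2 := lt_countP_iff hs (down_le x) i.val hi
    simp only [List.getElem_ofFn, Function.comp_apply, Fin.eta, decide_eq_true_eq] at e1 e2
    have h3 : ¬ A (Tuple.sort A i) < x := fun h => by
      have := e1.2 h
      omega
    have h4 : A (Tuple.sort A i) ≤ x := e2.1 (by omega)
    show Word.key x = .key (A (Tuple.sort A i))
    rw [le_antisymm h4 (not_lt.1 h3)]

end Serve

section Regimes

variable {α : Type u} [LinearOrder α] {N M B : ℕ}

/-- An array that fits into one block is read once. -/
theorem serve_resident (hBM : B ≤ M) (hNB : N ≤ B) (A : Fin N → α) (qs : List (Query α N)) :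
    ∃ t, ServesAll (prog N M B) (initial (M + 21) B A) qs (qs.map (Query.correct A)) t ∧
      t ≤ 1 ∧ t ≤ qs.length := by
  have hB : N ≠ 0 → 0 < B := by omega
  refine Exists.elim (servesAll_of_invariant hBM A
    (fun ps T s d => Bd N M s ∧ s.pc = 0 ∧ T ≤ ps.length ∧
      (s.ld = 0 ∧ T = 0 ∧ d = (initial (M + 21) B A).disk ∨
        s.ld = 1 ∧ T ≤ 1 ∧ (keysOf s.buf).take N = List.ofFn A))
    (fun _ _ _ _ h => h.1) ?_ qs [] 0 (.num 0) (initSt α B) (initial (M + 21) B A)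
    (repr_initial A) ⟨bd_initSt, rfl, le_rfl, .inl ⟨rfl, rfl, rfl⟩⟩) ?_
  · rintro Q ps T s d ⟨hbd, hpc, hT, hcase⟩
    have hans := isAnswer_leaf (qvalid_ofFn A Q)
    have hnum : ∀ k, leafAnswer dle Q.word 0 (List.ofFn A) = .num k → k < wMax N := by
      intro k hk
      have h1 := hans.num_le (qvalid_ofFn A Q) hk
      have h2 := add_lt_wMax N
      rw [List.length_ofFn] at h1
      omega
    have hctl := hbd.ctl
    simp only [St.ctl, List.mem_cons, List.not_mem_nil, or_false, forall_eq_or_imp, forall_eq]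
      at hctl
    rcases hcase with ⟨hld, hT0, hd⟩ | ⟨hld, hT1, hbuf⟩
    · have st1 : algStep N M B α dle Q.word s
          = ({ s with pc := 2, nd := ⟨0, 0, 0, 0, N⟩ }, .read 0) := by
        unfold algStep
        rw [hpc]
        show startStep N M dle Q.word s = _
        unfold startStep
        rw [if_pos hNB, if_neg (by omega)]
      have b1 : Bd N M { s with pc := 2, nd := ⟨0, 0, 0, 0, N⟩ } := by
        refine ⟨?_, hbd.nums, hbd.piv_len, hbd.pool_len, hbd.nums_len⟩
        simp only [St.ctl, List.mem_cons, List.not_mem_nil, or_false, forall_eq_or_imp, forall_eq]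
        omega
      have g1 := goes_read (d := d) st1 zero_lt_wMax b1 rfl
      have hxs : (keysOf (d 0)).take N = List.ofFn A := by
        rcases Nat.eq_zero_or_pos N with h | h
        · subst h; simp
        · have := fileAt_initial (R := M + 21) (B := B) A 0 (by simpa using h)
          have hb : (List.ofFn A).take B = List.ofFn A := List.take_of_length_le (by simpa using hNB)
          rw [hd, this, Nat.zero_mul, List.drop_zero, hb, keysOf_keyBlock _ (by simpa using hNB)]
          exact List.take_of_length_le (by simp)
      set s1 : St α B := { s with pc := 2, nd := ⟨0, 0, 0, 0, N⟩, buf := d 0 } with hs1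
      have st2 : algStep N M B α dle Q.word s1 = ({ s1 with pc := 0, ld := 1 },
          .answer (leafAnswer dle Q.word 0 (List.ofFn A))) := by
        show leafStep N dle Q.word s1 = _
        unfold leafStep
        rw [if_pos hNB]
        simp only [hs1, hxs]
      have b2 : Bd N M { s1 with pc := 0, ld := 1 } := by
        refine ⟨?_, hbd.nums, hbd.piv_len, hbd.pool_len, hbd.nums_len⟩
        simp only [hs1, St.ctl, List.mem_cons, List.not_mem_nil, or_false, forall_eq_or_imp,
          forall_eq]
        omega
      refine ⟨1, _, d, ⟨s1, g1, ?_, b2.fits (.inl rfl), ?_⟩, b2, rfl, ?_, .inr ⟨rfl, by omega, hxs⟩⟩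
      · rw [st2, isAnswer_ofFn A Q hans]
      · rw [← isAnswer_ofFn A Q hans]; exact hnum
      · simp only [List.length_cons]; omega
    · have st1 : algStep N M B α dle Q.word s
          = (s, .answer (leafAnswer dle Q.word 0 (List.ofFn A))) := by
        unfold algStep
        rw [hpc]
        show startStep N M dle Q.word s = _
        unfold startStep
        rw [if_pos hNB, if_pos hld, hbuf]
      refine ⟨0, s, d, ⟨s, .refl _ _, ?_, hbd.fits (.inl rfl), ?_⟩, hbd, hpc, ?_,
        .inr ⟨hld, hT1, hbuf⟩⟩
      · rw [st1, isAnswer_ofFn A Q hans]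
      · rw [← isAnswer_ofFn A Q hans]; exact hnum
      · simp only [List.length_cons]; omega
  · rintro t ⟨s', d', h1, h2⟩
    refine ⟨t, h1, ?_, ?_⟩
    · rcases h2.2.2.2 with h | h <;> omega
    · have := h2.2.2.1
      simpa using this

/-- The search tree. -/
theorem serve_tree (hBM : B ≤ M) (hg : Good N M B) (hNB : B < N) (A : Fin N → α)
    (qs : List (Query α N)) :
    ∃ (t : ℕ) (dep : ℕ → ℕ),
      ServesAll (prog N M B) (initial (M + 21) B A) qs (qs.map (Query.correct A)) t ∧
      (∀ x k, k < dep x → ∃ p ∈ qs.map (Query.pos A), ((x - p) + (p - x)) * gFac M B ^ k ≤ N ∧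
        B * gFac M B ^ k ≤ N) ∧
      t * B ≤ qs.length * ((Nat.log (gFac M B) N + 2) * (24 * (topLev N M B + 1) * B)) +
        17 * ∑ x ∈ Finset.range N, dep x := by
  have hB16 := hg.1
  refine Exists.elim (servesAll_of_invariant hBM A
    (fun ps T s d => Bd N M s ∧ s.pc = 0 ∧ ∃ dep : ℕ → ℕ,
      Rep N M d dep ⟨0, 0, 0, 0, N⟩ (List.ofFn A) ∧
      (∀ x k, k < dep x → ∃ p ∈ ps, ((x - p) + (p - x)) * gFac M B ^ k ≤ N ∧
        B * gFac M B ^ k ≤ N) ∧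
      T * B ≤ ps.length * ((Nat.log (gFac M B) N + 2) * (24 * (topLev N M B + 1) * B)) +
        17 * ∑ x ∈ Finset.range N, dep x)
    (fun _ _ _ _ h => h.1) ?_ qs [] 0 (.num 0) (initSt α B) (initial (M + 21) B A)
    (repr_initial A) ⟨bd_initSt, rfl, fun _ => 0, ?_, by simp, by simp⟩) ?_
  · rintro Q ps T s d ⟨hbd, hpc, dep, hrep, hdep, hT⟩
    have hctl := hbd.ctl
    simp only [St.ctl, List.mem_cons, List.not_mem_nil, or_false, forall_eq_or_imp, forall_eq]
      at hctl
    have st : algStep N M B α dle Q.word s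
        = enterNode N M { s with nd := ⟨0, 0, 0, 0, N⟩ } := by
      unfold algStep
      rw [hpc]
      show startStep N M dle Q.word s = _
      unfold startStep
      rw [if_neg (by omega), if_pos hg, hpc]
    have b1 : Bd N M { s with nd := ⟨0, 0, 0, 0, N⟩ } := by
      refine ⟨?_, hbd.nums, hbd.piv_len, hbd.pool_len, hbd.nums_len⟩
      simp only [St.ctl, List.mem_cons, List.not_mem_nil, or_false, forall_eq_or_imp, forall_eq]
      omega
    obtain ⟨t, w, s', d', dep', a1, a2, a3, a4, a5, a6, a7, a8, a9⟩ := visits (q := Q.word) hg hNB N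
      (d := d) (dep := dep) (xs := List.ofFn A) (s₀ := s)
      (s := { s with nd := ⟨0, 0, 0, 0, N⟩ }) rfl st rfl b1 ⟨by simp, by simp, by simp, by simp⟩
      (by simp) (by simp) hrep (qvalid_ofFn A Q)
    rw [isAnswer_ofFn A Q a2] at a1
    refine ⟨t, s', d', a1, a4, a3, dep', a5, ?_, ?_⟩
    · intro x k hk
      rcases a8 x k hk with h | h
      · obtain ⟨p, hp, h'⟩ := hdep x k h
        exact ⟨p, List.mem_cons_of_mem _ hp, h'⟩
      · refine ⟨Q.pos A, List.mem_cons_self, ?_⟩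
        rw [← qpos_ofFn]
        exact h
    · rw [List.length_cons, Nat.succ_mul, Nat.add_mul]
      simp only [Nat.sub_zero] at a9
      omega
  · refine .unexp _ _ (by simp) ?_ ?_ (by simp)
    · exact fileAt_initial A
    · intro l p c _
      have : N ≤ adr N 3 l p c (topLev N M B) 0 := by unfold adr; omega
      have h2 : adr N 3 l p c (topLev N M B) 0 ≤ adr N 3 l p c (topLev N M B) 0 * B :=
        Nat.le_mul_of_pos_right _ (by omega)
      unfold wordAt initial
      split_ifs
      · simp only at *
        rw [dif_neg (by omega)]
        rfl
      · rfl
  · rintro t ⟨s', d', h1, h2⟩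
    obtain ⟨_, _, dep, _, h3, h4⟩ := h2
    refine ⟨t, dep, h1, ?_, by simpa using h4⟩
    intro x k hk
    simpa using h3 x k hk

end Regimes

section Brute

variable {α : Type u} [LinearOrder α] {N M B : ℕ} {q : Word α}

/-- What is done at the end of a scan of the array `xs` for the candidate `x`. -/
def scanEnd (N : ℕ) (q : Word α) (xs : List α) (x : α) (i : ℕ) (s : St α B) : St α B × Cmd α :=
  match q with
  | .key _ => ({ s with pc := 0 },
      .answer (.num (xs.countP (fun y => decide (y < x)) +
        if xs.countP (fun y => decide (y < x)) < xs.countP (fun y => decide (y ≤ x))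
        then 1 else 0)))
  | .num n =>
    if xs.countP (fun y => decide (y < x)) < n ∧ n ≤ xs.countP (fun y => decide (y ≤ x)) then
      ({ s with pc := 0 }, .answer (.key x))
    else ({ s with pc := 10, i := (i + 1) % N }, .read ((i + 1) % N / B))

/-- The candidate in the buffer. -/
def candidate (q : Word α) (w : Word α) : List α :=
  match q with
  | .num _ => w.key?.toList
  | .key p => [p]

/-- Scanning the array to count the elements below a candidate. -/
theorem goes_scan (hB : 0 < B) {d : ℕ → Fin B → Word α} {xs : List α} {x : α}
    (hN : xs.length = N) (hfile : FileAt d (fun i => i) xs) (s : St α B) (hpc : s.pc = 11)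
    (hpiv : s.piv = [x]) (hbuf : s.buf = d s.o) (ho : s.o * B < N)
    (hnums : s.nums = [(xs.take (s.o * B)).countP (fun y => decide (y < x)),
      (xs.take (s.o * B)).countP (fun y => decide (y ≤ x))]) (hbd : Bd N M s) :
    ∃ t s', Goes N M q s d t s' d ∧ s.o + t ≤ N ∧ Bd N M s' ∧
      algStep N M B α dle q s' = scanEnd N q xs x s.i s' := by
  induction hn : N - s.o * B using Nat.strong_induction_on generalizing s with
  | _ n ih =>
    set blk := (xs.drop (s.o * B)).take B with hblk
    have hkeys : keysOf s.buf = blk := by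
      rw [hbuf, hfile s.o (by omega), keysOf_keyBlock _ (by simp)]
    have hsucc : (s.o + 1) * B = s.o * B + B := Nat.succ_mul _ _
    have htake : xs.take ((s.o + 1) * B) = xs.take (s.o * B) ++ blk := by
      rw [hsucc, List.take_add]
    have hlt : s.nums.getD 0 0 + blk.countP (fun y => [x].any (fun p => ltB dle y p))
        = (xs.take ((s.o + 1) * B)).countP (fun y => decide (y < x)) := by
      rw [hnums, htake, List.countP_append]
      simp
    have hle : s.nums.getD 1 0 + blk.countP (fun y => [x].any (fun p => dle y p))
        = (xs.take ((s.o + 1) * B)).countP (fun y => decide (y ≤ x)) := by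
      rw [hnums, htake, List.countP_append]
      simp
    have hst : algStep N M B α dle q s = bruteStep N dle q s := by
      unfold algStep
      rw [hpc]
      rfl
    have hoN : s.o ≤ s.o * B := Nat.le_mul_of_pos_right _ hB
    by_cases hend : (s.o + 1) * B < N
    · set s1 : St α B :=
        { s with o := s.o + 1, nums := [(xs.take ((s.o + 1) * B)).countP (fun y => decide (y < x)),
          (xs.take ((s.o + 1) * B)).countP (fun y => decide (y ≤ x))] } with hs1
      have st : algStep N M B α dle q s = (s1, .read (s.o + 1)) := by
        rw [hst]
        unfold bruteStep
        simp only [hkeys, hpiv, hlt, hle]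
        rw [if_pos hend]
        simp only [hs1, hpiv]
      have hcl := hbd.nums_len
      rw [hnums] at hcl
      have b1 : Bd N M s1 := by
        have hctl := hbd.ctl
        simp only [St.ctl, List.mem_cons, List.not_mem_nil, or_false, forall_eq_or_imp, forall_eq]
          at hctl
        refine ⟨?_, ?_, hbd.piv_len, hbd.pool_len, hcl⟩
        · simp only [hs1, St.ctl, List.mem_cons, List.not_mem_nil, or_false, forall_eq_or_imp,
            forall_eq]
          omega
        · have hl : ∀ p : α → Bool, (xs.take ((s.o + 1) * B)).countP p ≤ N := fun p =>
            List.countP_le_length.trans (by rw [List.length_take]; omega)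
          simp only [hs1, List.mem_cons, List.not_mem_nil, or_false, forall_eq_or_imp, forall_eq]
          exact ⟨hl _, hl _⟩
      have ha : s.o + 1 < wMax N := by
        have := add_lt_wMax N
        omega
      have g1 := goes_read (d := d) st ha b1 rfl
      obtain ⟨t, s', g2, a1, a4, a5⟩ := ih (N - (s.o + 1) * B) (by omega)
        { s1 with buf := d (s.o + 1) } hpc hpiv rfl hend rfl (b1.set_buf _) rfl
      simp only [hs1] at a1 a5
      exact ⟨1 + t, s', g1.trans g2, by omega, a4, a5⟩
    · have hall : xs.take ((s.o + 1) * B) = xs := List.take_of_length_le (by omega)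
      rw [hall] at hlt hle
      refine ⟨0, s, .refl _ _, by omega, hbd, ?_⟩
      rw [hst]
      unfold bruteStep
      simp only [hkeys, hpiv, hlt, hle]
      rw [if_neg hend]
      cases q <;> simp only [scanEnd, hpiv, areaKey_eq [x] (t := 0) (by simp), List.getElem_cons_zero]

/-- The start of the scan for a candidate. -/
theorem goes_candidate (hB : 0 < B) {d : ℕ → Fin B → Word α} {xs : List α} {x : α}
    (hN : xs.length = N) (hN0 : 0 < N) (hfile : FileAt d (fun i => i) xs) (s : St α B)
    (hpc : s.pc = 10) (hbd : Bd N M s)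
    (hx : candidate q (wordAt s.buf (s.i % B)) = [x]) :
    ∃ t s', Goes N M q s d t s' d ∧ t ≤ N + 1 ∧ Bd N M s' ∧
      algStep N M B α dle q s' = scanEnd N q xs x s.i s' := by
  set s1 : St α B := { s with pc := 11, piv := [x], o := 0, nums := [0, 0] } with hs1
  have st : algStep N M B α dle q s = (s1, .read 0) := by
    unfold algStep
    rw [hpc]
    show candStep q s = _
    unfold candStep
    rw [hs1, ← hx]
    rfl
  have b1 : Bd N M s1 := by
    have hctl := hbd.ctl
    simp only [St.ctl, List.mem_cons, List.not_mem_nil, or_false, forall_eq_or_imp, forall_eq]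
      at hctl
    refine ⟨?_, by simp [hs1], ?_, hbd.pool_len, ?_⟩
    · simp only [hs1, St.ctl, List.mem_cons, List.not_mem_nil, or_false, forall_eq_or_imp,
        forall_eq]
      omega
    · simp [hs1, capac]
    · simp [hs1, capac]
  have g1 := goes_read (d := d) st zero_lt_wMax b1 rfl
  obtain ⟨t, s', g2, a1, a4, a5⟩ := goes_scan (q := q) hB hN hfile
    { s1 with buf := d 0 } rfl rfl rfl (by simp only [hs1]; omega) (by simp [hs1]) (b1.set_buf _)
  simp only [hs1] at a1 a5
  exact ⟨1 + t, s', g1.trans g2, by omega, a4, a5⟩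

theorem countP_lt_countP_le_iff (xs : List α) (p : α) :
    xs.countP (fun y => decide (y < p)) < xs.countP (fun y => decide (y ≤ p)) ↔ p ∈ xs := by
  constructor
  · intro h
    by_contra hp
    refine h.ne ?_
    refine List.countP_congr fun y hy => ?_
    rw [decide_eq_true_eq, decide_eq_true_eq]
    exact ⟨le_of_lt, fun h' => lt_of_le_of_ne h' fun e => hp (e ▸ hy)⟩
  · intro h
    have h1 := countP_add_le (p := fun x => decide (x < p)) (p' := fun x => decide (x = p))
      (r := fun x => decide (x ≤ p)) xs (by
        intro x _ h1 h2
        simp only [decide_eq_true_eq] at h1 h2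
        exact h1.ne h2) (by
        intro x _ h'
        simp only [decide_eq_true_eq] at h' ⊢
        exact h'.elim le_of_lt le_of_eq)
    have h2 : 0 < xs.countP (fun x => decide (x = p)) := by
      rw [List.countP_pos_iff]
      exact ⟨p, h, by simp⟩
    omega

/-- Trying the candidates of a selection one after another. -/
theorem answers_select (hB : 0 < B) {d : ℕ → Fin B → Word α} {xs : List α}
    (hN : xs.length = N) (hfile : FileAt d (fun i => i) xs) {n j : ℕ} (hj : j < xs.length)
    (hj1 : xs.countP (fun y => decide (y < xs[j])) < n)
    (hj2 : n ≤ xs.countP (fun y => decide (y ≤ xs[j]))) (k : ℕ) (s : St α B)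
    (hpc : s.pc = 10) (hi : s.i + k = j) (hbuf : s.buf = d (s.i / B)) (hbd : Bd N M s) :
    ∃ t w s', Answers (algStep N M B α dle) (wMax N) (capac M B) (.num n) s d t w s' d ∧
      IsAnswer (.num n) 0 xs w ∧ s'.pc = 0 ∧ Bd N M s' ∧ t ≤ (k + 1) * (N + 2) := by
  induction k generalizing s with
  | zero =>
    obtain ⟨x, hx⟩ : ∃ x, x = xs[s.i]'(by omega) := ⟨_, rfl⟩
    have hw : wordAt s.buf (s.i % B) = .key x := by
      have hdm := Nat.div_add_mod' s.i B
      have hm := Nat.mod_lt s.i hB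
      rw [hbuf, hfile (s.i / B) (by omega)]
      unfold wordAt keyBlock areaKey
      rw [dif_pos hm]
      simp only
      rw [dif_pos (by simp; omega), hx]
      simp [hdm]
    obtain ⟨t, s1, g1, a1, a4, a5⟩ := goes_candidate (q := .num n) hB hN (by omega)
      hfile s hpc hbd (x := x) (by rw [hw]; rfl)
    have hxj : x = xs[j] := by
      rw [hx]
      congr 1
    rw [hxj] at a5
    simp only [scanEnd] at a5
    rw [if_pos ⟨hj1, hj2⟩] at a5
    refine ⟨t, _, _, ⟨s1, g1, a5, (a4.set_pc 0 (by omega)).fits (.inl rfl), ?_⟩, ?_, rfl,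
      a4.set_pc 0 (by omega), by omega⟩
    · intro k hk
      cases hk
    · exact ⟨xs[j], List.getElem_mem _, rfl, by omega, by omega⟩
  | succ k ih =>
    obtain ⟨x, hx⟩ : ∃ x, x = xs[s.i]'(by omega) := ⟨_, rfl⟩
    have hw : wordAt s.buf (s.i % B) = .key x := by
      have hdm := Nat.div_add_mod' s.i B
      have hm := Nat.mod_lt s.i hB
      rw [hbuf, hfile (s.i / B) (by omega)]
      unfold wordAt keyBlock areaKey
      rw [dif_pos hm]
      simp only
      rw [dif_pos (by simp; omega), hx]
      simp [hdm]
    obtain ⟨t, s1, g1, a1, a4, a5⟩ := goes_candidate (q := .num n) hB hN (by omega)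
      hfile s hpc hbd (x := x) (by rw [hw]; rfl)
    simp only [scanEnd] at a5
    have hmul : (k + 1 + 1) * (N + 2) = (k + 1) * (N + 2) + (N + 2) := Nat.succ_mul _ _
    by_cases hh : xs.countP (fun y => decide (y < x)) < n ∧ n ≤ xs.countP (fun y => decide (y ≤ x))
    · rw [if_pos hh] at a5
      refine ⟨t, _, _, ⟨s1, g1, a5, (a4.set_pc 0 (by omega)).fits (.inl rfl), ?_⟩, ?_, rfl,
        a4.set_pc 0 (by omega), by omega⟩
      · intro k hk
        cases hk
      · refine ⟨x, ?_, rfl, by omega, by omega⟩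
        rw [hx]; exact List.getElem_mem _
    · have hmod : (s.i + 1) % N = s.i + 1 := Nat.mod_eq_of_lt (by omega)
      rw [if_neg hh, hmod] at a5
      have b2 : Bd N M { s1 with pc := 10, i := s.i + 1 } := by
        have hctl := a4.ctl
        simp only [St.ctl, List.mem_cons, List.not_mem_nil, or_false, forall_eq_or_imp, forall_eq]
          at hctl
        refine ⟨?_, a4.nums, a4.piv_len, a4.pool_len, a4.nums_len⟩
        simp only [St.ctl, List.mem_cons, List.not_mem_nil, or_false, forall_eq_or_imp, forall_eq]
        omega
      have ha : (s.i + 1) / B < wMax N := by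
        have h1 := add_lt_wMax N
        have h2 := Nat.div_le_self (s.i + 1) B
        omega
      have g2 := goes_read (d := d) a5 ha b2 rfl
      obtain ⟨t', w, s', h1, h2, h3, h4, h5⟩ := ih
        { s1 with pc := 10, i := s.i + 1, buf := d ((s.i + 1) / B) } rfl (by simp only; omega) rfl
        (b2.set_buf _)
      refine ⟨t + 1 + t', w, s', (g1.trans g2).answers h1, h2, h3, h4, by omega⟩

/-- Brute force. -/
theorem serve_brute (hBM : 2 * B ≤ M) (hB : 0 < B) (hg : ¬ Good N M B) (hNB : B < N) (A : Fin N → α)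
    (qs : List (Query α N)) :
    ∃ t, ServesAll (prog N M B) (initial (M + 21) B A) qs (qs.map (Query.correct A)) t ∧
      t ≤ qs.length * ((N + 2) * (N + 2)) := by
  refine Exists.elim (servesAll_of_invariant (M := M) (by omega) A
    (fun ps T s d => Bd N M s ∧ s.pc = 0 ∧ d = (initial (M + 21) B A).disk ∧
      T ≤ ps.length * ((N + 2) * (N + 2)))
    (fun _ _ _ _ h => h.1) ?_ qs [] 0 (.num 0) (initSt α B) (initial (M + 21) B A)
    (repr_initial A) ⟨bd_initSt, rfl, rfl, by simp⟩) ?_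
  · rintro Q ps T s d ⟨hbd, hpc, hd, hT⟩
    have hfile : FileAt d (fun i => i) (List.ofFn A) := by rw [hd]; exact fileAt_initial A
    have hlen : (List.ofFn A).length = N := List.length_ofFn
    set s1 : St α B := { s with pc := 10, i := 0, o := 0 } with hs1
    have st : algStep N M B α dle Q.word s = (s1, .read 0) := by
      unfold algStep
      rw [hpc]
      show startStep N M dle Q.word s = _
      unfold startStep
      rw [if_neg (by omega), if_neg hg]
    have b1 : Bd N M s1 := by
      have hctl := hbd.ctl
      simp only [St.ctl, List.mem_cons, List.not_mem_nil, or_false, forall_eq_or_imp, forall_eq]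
        at hctl
      refine ⟨?_, hbd.nums, hbd.piv_len, hbd.pool_len, hbd.nums_len⟩
      simp only [hs1, St.ctl, List.mem_cons, List.not_mem_nil, or_false, forall_eq_or_imp,
        forall_eq]
      omega
    have g1 := goes_read (d := d) st zero_lt_wMax b1 rfl
    suffices h : ∃ t w s', Answers (algStep N M B α dle) (wMax N) (capac M B) Q.word s d t w s' d ∧
        IsAnswer Q.word 0 (List.ofFn A) w ∧ s'.pc = 0 ∧ Bd N M s' ∧ t ≤ (N + 2) * (N + 2) by
      obtain ⟨t, w, s', h1, h2, h3, h4, h5⟩ := h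
      rw [isAnswer_ofFn A Q h2] at h1
      refine ⟨t, s', d, h1, h4, h3, hd, ?_⟩
      rw [List.length_cons, Nat.succ_mul]
      omega
    cases Q with
    | select i =>
      have hans := isAnswer_leaf (qvalid_ofFn A (.select i))
      obtain ⟨x, hx, _, hx1, hx2⟩ := hans
      obtain ⟨j, hj, rfl⟩ := List.getElem_of_mem hx
      obtain ⟨t, w, s', h1, h2, h3, h4, h5⟩ := answers_select (n := i.val + 1) hB hlen hfile hj
        (by omega) (by omega) j { s1 with buf := d 0 } rfl (by simp [hs1]) (by simp [hs1])
        (b1.set_buf _)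
      refine ⟨1 + t, w, s', g1.answers h1, h2, h3, h4, ?_⟩
      have : (j + 1) * (N + 2) ≤ N * (N + 2) := Nat.mul_le_mul_right _ (by omega)
      have h6 : (N + 2) * (N + 2) = N * (N + 2) + 2 * (N + 2) := Nat.add_mul _ _ _
      omega
    | search p =>
      obtain ⟨t, s2, g2, a1, a4, a5⟩ := goes_candidate (q := (.key p : Word α)) hB hlen
        (by omega) hfile { s1 with buf := d 0 } rfl (b1.set_buf _) (x := p) rfl
      have hw : IsAnswer (.key p) 0 (List.ofFn A)
          (.num ((List.ofFn A).countP (fun y => decide (y < p)) +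
            if (List.ofFn A).countP (fun y => decide (y < p)) <
              (List.ofFn A).countP (fun y => decide (y ≤ p)) then 1 else 0)) := by
        simp only [IsAnswer, qpos, countP_lt_countP_le_iff, Nat.zero_add]
      refine ⟨1 + t, _, _, (g1.trans g2).answers (t' := 0) ⟨s2, .refl _ _, a5,
        (a4.set_pc 0 (by omega)).fits (.inl rfl), fun k hk => ?_⟩, hw, rfl,
        a4.set_pc 0 (by omega), ?_⟩
      · have h1 := hw.num_le trivial hk
        have h2 := add_lt_wMax N
        omega
      · nlinarith
  · rintro t ⟨s', d', h1, _, _, _, h2⟩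
    exact ⟨t, h1, by simpa using h2⟩

end Brute

/-! ### The sum of the depths -/

section Analysis

open Real Finset

theorem sum_log_add_one (n : ℕ) : ∑ j ∈ range n, log ((j : ℝ) + 1) = log (n.factorial : ℝ) := by
  induction n with
  | zero => simp
  | succ n ih =>
    rw [sum_range_succ, ih, Nat.factorial_succ, Nat.cast_mul,
      log_mul (by positivity) (by positivity)]
    push_cast
    ring

theorem sum_log_div_le (n : ℕ) : ∑ j ∈ range n, log ((n : ℝ) / ((j : ℝ) + 1)) ≤ n := by
  rcases Nat.eq_zero_or_pos n with rfl | hn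
  · simp
  · have hn' : (0 : ℝ) < n := by exact_mod_cast hn
    have h1 : ∑ j ∈ range n, log ((n : ℝ) / ((j : ℝ) + 1)) = log ((n : ℝ) ^ n / n.factorial) := by
      rw [log_div (by positivity) (by positivity), ← sum_log_add_one, log_pow]
      have e : ∀ j ∈ range n, log ((n : ℝ) / ((j : ℝ) + 1)) = log n - log ((j : ℝ) + 1) :=
        fun (j : ℕ) _ => log_div hn'.ne' (by positivity)
      rw [sum_congr rfl e, sum_sub_distrib]
      simp
    rw [h1, log_le_iff_le_exp (by positivity)]
    exact pow_div_factorial_le_exp _ hn'.le _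

theorem sum_log_div_max_le (n : ℕ) :
    ∑ j ∈ range n, log ((n : ℝ) / max (j : ℝ) 1) ≤ 2 * n := by
  rcases n with _ | n
  · simp
  · rw [sum_range_succ']
    have h1 := sum_log_div_le (n + 1)
    rw [sum_range_succ, Nat.cast_add_one, div_self (by positivity), log_one, add_zero] at h1
    have h2 : log (((n + 1 : ℕ) : ℝ) / max ((0 : ℕ) : ℝ) 1) ≤ (n + 1 : ℕ) := by
      rw [Nat.cast_zero, max_eq_right zero_le_one, div_one]
      exact (log_le_sub_one_of_pos (by positivity)).trans (by simp)
    have h3 : ∑ j ∈ range n, log (((n + 1 : ℕ) : ℝ) / max ((j + 1 : ℕ) : ℝ) 1)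
        = ∑ j ∈ range n, log (((n + 1 : ℕ) : ℝ) / ((j : ℝ) + 1)) := by
      refine sum_congr rfl fun j _ => ?_
      rw [max_eq_left]
      · push_cast; rfl
      · push_cast
        linarith [(Nat.cast_nonneg j : (0 : ℝ) ≤ j)]
    push_cast at *
    linarith

theorem sum_log_div_sub_le (n : ℕ) :
    ∑ j ∈ range n, log ((n : ℝ) / ((n : ℝ) - j)) ≤ n := by
  refine le_of_eq_of_le ?_ (sum_log_div_le n)
  rw [← sum_range_reflect]
  refine sum_congr rfl fun j hj => ?_
  rw [mem_range] at hj
  have : ((n - 1 - j : ℕ) : ℝ) = (n : ℝ) - 1 - j := by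
    rw [Nat.cast_sub (by omega), Nat.cast_sub (by omega)]
    simp
  rw [this]
  congr 2
  ring

/-- The bound for the sum of the depths in a gap. -/
noncomputable def gapBound (N M B : ℕ) (g : ℝ) (Δ : ℕ) : ℝ :=
  4 * Δ + Δ * (log ((N : ℝ) / B) - if Δ < M then 0 else log ((Δ : ℝ) / B)) / log g

variable {N M B g : ℕ} {dep : ℕ → ℕ} {l : List ℕ}

theorem dep_mul_log_le (hB : 0 < B) (hBN : B ≤ N) (hg : 3 ≤ g)
    (hdep : ∀ x k, k < dep x → ∃ p ∈ l, ((x - p) + (p - x)) * g ^ k ≤ N ∧ B * g ^ k ≤ N) (x : ℕ) :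
    ∃ k : ℕ, dep x ≤ k + 1 ∧ k * log g ≤ log ((N : ℝ) / B) ∧
      (k = 0 ∨ ∃ p ∈ l, ((x - p) + (p - x)) * g ^ k ≤ N) := by
  have hg' : (0 : ℝ) < g := by exact_mod_cast (by omega : 0 < g)
  have hB' : (0 : ℝ) < B := by exact_mod_cast hB
  have hN' : (0 : ℝ) < N := by exact_mod_cast (by omega : 0 < N)
  rcases hd : dep x with _ | k
  · refine ⟨0, by omega, ?_, .inl rfl⟩
    rw [Nat.cast_zero, zero_mul]
    apply log_nonneg
    rw [one_le_div hB']
    exact_mod_cast hBN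
  · obtain ⟨p, hp, h1, h2⟩ := hdep x k (by omega)
    refine ⟨k, by omega, ?_, .inr ⟨p, hp, h1⟩⟩
    rw [← log_pow]
    apply log_le_log (by positivity)
    rw [le_div_iff₀ hB', mul_comm]
    exact_mod_cast h2

theorem sum_dep_gap_le (hB : 0 < B) (hBN : B ≤ N) (hg : 3 ≤ g)
    (hdep : ∀ x k, k < dep x → ∃ p ∈ l, ((x - p) + (p - x)) * g ^ k ≤ N ∧ B * g ^ k ≤ N)
    {a b : ℕ} (hab : a ≤ b) (hbN : b ≤ N) (hl : ∀ p ∈ l, p ≤ a ∨ b ≤ p) :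
    ∑ x ∈ Ico a b, (dep x : ℝ) ≤ gapBound N M B g (b - a) := by
  have hg' : (0 : ℝ) < g := by exact_mod_cast (by omega : 0 < g)
  have hB' : (0 : ℝ) < B := by exact_mod_cast hB
  have hN' : (0 : ℝ) < N := by exact_mod_cast (by omega : 0 < N)
  have hlg : 1 ≤ log g := by
    rw [le_log_iff_exp_le hg']
    have h3 : (3 : ℝ) ≤ g := by exact_mod_cast hg
    linarith [exp_one_lt_d9]
  have hlg0 : 0 < log g := by linarith
  set Δ := b - a with hΔ
  rw [sum_Ico_eq_sum_range]
  unfold gapBound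
  by_cases hM : Δ < M
  · rw [if_pos hM, sub_zero]
    have hpt : ∀ j ∈ range (b - a), (dep (a + j) : ℝ) ≤ 1 + log ((N : ℝ) / B) / log g := by
      intro j _
      obtain ⟨k, h1, h2, _⟩ := dep_mul_log_le hB hBN hg hdep (a + j)
      have h3 : (dep (a + j) : ℝ) ≤ k + 1 := by exact_mod_cast h1
      have h4 : (k : ℝ) ≤ log ((N : ℝ) / B) / log g := by rwa [le_div_iff₀ hlg0]
      linarith
    refine (sum_le_card_nsmul _ _ _ hpt).trans ?_
    rw [card_range, nsmul_eq_mul, ← hΔ]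
    have : (0 : ℝ) ≤ Δ := Nat.cast_nonneg _
    rw [mul_add, mul_one, mul_div_assoc]
    linarith
  · rw [if_neg hM]
    rcases Nat.eq_zero_or_pos Δ with h0 | h0
    · rw [← hΔ, h0]; simp
    · have hΔ' : (0 : ℝ) < Δ := by exact_mod_cast h0
      have hΔN : (Δ : ℝ) ≤ N := by exact_mod_cast (by omega : Δ ≤ N)
      have hpt : ∀ j ∈ range Δ, (dep (a + j) : ℝ) ≤ 1 + (log ((N : ℝ) / Δ) +
          log ((Δ : ℝ) / max (j : ℝ) 1) + log ((Δ : ℝ) / ((Δ : ℝ) - j))) / log g := by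
        intro j hj
        rw [mem_range] at hj
        obtain ⟨k, h1, h2, h5⟩ := dep_mul_log_le hB hBN hg hdep (a + j)
        have h3 : (dep (a + j) : ℝ) ≤ k + 1 := by exact_mod_cast h1
        have hjr : (j : ℝ) + 1 ≤ Δ := by exact_mod_cast hj
        have hj0 : (0 : ℝ) ≤ j := Nat.cast_nonneg _
        have p1 : 0 ≤ log ((N : ℝ) / Δ) := log_nonneg ((one_le_div hΔ').2 hΔN)
        have hmax : 0 < max (j : ℝ) 1 := lt_max_of_lt_right one_pos
        have p2 : 0 ≤ log ((Δ : ℝ) / max (j : ℝ) 1) := by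
          refine log_nonneg ((one_le_div hmax).2 (max_le (by linarith) (by linarith)))
        have p3 : 0 ≤ log ((Δ : ℝ) / ((Δ : ℝ) - j)) :=
          log_nonneg ((one_le_div (by linarith)).2 (by linarith))
        suffices h4 : (k : ℝ) * log g ≤ log ((N : ℝ) / Δ) +
            log ((Δ : ℝ) / max (j : ℝ) 1) + log ((Δ : ℝ) / ((Δ : ℝ) - j)) by
          have : (k : ℝ) ≤ (log ((N : ℝ) / Δ) +
            log ((Δ : ℝ) / max (j : ℝ) 1) + log ((Δ : ℝ) / ((Δ : ℝ) - j))) / log g := by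
            rwa [le_div_iff₀ hlg0]
          linarith
        have hcomb : ∀ c : ℝ, 0 < c → log ((N : ℝ) / Δ) + log ((Δ : ℝ) / c) = log (N / c) := by
          intro c hc
          rw [log_div hN'.ne' hΔ'.ne', log_div hΔ'.ne' hc.ne', log_div hN'.ne' hc.ne']
          ring
        rcases h5 with rfl | ⟨p, hp, h5⟩
        · rw [Nat.cast_zero, zero_mul]; linarith
        · have key : ∀ c : ℕ, 0 < c → c ≤ (a + j - p) + (p - (a + j)) →
              (k : ℝ) * log g ≤ log ((N : ℝ) / c) := by
            intro c hc hcp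
            have hc' : (0 : ℝ) < c := by exact_mod_cast hc
            rw [← log_pow]
            apply log_le_log (by positivity)
            rw [le_div_iff₀ hc', mul_comm]
            exact_mod_cast (Nat.mul_le_mul_right _ hcp).trans h5
          rcases hl p hp with h | h
          · rcases Nat.eq_zero_or_pos j with rfl | hjp
            · have := hcomb 1 one_pos
              rw [Nat.cast_zero, max_eq_right zero_le_one, this]
              have h6 : log ((N : ℝ) / B) ≤ log ((N : ℝ) / 1) := by
                apply log_le_log (by positivity)
                apply div_le_div_of_nonneg_left hN'.le one_pos
                exact_mod_cast hB
              rw [Nat.cast_zero] at p3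
              linarith
            · have h6 := key j hjp (by omega)
              have hj1 : (1 : ℝ) ≤ j := by exact_mod_cast hjp
              rw [max_eq_left hj1, hcomb j (by linarith)]
              linarith
          · have h6 := key (Δ - j) (by omega) (by omega)
            rw [Nat.cast_sub hj.le] at h6
            have := hcomb ((Δ : ℝ) - j) (by linarith)
            linarith
      refine (sum_le_sum hpt).trans ?_
      rw [sum_add_distrib, ← sum_div, sum_add_distrib, sum_add_distrib]
      simp only [sum_const, card_range, nsmul_eq_mul, mul_one]
      have s1 := sum_log_div_max_le Δ
      have s2 := sum_log_div_sub_le Δ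
      have e1 : log ((N : ℝ) / Δ) = log ((N : ℝ) / B) - log ((Δ : ℝ) / B) := by
        rw [log_div hN'.ne' hΔ'.ne', log_div hN'.ne' hB'.ne', log_div hΔ'.ne' hB'.ne']
        ring
      rw [e1, add_assoc, add_div]
      have s3 : (∑ j ∈ range Δ, log ((Δ : ℝ) / max (j : ℝ) 1) +
          ∑ j ∈ range Δ, log ((Δ : ℝ) / ((Δ : ℝ) - j))) / log g ≤ 3 * Δ := by
        rw [div_le_iff₀ hlg0]
        nlinarith
      linarith

theorem sum_Ico_le_gaps {f : ℕ → ℝ} {G : ℕ → ℝ} {L : List ℕ}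
    (hG : ∀ a b, a ≤ b → b ≤ N → (∀ p ∈ L, p ≤ a ∨ b ≤ p) → ∑ x ∈ Ico a b, f x ≤ G (b - a))
    (a : ℕ) (l : List ℕ) (hs : (a :: l).Pairwise (· ≤ ·)) (hN : ∀ x ∈ a :: l, x ≤ N)
    (hmem : N ∈ a :: l) (hL : ∀ p ∈ L, p ≤ a ∨ p ∈ l) :
    ∑ x ∈ Ico a N, f x ≤
      ((List.zipWith (fun a b => b - a) (a :: l) (a :: l).tail).map G).sum ∧
    (List.zipWith (fun a b => b - a) (a :: l) (a :: l).tail).sum + a = N := by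
  induction l generalizing a with
  | nil =>
    simp only [List.mem_singleton] at hmem
    subst hmem
    simp
  | cons b l ih =>
    rw [List.pairwise_cons] at hs
    have hab : a ≤ b := hs.1 b List.mem_cons_self
    have hbN : b ≤ N := hN b (by simp)
    have hs2 := List.pairwise_cons.1 hs.2
    obtain ⟨i1, i2⟩ := ih b hs.2 (fun x hx => hN x (List.mem_cons_of_mem _ hx)) (by
      rcases List.mem_cons.1 hmem with h | h
      · have : b = N := by omega
        rw [this]; exact List.mem_cons_self
      · exact h) (by
      intro p hp
      rcases hL p hp with h | h
      · exact .inl (h.trans hab)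
      · rcases List.mem_cons.1 h with rfl | h
        · exact .inl le_rfl
        · exact .inr h)
    have h1 := hG a b hab hbN (by
      intro p hp
      rcases hL p hp with h | h
      · exact .inl h
      · rcases List.mem_cons.1 h with rfl | h
        · exact .inr le_rfl
        · exact .inr (hs2.1 p h))
    simp only [List.tail_cons, List.zipWith_cons_cons, List.map_cons, List.sum_cons] at i1 i2 ⊢
    rw [← sum_Ico_consecutive f hab hbN]
    exact ⟨by linarith, by omega⟩

end Analysis

/-! ### The bound in terms of the gaps -/

section GapBound

open Real Finset

variable {N M B g : ℕ} {dep : ℕ → ℕ} {pos : List ℕ}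

theorem exists_sum_Ico_le_gaps (hN : 1 ≤ N) (hpos : ∀ p ∈ pos, p ≤ N) {f G : ℕ → ℝ}
    (hG : ∀ a b, a ≤ b → b ≤ N → (∀ p ∈ pos, p ≤ a ∨ b ≤ p) → ∑ x ∈ Ico a b, f x ≤ G (b - a)) :
    ∃ a ≤ 1, ∑ x ∈ Ico a N, f x ≤ ((gaps N pos).map G).sum ∧ (gaps N pos).sum + a = N := by
  have hmem : ∀ x, x ∈ (1 :: N :: pos).insertionSort (· ≤ ·) ↔ x = 1 ∨ x = N ∨ x ∈ pos := by
    intro x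
    rw [List.mem_insertionSort]
    simp
  have hs : ((1 :: N :: pos).insertionSort (· ≤ ·)).Pairwise (· ≤ ·) :=
    List.pairwise_insertionSort _ _
  unfold gaps
  generalize (1 :: N :: pos).insertionSort (· ≤ ·) = s at hmem hs ⊢
  rcases s with _ | ⟨a, l⟩
  · exact absurd ((hmem 1).2 (.inl rfl)) List.not_mem_nil
  · have ha : a ≤ 1 := by
      rcases List.mem_cons.1 ((hmem 1).2 (.inl rfl)) with h | h
      · exact h.ge
      · exact (List.pairwise_cons.1 hs).1 _ h
    refine ⟨a, ha, sum_Ico_le_gaps hG a l hs ?_ ((hmem N).2 (.inr (.inl rfl))) ?_⟩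
    · intro x hx
      rcases (hmem x).1 hx with rfl | rfl | h
      exacts [hN, le_rfl, hpos x h]
    · intro p hp
      rcases List.mem_cons.1 ((hmem p).2 (.inr (.inr hp))) with rfl | h
      exacts [.inl le_rfl, .inr h]

theorem sum_gaps_le (hN : 1 ≤ N) (hpos : ∀ p ∈ pos, p ≤ N) : (gaps N pos).sum ≤ N := by
  obtain ⟨a, _, _, h⟩ := exists_sum_Ico_le_gaps (f := fun _ => 0) (G := fun _ => 0) hN hpos
    (by simp)
  omega

theorem div_le_nBlocks (N B : ℕ) : (N : ℝ) / B ≤ nBlocks N B := Nat.le_ceil _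

theorem one_le_nBlocks (hN : 1 ≤ N) (hB : 1 ≤ B) : 1 ≤ nBlocks N B := by
  unfold nBlocks
  have : (0 : ℝ) < (N : ℝ) / B := by positivity
  exact_mod_cast Nat.ceil_pos.2 this

theorem nBlocks_nonneg (N B : ℕ) : 0 ≤ nBlocks N B := Nat.cast_nonneg _

theorem two_le_mBlocks (hB : 1 ≤ B) (hM : 2 * B ≤ M) : 2 ≤ mBlocks M B := by
  unfold mBlocks
  rw [le_div_iff₀ (by positivity)]
  exact_mod_cast hM

theorem sum_gapLog_le (hB : 1 ≤ B) (hM : 2 * B ≤ M) (hBN : B ≤ N) (l : List ℕ)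
    (hl : ∀ Δ ∈ l, Δ ≤ N) :
    (l.map fun Δ : ℕ => (Δ : ℝ) / B * gapLog M B Δ).sum ≤
      (l.sum : ℝ) / B * logb (mBlocks M B) ((N : ℝ) / B) := by
  have hm := two_le_mBlocks hB hM
  have hB' : (0 : ℝ) < B := by exact_mod_cast hB
  have hBN' : (B : ℝ) ≤ N := by exact_mod_cast hBN
  have h0 : 0 ≤ logb (mBlocks M B) ((N : ℝ) / B) :=
    logb_nonneg (by linarith) ((one_le_div hB').2 hBN')
  induction l with
  | nil => simp
  | cons Δ l ih =>
    have h1 := ih fun x hx => hl x (List.mem_cons_of_mem _ hx)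
    rw [List.map_cons, List.sum_cons, List.sum_cons, Nat.cast_add, add_div, add_mul]
    refine add_le_add (mul_le_mul_of_nonneg_left ?_ (by positivity)) h1
    unfold gapLog
    split_ifs with h
    · exact h0
    · have : (0 : ℝ) < Δ := by exact_mod_cast (by omega : 0 < Δ)
      refine logb_le_logb_of_le (by linarith) (by positivity) ?_
      gcongr
      exact hl Δ List.mem_cons_self

theorem nBlocks_mul_logb_nonneg (hB : 1 ≤ B) (hM : 2 * B ≤ M) :
    0 ≤ nBlocks N B * logb (mBlocks M B) (nBlocks N B) := by
  have hm := two_le_mBlocks hB hM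
  rcases Nat.eq_zero_or_pos N with rfl | hN
  · simp [nBlocks]
  · have := one_le_nBlocks hN hB
    exact mul_nonneg (by linarith) (logb_nonneg (by linarith) this)

theorem ioBound_nonneg (hB : 1 ≤ B) (hM : 2 * B ≤ M) (hN : 1 ≤ N) (hpos : ∀ p ∈ pos, p ≤ N) :
    0 ≤ ioBound N M B pos := by
  have hm := two_le_mBlocks hB hM
  have hB' : (0 : ℝ) < B := by exact_mod_cast hB
  have hsum := sum_gaps_le hN hpos
  have hle : ∀ Δ ∈ gaps N pos, Δ ≤ N := fun Δ h => (List.le_sum_of_mem h).trans hsum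
  unfold ioBound
  rw [sub_nonneg]
  by_cases hNM : N < M
  · have : ((gaps N pos).map fun Δ : ℕ => (Δ : ℝ) / B * gapLog M B Δ).sum = 0 := by
      apply List.sum_eq_zero
      intro x hx
      obtain ⟨Δ, h, rfl⟩ := List.mem_map.1 hx
      simp [gapLog, (hle Δ h).trans_lt hNM]
    rw [this]
    exact nBlocks_mul_logb_nonneg hB hM
  · refine (sum_gapLog_le hB hM (by omega) _ hle).trans ?_
    have h1 : (1 : ℝ) ≤ (N : ℝ) / B := by
      rw [one_le_div hB']
      exact_mod_cast (by omega : B ≤ N)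
    have h2 := div_le_nBlocks N B
    have h3 : ((gaps N pos).sum : ℝ) / B ≤ (N : ℝ) / B := by gcongr
    exact mul_le_mul (h3.trans h2) (logb_le_logb_of_le (by linarith) (by linarith) h2)
      (logb_nonneg (by linarith) h1) (by linarith)

theorem sum_gapBound (hB : 1 ≤ B) (hM : 2 * B ≤ M) (l : List ℕ) (γ : ℝ) :
    (l.map (gapBound N M B γ)).sum = 4 * l.sum + (l.sum * log ((N : ℝ) / B) -
      B * log (mBlocks M B) * (l.map fun Δ : ℕ => (Δ : ℝ) / B * gapLog M B Δ).sum) / log γ := by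
  have hm := two_le_mBlocks hB hM
  have hB' : (0 : ℝ) < B := by exact_mod_cast hB
  have hlm : log (mBlocks M B) ≠ 0 := (log_pos (by linarith)).ne'
  induction l with
  | nil => simp
  | cons Δ l ih =>
    rw [List.map_cons, List.sum_cons, List.sum_cons, List.map_cons, List.sum_cons, ih]
    have : (if Δ < M then 0 else log ((Δ : ℝ) / B)) = log (mBlocks M B) * gapLog M B Δ := by
      unfold gapLog
      split_ifs
      · simp
      · rw [← log_div_log]
        field_simp
    unfold gapBound
    rw [this]
    have e : (B : ℝ) * log (mBlocks M B) * ((Δ : ℝ) / B * gapLog M B Δ +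
        (l.map fun Δ : ℕ => (Δ : ℝ) / B * gapLog M B Δ).sum) =
        Δ * (log (mBlocks M B) * gapLog M B Δ) + B * log (mBlocks M B) *
        (l.map fun Δ : ℕ => (Δ : ℝ) / B * gapLog M B Δ).sum := by
      field_simp
    rw [e]
    push_cast
    ring

theorem sum_dep_le (hB : 1 ≤ B) (hM : 2 * B ≤ M) (hBN : B ≤ N) (hpos : ∀ p ∈ pos, p ≤ N)
    (hg : 3 ≤ g) (hmg : log (mBlocks M B) ≤ 8 * log g)
    (hdep : ∀ x k, k < dep x → ∃ p ∈ pos, ((x - p) + (p - x)) * g ^ k ≤ N ∧ B * g ^ k ≤ N) :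
    ∑ x ∈ range N, (dep x : ℝ) ≤ B * (5 * nBlocks N B + 8 * ioBound N M B pos) := by
  have hN : 1 ≤ N := hB.trans hBN
  have hm := two_le_mBlocks hB hM
  have hB' : (0 : ℝ) < B := by exact_mod_cast hB
  have hN' : (0 : ℝ) < N := by exact_mod_cast hN
  have hg' : (0 : ℝ) < g := by exact_mod_cast (by omega : 0 < g)
  have hlm : 0 < log (mBlocks M B) := log_pos (by linarith)
  have hlg : 1 ≤ log g := by
    rw [le_log_iff_exp_le hg']
    have h3 : (3 : ℝ) ≤ g := by exact_mod_cast hg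
    linarith [exp_one_lt_d9]
  have hNB1 : (1 : ℝ) ≤ (N : ℝ) / B := (one_le_div hB').2 (by exact_mod_cast hBN)
  have hl0 : 0 ≤ log ((N : ℝ) / B) := log_nonneg hNB1
  have hd0 : (dep 0 : ℝ) ≤ N := by
    obtain ⟨k, h1, h2, _⟩ := dep_mul_log_le hB hBN hg hdep 0
    have h3 : (dep 0 : ℝ) ≤ k + 1 := by exact_mod_cast h1
    have h4 : (k : ℝ) ≤ log ((N : ℝ) / B) := by nlinarith [(Nat.cast_nonneg k : (0 : ℝ) ≤ k)]
    have h5 := log_le_sub_one_of_pos (by linarith : (0 : ℝ) < (N : ℝ) / B)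
    have h6 : (N : ℝ) / B ≤ N := div_le_self hN'.le (by exact_mod_cast hB)
    linarith
  obtain ⟨a, ha, h1, h2⟩ := exists_sum_Ico_le_gaps (f := fun x => (dep x : ℝ))
    (G := gapBound N M B g) hN hpos fun a b hab hb h => sum_dep_gap_le hB hBN hg hdep hab hb h
  have h3 : ∑ x ∈ range N, (dep x : ℝ) ≤ N + ∑ x ∈ Ico a N, (dep x : ℝ) := by
    rw [range_eq_Ico, ← sum_Ico_consecutive _ (Nat.zero_le a) (by omega : a ≤ N)]
    gcongr
    interval_cases a
    · simp
    · simpa using hd0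
  rw [sum_gapBound hB hM] at h1
  have hio := ioBound_nonneg hB hM hN hpos
  have hS : ((gaps N pos).sum : ℝ) ≤ N := by exact_mod_cast sum_gaps_le hN hpos
  set S := ((gaps N pos).map fun Δ : ℕ => (Δ : ℝ) / B * gapLog M B Δ).sum with hSdef
  have hn := div_le_nBlocks N B
  have hnB : (N : ℝ) ≤ B * nBlocks N B := by
    rw [div_le_iff₀ hB'] at hn
    linarith
  have h4 : (gaps N pos).sum * log ((N : ℝ) / B) ≤ B * nBlocks N B * log (nBlocks N B) :=
    mul_le_mul (hS.trans hnB) (log_le_log (by linarith) hn) hl0 (by linarith)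
  have h5 : B * nBlocks N B * log (nBlocks N B) - B * log (mBlocks M B) * S =
      B * log (mBlocks M B) * ioBound N M B pos := by
    unfold ioBound
    rw [← hSdef, ← log_div_log]
    field_simp
  have h6 : ((gaps N pos).sum * log ((N : ℝ) / B) - B * log (mBlocks M B) * S) / log g ≤
      8 * (B * ioBound N M B pos) := by
    rw [div_le_iff₀ (by linarith)]
    have : log (mBlocks M B) * (B * ioBound N M B pos) ≤ 8 * log g * (B * ioBound N M B pos) :=
      mul_le_mul_of_nonneg_right hmg (by positivity)
    linarith
  linarith

end GapBound

/-! ### The constants -/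

section Constants

open Real

variable {N M B : ℕ}

theorem mBlocks_le_gFac (hB : 1 ≤ B) : mBlocks M B ≤ ((gFac M B : ℝ) + 1) ^ 4 := by
  have h1 : M / B < ((M / B).sqrt + 1) * ((M / B).sqrt + 1) := Nat.lt_succ_sqrt _
  have h2 : (M / B).sqrt + 1 ≤ (gFac M B + 1) * (gFac M B + 1) :=
    Nat.lt_succ_sqrt (M / B).sqrt
  have h3 : M / B + 1 ≤ (gFac M B + 1) ^ 4 :=
    calc M / B + 1 ≤ ((M / B).sqrt + 1) * ((M / B).sqrt + 1) := h1
      _ ≤ ((gFac M B + 1) * (gFac M B + 1)) * ((gFac M B + 1) * (gFac M B + 1)) :=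
        Nat.mul_le_mul h2 h2
      _ = _ := by ring
  have h4 : M ≤ B * (gFac M B + 1) ^ 4 :=
    (Nat.lt_mul_div_succ M hB).le.trans (Nat.mul_le_mul_left _ h3)
  unfold mBlocks
  rw [div_le_iff₀ (by exact_mod_cast hB), mul_comm]
  exact_mod_cast h4

theorem log_mBlocks_le (hB : 1 ≤ B) (hM : 2 * B ≤ M) (hg : Good N M B) :
    log (mBlocks M B) ≤ 8 * log (gFac M B) := by
  have h16 : (16 : ℝ) ≤ gFac M B := by exact_mod_cast hg.gFac_ge
  have hm := two_le_mBlocks hB hM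
  calc log (mBlocks M B) ≤ log (((gFac M B : ℝ) ^ 2) ^ 4) := by
        apply log_le_log (by linarith)
        refine (mBlocks_le_gFac hB).trans ?_
        gcongr
        nlinarith
    _ = 8 * log (gFac M B) := by
        rw [← pow_mul, log_pow]
        norm_num

/-- The tall cache assumption in terms of the number of blocks. -/
theorem mul_rpow_le_mBlocks {a ε : ℝ} (hB : 1 ≤ B) (h : a * (B : ℝ) ^ (1 + ε) ≤ M) :
    a * (B : ℝ) ^ ε ≤ mBlocks M B := by
  have hB' : (0 : ℝ) < B := by exact_mod_cast hB
  unfold mBlocks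
  rw [le_div_iff₀ hB']
  rw [rpow_add hB', rpow_one] at h
  linarith

theorem log_block_le {a ε : ℝ} (ha : 0 < a) (hε : 0 < ε) (hB : 1 ≤ B) (hM : 2 * B ≤ M)
    (hg : Good N M B) (h : a * (B : ℝ) ^ (1 + ε) ≤ M) :
    log B ≤ (8 + |log a|) / ε * log (gFac M B) := by
  have hB' : (0 : ℝ) < B := by exact_mod_cast hB
  have h1 := log_le_log (by positivity) (mul_rpow_le_mBlocks hB h)
  rw [log_mul ha.ne' (by positivity), log_rpow hB'] at h1
  have h2 := log_mBlocks_le hB hM hg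
  have h16 : (16 : ℝ) ≤ gFac M B := by exact_mod_cast hg.gFac_ge
  have h3 : 1 ≤ log (gFac M B) := by
    rw [le_log_iff_exp_le (by linarith)]
    linarith [exp_one_lt_d9]
  have h4 := neg_abs_le (log a)
  rw [div_mul_eq_mul_div, le_div_iff₀ hε]
  nlinarith [abs_nonneg (log a)]

theorem levels_le {a ε : ℝ} (ha : 0 < a) (hε : 0 < ε) (hM : 2 * B ≤ M)
    (hg : Good N M B) (h : a * (B : ℝ) ^ (1 + ε) ≤ M) (hBN : B < N) :
    ((Nat.log (gFac M B) N : ℝ) + 2) * (topLev N M B + 1) ≤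
      (14 + (8 + |log a|) / ε) * logb B N := by
  have hB16 : 16 ≤ B := hg.1
  have hK := log_block_le ha hε (by omega) hM hg h
  set K := (8 + |log a|) / ε
  have hg16 := hg.gFac_ge
  set g := gFac M B with hgdef
  have hgr : (16 : ℝ) ≤ g := by exact_mod_cast hg16
  have hlg : 0 < log g := log_pos (by linarith)
  have hBr : (16 : ℝ) ≤ B := by exact_mod_cast hB16
  have hlB : 0 < log B := log_pos (by linarith)
  have hNr : (B : ℝ) < N := by exact_mod_cast hBN
  have hlBN : log B ≤ log N := log_le_log (by linarith) hNr.le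
  have hL : (Nat.log g N : ℝ) * log g ≤ log N := by
    rw [← log_pow]
    apply log_le_log (by positivity)
    exact_mod_cast Nat.pow_log_le_self g (by omega)
  have hfan4 : 4 ≤ fan B := by unfold fan; omega
  have hfan : B ≤ fan B ^ 3 := by
    have : B ≤ 4 * fan B + 3 := by unfold fan; omega
    nlinarith [Nat.mul_le_mul hfan4 hfan4]
  have hfr : (4 : ℝ) ≤ fan B := by exact_mod_cast hfan4
  have hlf : log B ≤ 3 * log (fan B) := by
    have : log B ≤ log ((fan B : ℝ) ^ 3) := log_le_log (by linarith) (by exact_mod_cast hfan)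
    rwa [log_pow] at this
  have hJ : fan B ^ topLev N M B ≤ min (fMax M B) N :=
    Nat.pow_log_le_self _ (by unfold fMax; omega)
  have hJ' : ∀ y : ℝ, (fan B : ℝ) ^ topLev N M B ≤ y → topLev N M B * log B ≤ 3 * log y := by
    intro y hy
    have := log_le_log (by positivity) hy
    rw [log_pow] at this
    nlinarith [(Nat.cast_nonneg (topLev N M B) : (0 : ℝ) ≤ topLev N M B)]
  have hJN := hJ' N (by exact_mod_cast hJ.trans (min_le_right _ _))
  have hJg := hJ' ((g : ℝ) ^ 2) (by
    have h8 : ((fan B ^ topLev N M B : ℕ) : ℝ) ≤ (8 * g : ℕ) := by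
      exact_mod_cast hJ.trans (min_le_left _ _)
    push_cast at h8
    nlinarith)
  rw [log_pow] at hJg
  rw [← log_div_log, ← mul_div_assoc, le_div_iff₀ hlB]
  set L : ℝ := (Nat.log g N : ℝ) with hLd
  set J : ℝ := (topLev N M B : ℝ) with hJd
  have hL0 : 0 ≤ L := Nat.cast_nonneg _
  have hK0 : 0 ≤ K := by positivity
  have e1 : L * (J * log B) ≤ L * (6 * log g) :=
    mul_le_mul_of_nonneg_left (by push_cast at hJg; linarith) hL0
  have e2 : L * log B ≤ L * (K * log g) := mul_le_mul_of_nonneg_left hK hL0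
  have e3 : K * (L * log g) ≤ K * log N := mul_le_mul_of_nonneg_left hL hK0
  linarith

/-- The array lengths for which no tree is built are bounded. -/
theorem le_of_not_good {a ε c : ℝ} (ha : 0 < a) (hε : 0 < ε) (hc : 0 < c) (hB : 1 ≤ B)
    (hg : ¬ Good N M B) (h : a * (B : ℝ) ^ (1 + ε) ≤ M) (hN : 1 ≤ N)
    (hlog : logb 2 (N : ℝ) ≤ c * B) :
    (N : ℝ) ≤ 2 ^ (c * (16 + ((2 ^ 16 + (c + 9) ^ 4) / a) ^ (1 / ε))) := by
  have hB' : (1 : ℝ) ≤ B := by exact_mod_cast hB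
  have hNp : (0 : ℝ) < N := by exact_mod_cast hN
  have hX : 0 ≤ ((2 ^ 16 + (c + 9) ^ 4) / a) ^ (1 / ε) := by positivity
  have key : mBlocks M B ≤ 2 ^ 16 + (c + 9) ^ 4 →
      (B : ℝ) ≤ ((2 ^ 16 + (c + 9) ^ 4) / a) ^ (1 / ε) := by
    intro hm
    have h1 := (mul_rpow_le_mBlocks hB h).trans hm
    have h2 : (B : ℝ) ^ ε ≤ (2 ^ 16 + (c + 9) ^ 4) / a := by
      rw [le_div_iff₀ ha]
      linarith
    have h3 := rpow_le_rpow (by positivity) h2 (by positivity : 0 ≤ 1 / ε)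
    rwa [← rpow_mul (by linarith), mul_one_div_cancel hε.ne', rpow_one] at h3
  have hBle : (B : ℝ) ≤ 16 + ((2 ^ 16 + (c + 9) ^ 4) / a) ^ (1 / ε) := by
    by_cases h16 : 16 ≤ B
    · suffices mBlocks M B ≤ 2 ^ 16 + (c + 9) ^ 4 by linarith [key this]
      by_cases hm : 2 ^ 16 ≤ M / B
      · have h1 : B * gFac M B < Nat.log 2 N + 8 := by
          by_contra h2
          exact hg ⟨h16, hm, by omega⟩
        have h2 : (B : ℝ) * gFac M B < Nat.log 2 N + 8 := by exact_mod_cast h1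
        have h3 : (Nat.log 2 N : ℝ) ≤ logb 2 N := by
          exact_mod_cast natLog_le_logb N 2
        have h4 : (gFac M B : ℝ) ≤ c + 8 := by
          by_contra h5
          push Not at h5
          nlinarith
        have h5 : ((gFac M B : ℝ) + 1) ^ 4 ≤ (c + 9) ^ 4 :=
          pow_le_pow_left₀ (by positivity) (by linarith) 4
        linarith [mBlocks_le_gFac (M := M) hB]
      · have h1 : M ≤ B * 2 ^ 16 :=
          (Nat.lt_mul_div_succ M hB).le.trans (Nat.mul_le_mul_left _ (by omega))
        have h2 : mBlocks M B ≤ 2 ^ 16 := by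
          unfold mBlocks
          rw [div_le_iff₀ (by linarith), mul_comm]
          exact_mod_cast h1
        have : 0 ≤ (c + 9) ^ 4 := by positivity
        linarith
    · have : (B : ℝ) ≤ 16 := by exact_mod_cast (by omega : B ≤ 16)
      linarith
  rw [← logb_le_iff_le_rpow one_lt_two hNp]
  exact hlog.trans (mul_le_mul_of_nonneg_left hBle hc.le)

end Constants

section Main

variable {α : Type u} [LinearOrder α] {N M B : ℕ}

theorem Query.pos_le (A : Fin N → α) (Q : Query α N) : Q.pos A ≤ N := by
  cases Q with
  | select i => exact i.isLt
  | search p =>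
    by_cases h : ∃ i, A i = p
    · obtain ⟨i, hi⟩ := h
      have : (Finset.univ.filter fun j => A j < p).card < (Finset.univ : Finset (Fin N)).card := by
        apply Finset.card_lt_card
        rw [Finset.filter_ssubset]
        exact ⟨i, Finset.mem_univ _, by simp [hi]⟩
      rw [Finset.card_fin] at this
      simp only [Query.pos, searchPos, if_pos (⟨i, hi⟩ : ∃ i, A i = p)]
      omega
    · have := Finset.card_filter_le (Finset.univ : Finset (Fin N)) (fun j => A j < p)
      rw [Finset.card_fin] at this
      simp only [Query.pos, searchPos, if_neg h]
      omega

theorem ioBound_zero_nil (hB : 1 ≤ B) (hM : 2 * B ≤ M) : ioBound 0 M B [] = 0 := by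
  have : gaps 0 [] = [1] := by decide
  simp [ioBound, this, gapLog, nBlocks, (by omega : 1 < M)]

theorem min_mul_logb_nonneg (hB : 1 ≤ B) (q : ℕ) :
    0 ≤ min ((q : ℝ) * mBlocks M B) (N : ℝ) * Real.logb (B : ℝ) (N : ℝ) := by
  apply mul_nonneg
  · exact le_min (mul_nonneg (Nat.cast_nonneg _) (by unfold mBlocks; positivity))
      (Nat.cast_nonneg _)
  · rcases Nat.eq_zero_or_pos N with rfl | hN
    · simp
    · rw [← Real.log_div_log]
      exact div_nonneg (Real.log_nonneg (by exact_mod_cast hN))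
        (Real.log_nonneg (by exact_mod_cast hB))

theorem serve_tree_cost {a ε κ : ℝ} (ha : 0 < a) (hε : 0 < ε) (hκ : 0 < κ) (hM : 2 * B ≤ M)
    (hg : Good N M B) (h : a * (B : ℝ) ^ (1 + ε) ≤ M) (hBN : B < N)
    (A : Fin N → α) (qs : List (Query α N)) (hq : (qs.length : ℝ) ≤ κ * N) :
    ∃ t : ℕ, ServesAll (prog N M B) (initial (M + 21) B A) qs (qs.map (Query.correct A)) t ∧
      (t : ℝ) ≤ 136 * ioBound N M B (qs.map (Query.pos A)) +
        24 * (1 + κ) * (14 + (8 + |Real.log a|) / ε) *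
          (min ((qs.length : ℝ) * mBlocks M B) (N : ℝ) * Real.logb B N) +
        85 * nBlocks N B := by
  have hB : 1 ≤ B := le_trans (by norm_num) hg.1
  have hB' : (0 : ℝ) < B := by exact_mod_cast hB
  obtain ⟨t, dep, h1, h2, h3⟩ := serve_tree (by omega) hg hBN A qs
  refine ⟨t, h1, ?_⟩
  have hpos : ∀ p ∈ qs.map (Query.pos A), p ≤ N := by
    intro p hp
    obtain ⟨Q, -, rfl⟩ := List.mem_map.1 hp
    exact Q.pos_le A
  have h4 := sum_dep_le hB hM hBN.le hpos (by have := hg.gFac_ge; omega)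
    (log_mBlocks_le hB hM hg) h2
  have h5 := levels_le ha hε hM hg h hBN
  have h6 : (t : ℝ) * B ≤ qs.length * (((Nat.log (gFac M B) N : ℝ) + 2) *
      (24 * (topLev N M B + 1) * B)) + 17 * ∑ x ∈ Finset.range N, (dep x : ℝ) := by
    exact_mod_cast h3
  have hm := two_le_mBlocks hB hM
  have hN0 : (0 : ℝ) ≤ N := Nat.cast_nonneg _
  have hq0 : (0 : ℝ) ≤ qs.length := Nat.cast_nonneg _
  have h7 : (qs.length : ℝ) ≤ (1 + κ) * min ((qs.length : ℝ) * mBlocks M B) (N : ℝ) := by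
    rcases min_cases ((qs.length : ℝ) * mBlocks M B) (N : ℝ) with ⟨e, _⟩ | ⟨e, _⟩
    · rw [e]
      have : (qs.length : ℝ) ≤ qs.length * mBlocks M B := le_mul_of_one_le_right hq0 (by linarith)
      nlinarith
    · rw [e]
      linarith
  have h8 : 0 ≤ ((Nat.log (gFac M B) N : ℝ) + 2) * (topLev N M B + 1) := by positivity
  have h9 := mul_le_mul h7 h5 h8 (hq0.trans h7)
  have h10 : (t : ℝ) * B ≤ (24 * (qs.length * (((Nat.log (gFac M B) N : ℝ) + 2) *
      (topLev N M B + 1))) + 17 * (5 * nBlocks N B +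
        8 * ioBound N M B (qs.map (Query.pos A)))) * B := by linarith
  have h11 := le_of_mul_le_mul_right h10 hB'
  linarith

theorem serve_brute_cost {a ε c κ : ℝ} (ha : 0 < a) (hε : 0 < ε) (hc : 0 < c) (hκ : 0 < κ)
    (hB : 1 ≤ B) (hM : 2 * B ≤ M) (hg : ¬ Good N M B) (h : a * (B : ℝ) ^ (1 + ε) ≤ M)
    (hlog : Real.logb 2 (N : ℝ) ≤ c * B) (hBN : B < N)
    (A : Fin N → α) (qs : List (Query α N)) (hq : (qs.length : ℝ) ≤ κ * N) {T : ℝ}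
    (hT : T = 2 ^ (c * (16 + ((2 ^ 16 + (c + 9) ^ 4) / a) ^ (1 / ε)))) :
    ∃ t : ℕ, ServesAll (prog N M B) (initial (M + 21) B A) qs (qs.map (Query.correct A)) t ∧
      (t : ℝ) ≤ κ * T * ((T + 2) * (T + 2)) * nBlocks N B := by
  obtain ⟨t, h1, h2⟩ := serve_brute hM hB hg hBN A qs
  refine ⟨t, h1, ?_⟩
  have hN : 1 ≤ N := by omega
  have hNT : (N : ℝ) ≤ T := hT ▸ le_of_not_good ha hε hc hB hg h hN hlog
  have hN0 : (0 : ℝ) ≤ N := Nat.cast_nonneg _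
  have hT0 : 0 ≤ T := hN0.trans hNT
  have h3 : (t : ℝ) ≤ qs.length * (((N : ℝ) + 2) * (N + 2)) := by exact_mod_cast h2
  calc (t : ℝ) ≤ qs.length * (((N : ℝ) + 2) * (N + 2)) := h3
    _ ≤ (κ * T) * ((T + 2) * (T + 2)) := by
      gcongr
      exact hq.trans (by gcongr)
    _ ≤ κ * T * ((T + 2) * (T + 2)) * nBlocks N B :=
      le_mul_of_one_le_right (by positivity) (one_le_nBlocks hN hB)

end Main

end ExtMem

theorem mainTheorem5 :
    -- `r` extra registers, and integers of `O(log N)` bits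
    ∃ (r k : ℕ) (P : (N M B : ℕ) → ExtMem.Program (M + r) ((N + 2) ^ k)),
      ∀ c a ε κ : ℝ, 0 < c → 0 < a → 0 < ε → 0 < κ →
      ∃ C : ℝ, 0 < C ∧
      ∀ N M B : ℕ, 1 ≤ B → 2 * B ≤ M →
        -- tall cache: `M = Ω(B ^ (1 + ε))`
        a * (B : ℝ) ^ (1 + ε) ≤ (M : ℝ) →
        -- `log N = O(B)`
        Real.logb 2 (N : ℝ) ≤ c * (B : ℝ) →
      ∀ (α : Type*) [LinearOrder α] (A : Fin N → α) (qs : List (ExtMem.Query α N)),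
        -- `q = O(N)`
        (qs.length : ℝ) ≤ κ * (N : ℝ) →
        ∃ t : ℕ,
          ExtMem.ServesAll (P N M B) (ExtMem.initial (M + r) B A) qs
            (qs.map (ExtMem.Query.correct A)) t ∧
          (t : ℝ) ≤
            C * (ExtMem.ioBound N M B (qs.map (ExtMem.Query.pos A))
              + min ((qs.length : ℝ) * ExtMem.mBlocks M B) (N : ℝ) * Real.logb (B : ℝ) (N : ℝ)
              + ExtMem.nBlocks N B) := by
  refine ⟨21, 20, ExtMem.prog, fun c a ε κ hc ha hε hκ => ?_⟩
  obtain ⟨T, hT⟩ : ∃ T : ℝ, T = 2 ^ (c * (16 + ((2 ^ 16 + (c + 9) ^ 4) / a) ^ (1 / ε))) := ⟨_, rfl⟩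
  have hT0 : 0 < T := by rw [hT]; positivity
  obtain ⟨C₁, hC₁⟩ : ∃ C₁ : ℝ, C₁ = 24 * (1 + κ) * (14 + (8 + |Real.log a|) / ε) := ⟨_, rfl⟩
  have hC₁0 : 0 < C₁ := by rw [hC₁]; positivity
  obtain ⟨C₂, hC₂⟩ : ∃ C₂ : ℝ, C₂ = κ * T * ((T + 2) * (T + 2)) := ⟨_, rfl⟩
  have hC₂0 : 0 < C₂ := by rw [hC₂]; positivity
  refine ⟨136 + C₁ + C₂, by positivity, ?_⟩
  intro N M B hB hM htall hlog α _ A qs hq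
  have hmin := ExtMem.min_mul_logb_nonneg (N := N) (M := M) hB qs.length
  have hn := ExtMem.nBlocks_nonneg N B
  rcases Nat.eq_zero_or_pos N with rfl | hN
  · have h0 : qs = [] := by
      rw [← List.length_eq_zero_iff]
      exact_mod_cast le_antisymm (by simpa using hq) (Nat.cast_nonneg qs.length)
    subst h0
    refine ⟨0, ExtMem.ServesAll.nil _, ?_⟩
    rw [List.map_nil, ExtMem.ioBound_zero_nil hB hM]
    refine Nat.cast_zero.le.trans (mul_nonneg (by positivity) (by linarith))
  · have hio : 0 ≤ ExtMem.ioBound N M B (qs.map (ExtMem.Query.pos A)) := by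
      refine ExtMem.ioBound_nonneg hB hM hN fun p hp => ?_
      obtain ⟨Q, -, rfl⟩ := List.mem_map.1 hp
      exact Q.pos_le A
    rcases Nat.lt_or_ge B N with hBN | hNB
    · by_cases hg : ExtMem.Good N M B
      · obtain ⟨t, h1, h2⟩ := ExtMem.serve_tree_cost ha hε hκ hM hg htall hBN A qs hq
        refine ⟨t, h1, h2.trans ?_⟩
        rw [← hC₁]
        have e1 := mul_nonneg (add_pos hC₁0 hC₂0).le hio
        have e2 := mul_nonneg (by positivity : 0 ≤ 136 + C₂) hmin
        have e3 := mul_nonneg (by positivity : 0 ≤ 51 + C₁ + C₂) hn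
        linarith
      · obtain ⟨t, h1, h2⟩ :=
          ExtMem.serve_brute_cost ha hε hc hκ hB hM hg htall hlog hBN A qs hq hT
        refine ⟨t, h1, h2.trans ?_⟩
        rw [← hC₂]
        have e1 := mul_nonneg (by positivity : 0 ≤ 136 + C₁ + C₂) (add_nonneg hio hmin)
        have e2 := mul_nonneg (by positivity : 0 ≤ 136 + C₁) hn
        linarith
    · obtain ⟨t, h1, h2, -⟩ := ExtMem.serve_resident (by omega : B ≤ M) hNB A qs
      refine ⟨t, h1, ?_⟩
      have h3 : (t : ℝ) ≤ 1 := by exact_mod_cast h2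
      have h4 := ExtMem.one_le_nBlocks hN hB
      have e1 := mul_nonneg (by positivity : 0 ≤ 136 + C₁ + C₂) (add_nonneg hio hmin)
      have e2 := mul_nonneg (by positivity : 0 ≤ 135 + C₁ + C₂) hn
      linarith
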